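/- Notation. For integers $l\ge 0$, $|m|\le l$ let $Y_{lm}$ be the orthonormal complex spherical harmonics on the unit sphere of $\mathbb R^3$ (Condon–Shortley phase), $\hat v=v/|v|$, and let $j_l$, $h^{(1)}_l$ be the spherical Bessel function and the outgoing spherical Hankel function, $K_\nu$ the modified Bessel function of the second kind. (For $v=0$ the product $j_l(\omega|v|)Y_{lm}(\hat v)$ is $\delta_{l0}/\sqrt{4\pi}$.) Put $$C\begin{pmatrix} l&l'&l''\\ m&m'&m''\end{pmatrix}=4\pi\int d\Omega\; Y_{lm}Y_{l'm'}^*Y_{l''m''}^* .$$ Let $P_A\neq P_B$ be points of $\mathbb R^3$, $\vec a=P_B-P_A$, $a=|\vec a|$. For points $x$ (in body $A$) and $y$ (in body $B$) put $\vec r=x-P_A$, $\vec r'=y-P_B$, $r=|\vec r|$, $r'=|\vec r'|$. For complex $\omega\ne0$ put $$G_\omega(x,y)=-\frac{e^{i\omega|x-y|}}{4\pi|x-y|},\qquad \mathcal C_{lm;l'm'}(\omega)=-\frac{i\pi}{2\omega}\sum_{l'',m''}C\begin{pmatrix} l&l'&l''\\ m&m'&m''\end{pmatrix}i^{\,l''+l'-l}\,h^{(1)}_{l''}(\omega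 a)\,Y_{l''m''}(\hat a).$$ Let $\omega>0$. Then the following hold. 1. For all indices, $$C\begin{pmatrix} l&l'&l''\\ m&m'&m''\end{pmatrix}=(-1)^m\sqrt{4\pi(2l+1)(2l'+1)(2l''+1)}\begin{pmatrix} l&l'&l''\\0&0&0\end{pmatrix}\begin{pmatrix} l&l'&l''\\ m&-m'&-m''\end{pmatrix}$$ with Wigner $3j$ symbols on the right; for fixed $(l,m),(l',m')$ only finitely many of these coefficients are nonzero, so the sum defining $\mathcal C_{lm;l'm'}$ is finite. 2. With the free spherical waves $|(lm)_A\rangle=\sqrt{2\omega^2/\pi}\,j_l(\omega r)Y_{lm}(\hat r)$ and $|(l'm')_B\rangle=\sqrt{2\omega^2/\pi}\,j_{l'}(\omega r')Y_{l'm'}(\hat r')$, $$G_\omega=\sum_{lm;\,l'm'}|(l'm')_B\rangle\,\mathcal C_{lm;l'm'}(\omega)\,\langle(lm)_A| ,$$ that is, $$-\frac{e^{i\omega|x-y|}}{4\pi|x-y|}=\frac{2\omega^2}{\pi}\sum_{lm;\,l'm'}j_{l'}(\omega r')Y_{l'm'}(\hat r')\,\mathcal C_{lm;l'm'}(\omega)\,j_l(\omega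 r)Y_{lm}^*(\hat r).$$ The double series converges unconditionally to the left-hand side whenever $r+r'<a$. More generally, whenever $r'<a$ and $r<|\vec a+\vec r'|$, the identity holds as an iterated series: for each $(l,m)$ the inner sum over $(l',m')$ converges unconditionally, and then so does the outer sum over $(l,m)$, to the left-hand side. 3. (Wick rotation.) With $$g_{lm;l'm'}=\sum_{l'',m''}C\begin{pmatrix} l&l'&l''\\ m&m'&m''\end{pmatrix}\sqrt{\frac{2}{\pi\omega a}}\,K_{l''+\frac12}(\omega a)\,Y_{l''m''}(\hat a)$$ one has $$\mathcal C_{lm;l'm'}(i\omega)=\frac{\pi}{2\omega}\,i^{\,l'-l}\,g_{lm;l'm'} .$$ If $\varphi_a$ is the azimuthal angle of $\vec a$ (taken to be $0$ when $\vec a$ lies on the $z$-axis), then $g_{lm;l'm'}e^{-i(m-m')\varphi_a}$ is real; in particular $g_{lm;l'm'}$ is real if $\vec a$ lies on the $z$-axis. Moreover $$-\frac{e^{-\omega|x-y|}}{4\pi|x-y|}=\frac{2(i\omega)^2}{\pi}\sum_{lm;\,l'm'}j_{l'}(i\omega r')Y_{l'm'}(\hat r')\,\mathcal C_{lm;l'm'}(i\omega)\,j_l(i\omega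 r)Y_{lm}^*(\hat r),$$ with the same two modes of convergence under the same conditions as in 2. -/

import Mathlib

noncomputable section

namespace SphericalWaves

open Complex

/-- Three-dimensional Euclidean space. -/
abbrev E3 : Type := EuclideanSpace ℝ (Fin 3)

/-- Angular momentum labels `(l, m)`: `l = 0, 1, 2, …` and `m = -l, …, l`. -/
abbrev LM : Type := {p : ℕ × ℤ // |p.2| ≤ (p.1 : ℤ)}

/-- The label `l` of `(l, m)`. -/
def LM.l (p : LM) : ℕ := p.1.1

/-- The label `m` of `(l, m)`. -/
def LM.m (p : LM) : ℤ := p.1.2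

/-- The spherical harmonic `Y_{ln}` with `0 ≤ n ≤ l`, at the direction of `x`. In polar coordinates
`cos θ = x₂ / ‖x‖`, `sin θ * exp (i φ) = (x₀ + i x₁) / ‖x‖`, it is
`(-1)^n √((2l+1)/(4π) (l-n)!/(l+n)!) P_l^n(cos θ) exp (i n φ)`, where
`P_l^n(u) = (1 - u²)^(n/2) / (2^l l!) (d/du)^(l+n) (u² - 1)^l`. -/
def harmonicNonneg (l n : ℕ) (x : E3) : ℂ :=
  (-1) ^ n
    * (Real.sqrt ((2 * l + 1) / (4 * Real.pi)
        * ((l - n).factorial / (l + n).factorial)) : ℝ)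
    * (((Polynomial.derivative^[l + n] ((Polynomial.X ^ 2 - 1 : Polynomial ℝ) ^ l)).eval
        (x 2 / ‖x‖) / (2 ^ l * l.factorial) : ℝ) : ℂ)
    * (((x 0 : ℂ) + I * (x 1 : ℂ)) / (‖x‖ : ℂ)) ^ n

/-- The orthonormal spherical harmonic `Y_{lm}` (Condon–Shortley phase) at the direction `x / ‖x‖`;
`Y_{l,-m} = (-1)^m` times the complex conjugate of `Y_{lm}`. -/
def sphericalHarmonic (p : LM) (x : E3) : ℂ :=
  if 0 ≤ p.m then harmonicNonneg p.l p.m.natAbs x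
  else (-1) ^ p.m.natAbs * (starRingEnd ℂ) (harmonicNonneg p.l p.m.natAbs x)

/-- The unit vector with polar angle `θ` and azimuth `φ`. -/
def direction (θ φ : ℝ) : E3 :=
  !₂[Real.sin θ * Real.cos φ, Real.sin θ * Real.sin φ, Real.cos θ]

/-- The integral over the unit sphere, `∫ dΩ f`. -/
def solidAngleIntegral (f : E3 → ℂ) : ℂ :=
  ∫ θ in (0 : ℝ)..Real.pi, ∫ φ in (0 : ℝ)..(2 * Real.pi),
    f (direction θ φ) * (Real.sin θ : ℂ)

/-- The spherical Bessel function `j_l` (its everywhere convergent power series). -/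
def sphericalBessel (l : ℕ) (z : ℂ) : ℂ :=
  ∑' k : ℕ, (-1) ^ k * z ^ (l + 2 * k)
    / (2 ^ k * (k.factorial : ℂ) * (Nat.doubleFactorial (2 * l + 2 * k + 1) : ℂ))

/-- The outgoing spherical Hankel function `h_l^{(1)}`, in closed form. -/
def sphericalHankel (l : ℕ) (z : ℂ) : ℂ :=
  exp (I * z) * ∑ k ∈ Finset.range (l + 1),
    I ^ ((k : ℤ) - l - 1) * ((l + k).factorial : ℂ)
      / (2 ^ k * (k.factorial : ℂ) * ((l - k).factorial : ℂ) * z ^ (k + 1))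

/-- The modified Bessel function of the second kind `K_ν(x)`, `x > 0`. -/
def besselK (ν x : ℝ) : ℝ :=
  ∫ t in Set.Ioi (0 : ℝ), Real.exp (-x * Real.cosh t) * Real.cosh (ν * t)

/-- `1 / n!`, with value `0` at negative integers. -/
def invFactorial (n : ℤ) : ℝ := if 0 ≤ n then 1 / (n.toNat.factorial : ℝ) else 0

/-- The Wigner 3j symbol with integer angular momenta, by Racah's formula. It vanishes unless
`m₁ + m₂ + m₃ = 0`, `|mᵢ| ≤ jᵢ` and the `jᵢ` satisfy the triangle inequalities. -/
def wigner3j (j₁ j₂ j₃ : ℕ) (m₁ m₂ m₃ : ℤ) : ℝ :=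
  if m₁ + m₂ + m₃ = 0 ∧ |m₁| ≤ (j₁ : ℤ) ∧ |m₂| ≤ (j₂ : ℤ) ∧ |m₃| ≤ (j₃ : ℤ)
      ∧ j₃ ≤ j₁ + j₂ ∧ j₁ ≤ j₂ + j₃ ∧ j₂ ≤ j₁ + j₃ then
    (-1) ^ ((j₁ : ℤ) - j₂ - m₃)
      * Real.sqrt (((j₁ + j₂ - j₃).factorial * (j₁ + j₃ - j₂).factorial
          * (j₂ + j₃ - j₁).factorial : ℝ) / (j₁ + j₂ + j₃ + 1).factorial)
      * Real.sqrt ((j₁ + m₁).toNat.factorial * (j₁ - m₁).toNat.factorial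
          * (j₂ + m₂).toNat.factorial * (j₂ - m₂).toNat.factorial
          * (j₃ + m₃).toNat.factorial * (j₃ - m₃).toNat.factorial)
      * ∑ t ∈ Finset.range (j₁ + j₂ + 1),
          (-1) ^ t * invFactorial t * invFactorial (j₃ - j₂ + t + m₁)
            * invFactorial (j₃ - j₁ + t - m₂) * invFactorial (j₁ + j₂ - j₃ - t)
            * invFactorial (j₁ - t - m₁) * invFactorial (j₂ - t + m₂)
  else 0

/-- The Gaunt coefficient `C(l l' l''; m m' m'') = 4π ∫ dΩ Y_{lm} Y_{l'm'}^* Y_{l''m''}^*`. -/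
def gauntC (p p' p'' : LM) : ℂ :=
  4 * Real.pi * solidAngleIntegral (fun n =>
    sphericalHarmonic p n * (starRingEnd ℂ) (sphericalHarmonic p' n)
      * (starRingEnd ℂ) (sphericalHarmonic p'' n))

/-- The free propagator `-exp (i ω |x - y|) / (4π |x - y|)` at (complex) frequency `ω`. -/
def freePropagator (ω : ℂ) (x y : E3) : ℂ :=
  -exp (I * ω * (‖x - y‖ : ℂ)) / (4 * Real.pi * (‖x - y‖ : ℂ))

/-- The free spherical wave `√(2ω²/π) j_l(ωr) Y_{lm}(r̂)` centred at the origin, `ω` real. -/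
def sphericalWave (ω : ℝ) (p : LM) (r : E3) : ℂ :=
  (Real.sqrt (2 * ω ^ 2 / Real.pi) : ℝ) * sphericalBessel p.l ((ω : ℂ) * (‖r‖ : ℂ))
    * sphericalHarmonic p r

/-- The coefficient `𝒞_{lm;l'm'}(ω)` for the separation vector `a`, at (complex) frequency `ω`. -/
def transferCoeff (ω : ℂ) (a : E3) (p p' : LM) : ℂ :=
  -(I * Real.pi / (2 * ω)) * ∑' p'' : LM,
    gauntC p p' p'' * I ^ ((p''.l : ℤ) + p'.l - p.l)
      * sphericalHankel p''.l (ω * (‖a‖ : ℂ)) * sphericalHarmonic p'' a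

/-- The Wick-rotated coefficient `g_{lm;l'm'}`. -/
def wickCoeff (ω : ℝ) (a : E3) (p p' : LM) : ℂ :=
  ∑' p'' : LM, gauntC p p' p''
    * (Real.sqrt (2 / (Real.pi * ω * ‖a‖)) : ℝ)
    * (besselK ((p''.l : ℝ) + 1 / 2) (ω * ‖a‖) : ℝ) * sphericalHarmonic p'' a

/-- The `(lm; l'm')` term of the expansion at real frequency:
`⟨y|(l'm')_B⟩ 𝒞_{lm;l'm'}(ω) ⟨(lm)_A|x⟩`. -/
def expansionTerm (ω : ℝ) (PA PB x y : E3) (p p' : LM) : ℂ :=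
  sphericalWave ω p' (y - PB) * transferCoeff ω (PB - PA) p p'
    * (starRingEnd ℂ) (sphericalWave ω p (x - PA))

/-- The `(lm; l'm')` term continued analytically to the frequency `i ω`, `ω` real. -/
def wickTerm (ω : ℝ) (PA PB x y : E3) (p p' : LM) : ℂ :=
  (2 * (I * ω) ^ 2 / Real.pi)
    * (sphericalBessel p'.l (I * ω * (‖y - PB‖ : ℂ)) * sphericalHarmonic p' (y - PB))
    * transferCoeff (I * ω) (PB - PA) p p'
    * (sphericalBessel p.l (I * ω * (‖x - PA‖ : ℂ))
        * (starRingEnd ℂ) (sphericalHarmonic p (x - PA)))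

end SphericalWaves

end

open SphericalWaves

/-! ### Moments of complex linear forms over the unit sphere. -/

noncomputable section
namespace SphericalWaves
open Complex

/-! The angular part rests on one integral: for complex `v`, the moment ∫ (v·n)^N dΩ is 4π/(N+1)
(v·v)^(N/2) for even N and 0 for odd N (`solidAngleIntegral_linear_pow`). For the null vector ζ(τ) =
`nullVec τ`, quadratic in τ, the coefficient of τ^(l+m) in (ζ(τ)·n)^l is Y_{lm} up to normalisation
(`sphericalHarmonic_eq_coeff`), so integrals of products of harmonics are coefficients of such
moments. The moment of v + xζ gives the Funk–Hecke formula and orthonormality. The moment of a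
combination of three null vectors gives the triple integrals as coefficients of (x-y)^(2c)
(x-z)^(2b) (y-z)^(2a), which is Racah's sum. Its value at m = 0 is Dixon's identity (`dixonSum_eq`).
Together these give `gauntC_eq_wigner3j`, and the triangle inequality gives finiteness.

For the propagator, consider the functional Φ_y(p) = p(∇/(ik)) h₀(k|y|) on polynomials (`waveFun`).
The Helmholtz equation says that Φ_y annihilates multiples of n·n - 1, so Φ_y sees a polynomial only
through its expansion in spherical harmonics (`hasSum_sphere_expansion`), and Φ_y(r^l Y_{lm}) = i^l
h_l(k|y|) Y_{lm}(ŷ) (`waveFun_solid_real`). Heuristically Φ_y integrates exp(ik n·y) against p, so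
that moving y by r multiplies p by exp(ik n·r), whose harmonic expansion is 4π Σ i^l j_l Y Y*. The
rigorous form is `hasSum_waveFun_translate`, obtained from Taylor's series and Funk–Hecke. The
coefficient 𝒞 is Φ_a applied to a product Y_{lm} Y_{l'm'}^*, expanded harmonic by harmonic
(`transferCoeff_eq`). Hence the sum over (l',m') translates from a to a + r', and the sum over (l,m)
translates on to a + r' - r = y - x.

Convergence comes from complex analysis. The function √(y·y) stays holomorphic when real vectors b,
c of total weighted length less than |a| are added to a with complex coefficients
(`dot_mem_slitPlane`). Cauchy's estimates then bound Φ_a on powers of linear forms, and Funk–Hecke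
turns this into bounds on solid harmonics (`norm_apply_solid_le`). The factors (2l+1)!! in these
bounds cancel against those of j_l, leaving geometric series in |r|/R and |r'|/R' with R + R' < |a|.
This gives the double series, whereas the iterated one only needs the one-variable estimate twice.

All of this holds for any complex k ≠ 0, so real and imaginary frequency are two instances. On the
imaginary axis h_l becomes K_{l+1/2} because both obey the same recursion (`besselK_eq_hankel`). The
Gaunt coefficients are real and force m'' = m - m', which fixes the phase of g. -/

lemma integral_exp_int_mul (n : ℤ) :
    ∫ φ in (0 : ℝ)..(2 * Real.pi), exp ((n * I) * (φ : ℂ))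
      = if n = 0 then (2 * Real.pi : ℂ) else 0 := by
  split_ifs with h
  · subst h; simp
  · have hc : (n : ℂ) * I ≠ 0 := mul_ne_zero (by exact_mod_cast h) I_ne_zero
    rw [integral_exp_mul_complex hc]
    have : exp ((n : ℂ) * I * ((2 * Real.pi : ℝ) : ℂ)) = 1 := by
      rw [Complex.exp_eq_one_iff]
      exact ⟨n, by push_cast; ring⟩
    rw [this]; simp

/-- Integration over a period keeps only the constant Fourier mode, which is the middle binomial
term. -/
lemma integral_trig_pow (β β' : ℂ) (i : ℕ) :
    ∫ φ in (0 : ℝ)..(2 * Real.pi), (β * exp (I * (φ : ℂ)) + β' * exp (-I * (φ : ℂ))) ^ i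
      = if Even i then 2 * Real.pi * (i.choose (i / 2)) * (β * β') ^ (i / 2) else 0 := by
  have h1 : ∀ φ : ℝ, (β * exp (I * (φ : ℂ)) + β' * exp (-I * (φ : ℂ))) ^ i
      = ∑ m ∈ Finset.range (i + 1), (β ^ m * β' ^ (i - m) * (i.choose m))
        * exp ((((2 * m : ℤ) - i : ℤ) * I) * (φ : ℂ)) := by
    intro φ
    rw [add_pow]
    refine Finset.sum_congr rfl fun m hm => ?_
    have hm : m ≤ i := by simpa [Nat.lt_succ_iff] using hm
    rw [mul_pow, mul_pow, ← Complex.exp_nat_mul, ← Complex.exp_nat_mul]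
    have : exp ((((2 * m : ℤ) - i : ℤ) * I) * (φ : ℂ))
        = exp (m * (I * φ)) * exp (((i - m : ℕ) : ℂ) * (-I * φ)) := by
      rw [← Complex.exp_add]; congr 1; push_cast [hm]; ring
    rw [this]; ring
  simp_rw [h1]
  rw [intervalIntegral.integral_finsetSum]
  swap
  · intro m _
    exact Continuous.intervalIntegrable (by fun_prop) _ _
  simp_rw [intervalIntegral.integral_const_mul, integral_exp_int_mul]
  split_ifs with he
  · obtain ⟨j, rfl⟩ := he
    have hj : (j + j) / 2 = j := by omega
    rw [hj, Finset.sum_eq_single j]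
    · have : ((2 * j : ℤ) - (j + j : ℕ) : ℤ) = 0 := by push_cast; ring
      rw [if_pos this, mul_pow]
      simp only [Nat.add_sub_cancel]; ring
    · intro m _ hmj
      rw [if_neg, mul_zero]
      push_cast; omega
    · intro h; exact absurd (Finset.mem_range.2 (by omega)) h
  · refine Finset.sum_eq_zero fun m _ => ?_
    rw [if_neg, mul_zero]
    intro h; apply he; exact ⟨m, by omega⟩

lemma integral_affine_trig_pow (b c d : ℂ) (N : ℕ) :
    ∫ φ in (0 : ℝ)..(2 * Real.pi),
        (c + (b * (Real.cos φ : ℂ) + d * (Real.sin φ : ℂ))) ^ N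
      = ∑ i ∈ Finset.range (N + 1), if Even i then
          (N.choose i) * (2 * Real.pi * (i.choose (i / 2))) * c ^ (N - i)
            * ((b ^ 2 + d ^ 2) / 4) ^ (i / 2) else 0 := by
  have h1 : ∀ φ : ℝ, (c + (b * (Real.cos φ : ℂ) + d * (Real.sin φ : ℂ))) ^ N
      = ∑ i ∈ Finset.range (N + 1), (c ^ (N - i) * (N.choose i)) *
        ((b - I * d) / 2 * exp (I * (φ : ℂ)) + (b + I * d) / 2 * exp (-I * (φ : ℂ))) ^ i := by
    intro φ
    have : b * (Real.cos φ : ℂ) + d * (Real.sin φ : ℂ)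
        = (b - I * d) / 2 * exp (I * (φ : ℂ)) + (b + I * d) / 2 * exp (-I * (φ : ℂ)) := by
      have e1 : exp (I * (φ : ℂ)) = Complex.cos φ + Complex.sin φ * I := by
        rw [mul_comm, Complex.exp_mul_I]
      have e2 : exp (-I * (φ : ℂ)) = Complex.cos φ - Complex.sin φ * I := by
        rw [show -I * (φ : ℂ) = (-φ : ℂ) * I by ring, Complex.exp_mul_I]; simp; ring
      rw [e1, e2]; push_cast
      linear_combination (d * Complex.sin φ) * I_sq
    rw [this, add_comm, add_pow]
    refine Finset.sum_congr rfl fun i _ => by ring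
  simp_rw [h1]
  rw [intervalIntegral.integral_finsetSum]
  swap
  · intro m _
    exact Continuous.intervalIntegrable (by fun_prop) _ _
  simp_rw [intervalIntegral.integral_const_mul, integral_trig_pow]
  refine Finset.sum_congr rfl fun i _ => ?_
  split_ifs
  · have : (b - I * d) / 2 * ((b + I * d) / 2) = (b ^ 2 + d ^ 2) / 4 := by
      linear_combination (-d ^ 2 / 4) * I_sq
    rw [this]; ring
  · simp

/-- `∫_0^π sin^{2j+1} cos^c`. -/
def polarIntegral (j c : ℕ) : ℝ :=
  ∫ θ in (0 : ℝ)..Real.pi, Real.sin θ ^ (2 * j + 1) * Real.cos θ ^ c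

lemma polarIntegral_zero (c : ℕ) : polarIntegral 0 c = (1 + (-1) ^ c) / (c + 1) := by
  have hc : (c : ℝ) + 1 ≠ 0 := by positivity
  have := intervalIntegral.integral_eq_sub_of_hasDerivAt (a := 0) (b := Real.pi)
    (f := fun θ => -(Real.cos θ ^ (c + 1) / (c + 1)))
    (f' := fun θ => Real.sin θ ^ (2 * 0 + 1) * Real.cos θ ^ c)
    (fun x _ => by
      have := (((Real.hasDerivAt_cos x).pow (c + 1)).div_const ((c : ℝ) + 1)).neg
      refine this.congr_deriv ?_
      push_cast; field_simp)
    (Continuous.intervalIntegrable (by fun_prop) _ _)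
  rw [polarIntegral, this]; simp [pow_succ]; field_simp; ring

/-- Integration by parts: the boundary values of sin^(2j+2) cos^(c+1) vanish at 0 and π, so two
powers of sine can be traded for two of cosine. -/
lemma polarIntegral_succ (j c : ℕ) :
    polarIntegral (j + 1) c = 2 * (j + 1) / (c + 1) * polarIntegral j (c + 2) := by
  have hc : (c : ℝ) + 1 ≠ 0 := by positivity
  have := intervalIntegral.integral_eq_sub_of_hasDerivAt (a := 0) (b := Real.pi)
    (f := fun θ => Real.sin θ ^ (2 * j + 2) * Real.cos θ ^ (c + 1))
    (f' := fun θ => (2 * (j + 1)) * (Real.sin θ ^ (2 * j + 1) * Real.cos θ ^ (c + 2))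
      - (c + 1) * (Real.sin θ ^ (2 * (j + 1) + 1) * Real.cos θ ^ c))
    (fun x _ => by
      have := (((Real.hasDerivAt_sin x).pow (2 * j + 2))).mul ((Real.hasDerivAt_cos x).pow (c + 1))
      refine this.congr_deriv ?_
      push_cast [show 2 * j + 2 - 1 = 2 * j + 1 by omega, show c + 1 - 1 = c by omega, Pi.pow_apply]; ring)
    (Continuous.intervalIntegrable (by fun_prop) _ _)
  rw [intervalIntegral.integral_sub, intervalIntegral.integral_const_mul,
    intervalIntegral.integral_const_mul] at this
  · simp at this
    simp only [polarIntegral]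
    field_simp; linarith
  · exact Continuous.intervalIntegrable (by fun_prop) _ _
  · exact Continuous.intervalIntegrable (by fun_prop) _ _

lemma polarIntegral_odd (j c : ℕ) (hc : Odd c) : polarIntegral j c = 0 := by
  induction j generalizing c with
  | zero => rw [polarIntegral_zero, hc.neg_one_pow]; simp
  | succ j ih => rw [polarIntegral_succ, ih _ (by obtain ⟨k, rfl⟩ := hc; exact ⟨k + 1, by ring⟩)]; simp

lemma polarIntegral_even (j d : ℕ) : polarIntegral j (2 * d)
    = 2 * 4 ^ j * j.factorial * (2 * d).factorial * (d + j).factorial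
      / (d.factorial * (2 * d + 2 * j + 1).factorial) := by
  induction j generalizing d with
  | zero =>
    rw [polarIntegral_zero]
    have : ((2 * d + 2 * 0 + 1).factorial : ℝ) = (2 * d + 1) * (2 * d).factorial := by
      rw [show 2 * d + 2 * 0 + 1 = 2 * d + 1 by ring, Nat.factorial_succ]; push_cast; ring
    rw [this]
    have h1 : ((2 * d).factorial : ℝ) ≠ 0 := by positivity
    have h2 : (d.factorial : ℝ) ≠ 0 := by positivity
    simp; field_simp; ring
  | succ j ih =>
    rw [polarIntegral_succ, show 2 * d + 2 = 2 * (d + 1) by ring, ih]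
    have e1 : ((2 * (d + 1)).factorial : ℝ) = (2 * d + 2) * (2 * d + 1) * (2 * d).factorial := by
      rw [show 2 * (d + 1) = 2 * d + 1 + 1 by ring, Nat.factorial_succ, Nat.factorial_succ]
      push_cast; ring
    have e2 : ((d + 1).factorial : ℝ) = (d + 1) * d.factorial := by
      rw [Nat.factorial_succ]; push_cast; ring
    have e3 : ((j + 1).factorial : ℝ) = (j + 1) * j.factorial := by
      rw [Nat.factorial_succ]; push_cast; ring
    rw [e1, e2, e3, show d + 1 + j = d + (j + 1) by ring,
      show 2 * (d + 1) + 2 * j + 1 = 2 * d + 2 * (j + 1) + 1 by ring]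
    have h2 : (d.factorial : ℝ) ≠ 0 := by positivity
    push_cast; field_simp; ring

lemma sum_range_of_even {R : Type*} [AddCommMonoid R] (f : ℕ → R) (M : ℕ) :
    ∑ i ∈ Finset.range (2 * M + 1), (if Even i then f i else 0)
      = ∑ j ∈ Finset.range (M + 1), f (2 * j) := by
  induction M with
  | zero => simp
  | succ M ih =>
    rw [show 2 * (M + 1) + 1 = 2 * M + 1 + 1 + 1 by ring, Finset.sum_range_succ,
      Finset.sum_range_succ, ih, Finset.sum_range_succ _ (M + 1)]
    rw [if_neg (by simp [parity_simps]), if_pos (by simp [parity_simps])]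
    simp [mul_add]

/-- Moments of linear forms over the unit sphere. -/
theorem solidAngleIntegral_linear_pow (v : Fin 3 → ℂ) (N : ℕ) :
    solidAngleIntegral (fun n => (v 0 * (n 0 : ℂ) + v 1 * (n 1 : ℂ) + v 2 * (n 2 : ℂ)) ^ N)
      = if Even N then 4 * Real.pi / (N + 1) * (v 0 ^ 2 + v 1 ^ 2 + v 2 ^ 2) ^ (N / 2) else 0 := by
  have h1 : ∀ θ : ℝ, (∫ φ in (0 : ℝ)..(2 * Real.pi),
      (v 0 * (direction θ φ 0 : ℂ) + v 1 * (direction θ φ 1 : ℂ) + v 2 * (direction θ φ 2 : ℂ)) ^ N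
        * (Real.sin θ : ℂ)) = ∑ i ∈ Finset.range (N + 1), if Even i then
          ((N.choose i) * (2 * Real.pi * (i.choose (i / 2))) * v 2 ^ (N - i)
            * ((v 0 ^ 2 + v 1 ^ 2) / 4) ^ (i / 2))
            * ((Real.sin θ ^ (2 * (i / 2) + 1) * Real.cos θ ^ (N - i) : ℝ) : ℂ) else 0 := by
    intro θ
    have := integral_affine_trig_pow (v 0 * (Real.sin θ : ℂ)) (v 2 * (Real.cos θ : ℂ))
      (v 1 * (Real.sin θ : ℂ)) N
    rw [intervalIntegral.integral_mul_const]
    have e : ∀ φ : ℝ, (v 0 * (direction θ φ 0 : ℂ) + v 1 * (direction θ φ 1 : ℂ)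
        + v 2 * (direction θ φ 2 : ℂ)) = (v 2 * (Real.cos θ : ℂ) +
        (v 0 * (Real.sin θ : ℂ) * (Real.cos φ : ℂ) + v 1 * (Real.sin θ : ℂ) * (Real.sin φ : ℂ))) := by
      intro φ; simp [direction]; ring
    simp_rw [e]
    rw [this, Finset.sum_mul]
    refine Finset.sum_congr rfl fun i _ => ?_
    split_ifs with hi
    · have : ((v 0 * (Real.sin θ : ℂ)) ^ 2 + (v 1 * (Real.sin θ : ℂ)) ^ 2) / 4
          = (v 0 ^ 2 + v 1 ^ 2) / 4 * (Real.sin θ : ℂ) ^ 2 := by ring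
      rw [this, mul_pow _ _ (i / 2), ← pow_mul, mul_pow]; push_cast; ring
    · simp
  unfold solidAngleIntegral
  simp_rw [h1]
  rw [intervalIntegral.integral_finsetSum]
  swap
  · intro i _
    split_ifs
    · exact Continuous.intervalIntegrable (by fun_prop) _ _
    · exact Continuous.intervalIntegrable (by fun_prop) _ _
  have h2 : ∀ i ∈ Finset.range (N + 1), (∫ θ in (0 : ℝ)..Real.pi, if Even i then
          ((N.choose i) * (2 * Real.pi * (i.choose (i / 2))) * v 2 ^ (N - i)
            * ((v 0 ^ 2 + v 1 ^ 2) / 4) ^ (i / 2))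
            * ((Real.sin θ ^ (2 * (i / 2) + 1) * Real.cos θ ^ (N - i) : ℝ) : ℂ) else 0)
      = if Even i then ((N.choose i) * (2 * Real.pi * (i.choose (i / 2))) * v 2 ^ (N - i)
            * ((v 0 ^ 2 + v 1 ^ 2) / 4) ^ (i / 2)) * (polarIntegral (i / 2) (N - i) : ℂ) else 0 := by
    intro i _
    split_ifs
    · rw [intervalIntegral.integral_const_mul, polarIntegral, intervalIntegral.integral_ofReal]
    · simp
  rw [Finset.sum_congr rfl h2]
  split_ifs with hN
  · obtain ⟨M, hM⟩ := hN
    obtain rfl : N = 2 * M := by omega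
    rw [sum_range_of_even, show 2 * M / 2 = M by omega, add_pow, Finset.mul_sum]
    refine Finset.sum_congr rfl fun j hj => ?_
    obtain ⟨d, rfl⟩ : ∃ d, M = d + j := ⟨M - j, by simp at hj; omega⟩
    rw [show 2 * j / 2 = j by omega, show 2 * (d + j) - 2 * j = 2 * d by omega,
      show d + j - j = d by omega, polarIntegral_even]
    have c1 : ((2 * (d + j)).choose (2 * j) : ℂ)
        = (2 * d + 2 * j).factorial / ((2 * j).factorial * (2 * d).factorial) := by
      rw [show 2 * (d + j) = 2 * j + 2 * d by ring, Nat.cast_add_choose, add_comm (2 * j)]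
    have c2 : ((2 * j).choose j : ℂ) = (2 * j).factorial / (j.factorial * j.factorial) := by
      rw [two_mul, Nat.cast_add_choose]
    have c3 : ((2 * d + 2 * j + 1).factorial : ℂ) = (2 * d + 2 * j + 1) * (2 * d + 2 * j).factorial := by
      rw [Nat.factorial_succ]; push_cast; ring
    have n1 : ∀ n : ℕ, (n.factorial : ℂ) ≠ 0 := fun n => by exact_mod_cast n.factorial_ne_zero
    have n2 : (2 * d + 2 * j + 1 : ℂ) ≠ 0 := by exact_mod_cast (2 * d + 2 * j).succ_ne_zero
    rw [c1, c2, ← Nat.choose_symm_add, Nat.cast_add_choose]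
    push_cast
    rw [c3]
    have := n1 j; have := n1 d; have := n1 (2 * d); have := n1 (2 * j); have := n1 (2 * d + 2 * j)
    rw [div_pow, show (2 : ℂ) * (d + j) + 1 = 2 * d + 2 * j + 1 by ring]
    field_simp
    rw [pow_mul]; ring
  · refine Finset.sum_eq_zero fun i hi => ?_
    split_ifs with hi2
    · rw [polarIntegral_odd, ofReal_zero, mul_zero]
      have : i ≤ N := by simp at hi; omega
      rw [Nat.odd_sub this]
      simp [← Nat.not_even_iff_odd, hN, hi2]
    · rfl

end SphericalWaves
end

/-! ### Generating function of the spherical harmonics and solid harmonics. -/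

noncomputable section
namespace SphericalWaves
open Complex

section Quadratic
open Polynomial
variable {R : Type*}

/-- The quadratic polynomial `a X² + b X + c`. -/
def quad [CommRing R] (a b c : R) : R[X] := C a * X ^ 2 + C b * X + C c

lemma natDegree_quad_le [CommRing R] (a b c : R) : (quad a b c).natDegree ≤ 2 :=
  natDegree_quadratic_le

lemma natDegree_quad_pow_le [CommRing R] (a b c : R) (l : ℕ) :
    (quad a b c ^ l).natDegree ≤ 2 * l := by
  refine natDegree_pow_le.trans ?_
  rw [mul_comm]; gcongr; exact natDegree_quad_le a b c

lemma reflect_quad [CommRing R] (a b c : R) : reflect 2 (quad a b c) = quad c b a := by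
  have h : ∀ j, (quad a b c).coeff j = if j = 2 then a else if j = 1 then b else
      if j = 0 then c else 0 := by
    intro j
    rcases j with _ | _ | _ | j <;> simp [quad, coeff_X, coeff_C, coeff_X_pow]
  have h' : ∀ j, (quad c b a).coeff j = if j = 2 then c else if j = 1 then b else
      if j = 0 then a else 0 := by
    intro j
    rcases j with _ | _ | _ | j <;> simp [quad, coeff_X, coeff_C, coeff_X_pow]
  ext j
  rw [coeff_reflect, h, h']
  rcases j with _ | _ | _ | j
  · simp [revAt_le]
  · simp [revAt_le]
  · simp [revAt_le]
  · rw [revAt_eq_self_of_lt (by omega)]; simp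

lemma reflect_quad_pow [CommRing R] (a b c : R) (l : ℕ) :
    reflect (2 * l) (quad a b c ^ l) = quad c b a ^ l := by
  induction l with
  | zero => simp
  | succ l ih =>
    rw [pow_succ, mul_add, mul_one, reflect_mul _ _ (natDegree_quad_pow_le a b c l)
      (natDegree_quad_le a b c), ih, reflect_quad, pow_succ]

lemma coeff_quad_pow_symm [CommRing R] (a b c : R) (l j : ℕ) (hj : j ≤ 2 * l) :
    (quad a b c ^ l).coeff (2 * l - j) = (quad c b a ^ l).coeff j := by
  rw [← reflect_quad_pow a b c l, coeff_reflect, revAt_le hj]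

/-- Substituting aX into X² + bX + ac gives a(aX² + bX + c); comparing coefficients of l-th powers
proves the claim for a ≠ 0. For a = 0 both sides are b^l if n = 0 and vanish otherwise. The factor
a^n becomes the azimuthal factor of Y_{lm}. -/
lemma coeff_quad_pow_eq {K : Type*} [Field K] (a b c : K) (l n : ℕ) :
    (quad a b c ^ l).coeff (l + n) = a ^ n * (quad 1 b (a * c) ^ l).coeff (l + n) := by
  by_cases ha : a = 0
  · subst ha
    rcases Nat.eq_zero_or_pos n with rfl | hn
    · have e1 : quad 1 b (0 * c) ^ l = (X + C b) ^ l * X ^ l := by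
        rw [← mul_pow]; simp [quad]; ring
      have e2 : (quad 0 b c) = C b * X + C c := by simp [quad]
      rw [e1, add_zero, show (((X + C b) ^ l * X ^ l : K[X]).coeff l)
        = ((X + C b) ^ l * X ^ l : K[X]).coeff (0 + l) by simp, coeff_mul_X_pow, e2, add_pow,
        finsetSum_coeff, Finset.sum_eq_single l]
      · simp only [Nat.sub_self, pow_zero, mul_one, Nat.choose_self, Nat.cast_one, one_mul,
          coeff_zero_eq_eval_zero, eval_pow, eval_add, eval_X, eval_C, zero_add]
        rw [mul_pow, ← C_pow, coeff_C_mul, coeff_X_pow_self, mul_one]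
      · intro i hi hil
        have : i < l := by simp at hi; omega
        rw [mul_pow, ← C_pow, ← C_pow, ← C_eq_natCast, mul_assoc, mul_assoc, coeff_C_mul, ← C_mul,
          coeff_mul_C, coeff_X_pow, if_neg (by omega)]; simp
      · simp
    · rw [zero_pow hn.ne', zero_mul]
      apply coeff_eq_zero_of_natDegree_lt
      have : quad 0 b c = C b * X + C c := by simp [quad]
      rw [this]
      refine (natDegree_pow_le_of_le l (natDegree_linear_le (a := b) (b := c))).trans_lt ?_
      omega
  · have h : (quad 1 b (a * c) ^ l).comp (C a * X) = C (a ^ l) * quad a b c ^ l := by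
      rw [pow_comp, C_pow, ← mul_pow]; congr 1; simp [quad]; ring
    have h2 := congrArg (fun P : K[X] => P.coeff (l + n)) h
    simp only [comp_C_mul_X_coeff, coeff_C_mul] at h2
    have := pow_ne_zero l ha
    apply mul_left_cancel₀ this
    rw [← h2, pow_add]; ring

/-- Since s = 1 - z², the quadratic is (X + z)² - 1, so its l-th power is the Taylor expansion at z
of Rodrigues' polynomial (X² - 1)^l. -/
lemma coeff_quad_one_eq_derivative (z : ℝ) (s : ℝ) (hs : z ^ 2 + s = 1) (l k : ℕ) :
    (quad 1 (2 * z) (-s) ^ l).coeff k * k.factorial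
      = (derivative^[k] ((X ^ 2 - 1 : ℝ[X]) ^ l)).eval z := by
  have h1 : quad 1 (2 * z) (-s) ^ l = taylor z ((X ^ 2 - 1 : ℝ[X]) ^ l) := by
    rw [taylor_pow]; congr 1
    simp only [quad, taylor_apply, sub_comp, pow_comp, X_comp, one_comp]
    have : C (-s) = C z ^ 2 - 1 := by
      rw [show -s = z ^ 2 - 1 by linarith]; simp
    rw [this]; simp only [map_mul, map_ofNat, map_one]; ring
  rw [h1, taylor_coeff, ← factorial_smul_hasseDeriv]
  simp [mul_comm]

end Quadratic

/-- `LM` label with opposite `m`. -/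
def LM.neg (p : LM) : LM := ⟨(p.1.1, -p.1.2), by simpa using p.2⟩

@[simp] lemma LM.neg_l (p : LM) : p.neg.l = p.l := rfl
@[simp] lemma LM.neg_m (p : LM) : p.neg.m = -p.m := rfl
@[simp] lemma LM.neg_neg (p : LM) : p.neg.neg = p := by
  apply Subtype.ext; simp [LM.neg]
lemma LM.abs_m_le (p : LM) : |p.m| ≤ p.l := p.2
lemma LM.natAbs_le (p : LM) : p.m.natAbs ≤ p.l := by have := p.abs_m_le; rw [Int.abs_eq_natAbs] at this; omega
lemma LM.ext {p q : LM} (h1 : p.l = q.l) (h2 : p.m = q.m) : p = q :=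
  Subtype.ext (Prod.ext h1 h2)

/-- The exponent `l + m` as a natural number. -/
def LM.idx (p : LM) : ℕ := (p.l + p.m).toNat

lemma LM.idx_cast (p : LM) : (p.idx : ℤ) = p.l + p.m := by
  have := p.abs_m_le; rw [abs_le] at this
  rw [LM.idx, Int.toNat_of_nonneg (by omega)]

lemma LM.idx_le (p : LM) : p.idx ≤ 2 * p.l := by
  have := p.abs_m_le; rw [abs_le] at this
  have := p.idx_cast; omega

lemma LM.idx_neg (p : LM) : p.neg.idx = 2 * p.l - p.idx := by
  have := p.neg.idx_cast; have := p.idx_cast; have := p.idx_le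
  simp at *; omega

/-- Normalisation of the generating function of the spherical harmonics. -/
def normCoeff (p : LM) : ℝ :=
  Real.sqrt ((2 * p.l + 1) / (4 * Real.pi))
    * Real.sqrt (p.idx.factorial * (2 * p.l - p.idx).factorial) / (2 ^ p.l * p.l.factorial)

lemma normCoeff_pos (p : LM) : 0 < normCoeff p := by
  unfold normCoeff; positivity

lemma normCoeff_neg (p : LM) : normCoeff p.neg = normCoeff p := by
  have := p.idx_le
  simp only [normCoeff, LM.neg_l, LM.idx_neg]
  rw [show 2 * p.l - (2 * p.l - p.idx) = p.idx by omega, mul_comm ((p.idx.factorial : ℝ))]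

/-- Absorbing (l+|m|)! into the square root makes the normalisation symmetric under m ↦ -m, because
idx! (2l-idx)! equals (l-|m|)! (l+|m|)!. -/
lemma sqrt_eq_normCoeff (p : LM) :
    Real.sqrt ((2 * p.l + 1) / (4 * Real.pi)
        * ((p.l - p.m.natAbs).factorial / (p.l + p.m.natAbs).factorial))
      * ((p.l + p.m.natAbs).factorial / (2 ^ p.l * p.l.factorial)) = normCoeff p := by
  have h : (p.idx.factorial * (2 * p.l - p.idx).factorial : ℝ)
      = (p.l - p.m.natAbs).factorial * (p.l + p.m.natAbs).factorial := by
    have := p.idx_cast; have := p.natAbs_le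
    rcases le_total 0 p.m with hm | hm
    · rw [show p.idx = p.l + p.m.natAbs by omega,
        show 2 * p.l - (p.l + p.m.natAbs) = p.l - p.m.natAbs by omega, mul_comm]
    · rw [show p.idx = p.l - p.m.natAbs by omega,
        show 2 * p.l - (p.l - p.m.natAbs) = p.l + p.m.natAbs by omega]
  have hpos : (0 : ℝ) < (p.l + p.m.natAbs).factorial := by positivity
  rw [normCoeff, h, Real.sqrt_mul (by positivity)]
  have h3 : Real.sqrt ((p.l - p.m.natAbs).factorial / (p.l + p.m.natAbs).factorial)
    = Real.sqrt ((p.l - p.m.natAbs).factorial * (p.l + p.m.natAbs).factorial)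
      / (p.l + p.m.natAbs).factorial := by
    rw [show ((p.l - p.m.natAbs).factorial / (p.l + p.m.natAbs).factorial : ℝ)
      = (p.l - p.m.natAbs).factorial * (p.l + p.m.natAbs).factorial
        / (p.l + p.m.natAbs).factorial ^ 2 by field_simp, Real.sqrt_div' _ (by positivity),
        Real.sqrt_sq hpos.le]
  rw [h3]
  field_simp

/-- The value at `n` of the generating quadratic of the solid harmonics. -/
def genQuad (n : Fin 3 → ℂ) : Polynomial ℂ :=
  quad (-(n 0 + I * n 1)) (2 * n 2) (n 0 - I * n 1)

/-- Real points as complex points. -/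
def toC (x : E3) : Fin 3 → ℂ := fun i => (x i : ℂ)

lemma norm_sq_eq (x : E3) : ‖x‖ ^ 2 = x 0 ^ 2 + x 1 ^ 2 + x 2 ^ 2 := by
  rw [EuclideanSpace.norm_sq_eq, Fin.sum_univ_three]; simp

lemma coeff_map_quad (z s : ℝ) (l k : ℕ) :
    (quad (1 : ℂ) (2 * z) (-s) ^ l).coeff k = ((quad 1 (2 * z) (-s) ^ l).coeff k : ℝ) := by
  have : (quad (1 : ℂ) (2 * z) (-s) ^ l) = ((quad 1 (2 * z) (-s) ^ l).map Complex.ofRealHom) := by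
    rw [Polynomial.map_pow]; simp [quad]
  rw [this, Polynomial.coeff_map]; rfl

lemma harmonicNonneg_eq (p : LM) (x : E3) (hx : ‖x‖ = 1) :
    harmonicNonneg p.l p.m.natAbs x = normCoeff p
      * (-((x 0 : ℂ) + I * x 1)) ^ p.m.natAbs
      * ((quad 1 (2 * x 2) (-(x 0 ^ 2 + x 1 ^ 2)) ^ p.l).coeff (p.l + p.m.natAbs) : ℝ) := by
  have hs : x 2 ^ 2 + (x 0 ^ 2 + x 1 ^ 2) = 1 := by
    have := norm_sq_eq x; rw [hx] at this; linarith
  rw [harmonicNonneg, hx, div_one, ← coeff_quad_one_eq_derivative (x 2) _ hs, ← sqrt_eq_normCoeff]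
  rw [neg_pow (_ + _)]
  push_cast
  simp only [div_one]
  ring

/-- Spherical harmonics at unit vectors are coefficients of powers of the generating quadratic. -/
lemma sphericalHarmonic_eq_coeff (p : LM) (x : E3) (hx : ‖x‖ = 1) :
    sphericalHarmonic p x = normCoeff p * (genQuad (toC x) ^ p.l).coeff p.idx := by
  have hI := I_sq
  have hle := p.natAbs_le
  have hidx := p.idx_cast
  have e : ∀ k, ((quad 1 (2 * x 2) (-(x 0 ^ 2 + x 1 ^ 2)) ^ p.l).coeff k : ℂ) =
      (quad (1 : ℂ) (2 * x 2) (-((x 0 : ℂ) ^ 2 + (x 1 : ℂ) ^ 2)) ^ p.l).coeff k := by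
    intro k
    have := coeff_map_quad (x 2) (x 0 ^ 2 + x 1 ^ 2) p.l k
    push_cast at this; exact this.symm
  rw [sphericalHarmonic, harmonicNonneg_eq p x hx]
  split_ifs with hm
  · rw [e, show p.idx = p.l + p.m.natAbs by omega, genQuad,
      coeff_quad_pow_eq (-(toC x 0 + I * toC x 1))]
    have : -(toC x 0 + I * toC x 1) * (toC x 0 - I * toC x 1)
        = -((x 0 : ℂ) ^ 2 + (x 1 : ℂ) ^ 2) := by
      simp only [toC]; linear_combination (x 1 : ℂ) ^ 2 * hI
    rw [this]; simp only [toC]; ring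
  · rw [show p.idx = 2 * p.l - (p.l + p.m.natAbs) by omega, genQuad,
      coeff_quad_pow_symm _ _ _ _ _ (by omega),
      coeff_quad_pow_eq (toC x 0 - I * toC x 1)]
    have : (toC x 0 - I * toC x 1) * -(toC x 0 + I * toC x 1)
        = -((x 0 : ℂ) ^ 2 + (x 1 : ℂ) ^ 2) := by
      simp only [toC]; linear_combination (x 1 : ℂ) ^ 2 * hI
    rw [this, show toC x 2 = (x 2 : ℂ) from rfl, ← e]
    have h2 : (starRingEnd ℂ) (-((x 0 : ℂ) + I * x 1)) = -(toC x 0 - I * toC x 1) := by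
      simp [toC, sub_eq_add_neg]
    rw [map_mul, map_mul, map_pow, h2, conj_ofReal, conj_ofReal]
    simp only [toC, neg_pow ((x 0 : ℂ) - I * x 1)]
    have : ((-1 : ℂ) ^ p.m.natAbs) * (-1) ^ p.m.natAbs = 1 := by
      rw [← mul_pow]; simp
    linear_combination (normCoeff p * ((x 0 : ℂ) - I * x 1) ^ p.m.natAbs *
      ((quad 1 (2 * x 2) (-(x 0 ^ 2 + x 1 ^ 2)) ^ p.l).coeff (p.l + p.m.natAbs) : ℂ)) * this

lemma conj_harmonicNonneg_zero (l : ℕ) (x : E3) :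
    (starRingEnd ℂ) (harmonicNonneg l 0 x) = harmonicNonneg l 0 x := by
  simp [harmonicNonneg, conj_ofReal, map_ofNat]

lemma conj_sphericalHarmonic (p : LM) (x : E3) :
    (starRingEnd ℂ) (sphericalHarmonic p x) = (-1) ^ p.m.natAbs * sphericalHarmonic p.neg x := by
  have hs : ((-1 : ℂ) ^ p.m.natAbs) * (-1) ^ p.m.natAbs = 1 := by rw [← mul_pow]; simp
  simp only [sphericalHarmonic, LM.neg_m, LM.neg_l, Int.natAbs_neg]
  rcases lt_trichotomy p.m 0 with h | h | h
  · rw [if_neg (by omega), if_pos (by omega)]; simp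
  · rw [if_pos (by omega), if_pos (by omega), h]; simp [conj_harmonicNonneg_zero]
  · rw [if_pos (by omega), if_neg (by omega), ← mul_assoc, hs, one_mul]

lemma harmonicNonneg_smul (l n : ℕ) (x : E3) (c : ℝ) (hc : 0 < c) :
    harmonicNonneg l n (c • x) = harmonicNonneg l n x := by
  have h : ‖c • x‖ = c * ‖x‖ := by rw [norm_smul, Real.norm_of_nonneg hc.le]
  have hc' : (c : ℂ) ≠ 0 := by exact_mod_cast hc.ne'
  simp only [harmonicNonneg, h, PiLp.smul_apply, smul_eq_mul]
  rw [mul_div_mul_left _ _ hc.ne']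
  push_cast
  rw [show (c : ℂ) * x 0 + I * (c * x 1) = c * (x 0 + I * x 1) by ring, mul_div_mul_left _ _ hc']

lemma sphericalHarmonic_smul (p : LM) (x : E3) (c : ℝ) (hc : 0 < c) :
    sphericalHarmonic p (c • x) = sphericalHarmonic p x := by
  simp only [sphericalHarmonic, harmonicNonneg_smul _ _ _ _ hc]

/-- Polynomial functions on `ℂ³`. -/
abbrev Pol : Type := MvPolynomial (Fin 3) ℂ

/-- Generating quadratic of the solid harmonics. -/
def polQuad : Polynomial Pol :=
  quad (-(MvPolynomial.X 0 + MvPolynomial.C I * MvPolynomial.X 1)) (2 * MvPolynomial.X 2)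
    (MvPolynomial.X 0 - MvPolynomial.C I * MvPolynomial.X 1)

/-- The solid harmonic `r^l Y_{lm}` as a polynomial. -/
def solid (p : LM) : Pol := MvPolynomial.C (normCoeff p : ℂ) * (polQuad ^ p.l).coeff p.idx

lemma map_polQuad (n : Fin 3 → ℂ) : polQuad.map (MvPolynomial.eval n) = genQuad n := by
  simp [polQuad, genQuad, quad]

lemma eval_coeff_polQuad (n : Fin 3 → ℂ) (l j : ℕ) :
    MvPolynomial.eval n ((polQuad ^ l).coeff j) = (genQuad n ^ l).coeff j := by
  rw [← Polynomial.coeff_map, Polynomial.map_pow, map_polQuad]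

lemma eval_solid (p : LM) (n : Fin 3 → ℂ) :
    MvPolynomial.eval n (solid p) = normCoeff p * (genQuad n ^ p.l).coeff p.idx := by
  rw [solid, map_mul, eval_coeff_polQuad, MvPolynomial.eval_C]

lemma eval_solid_unit (p : LM) (x : E3) (hx : ‖x‖ = 1) :
    MvPolynomial.eval (toC x) (solid p) = sphericalHarmonic p x := by
  rw [eval_solid, sphericalHarmonic_eq_coeff p x hx]

lemma genQuad_smul (c : ℂ) (n : Fin 3 → ℂ) : genQuad (c • n) = Polynomial.C c * genQuad n := by
  simp only [genQuad, quad, Pi.smul_apply, smul_eq_mul]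
  simp only [map_mul, map_add, map_neg, map_sub]; ring

lemma eval_solid_smul (p : LM) (c : ℂ) (n : Fin 3 → ℂ) :
    MvPolynomial.eval (c • n) (solid p) = c ^ p.l * MvPolynomial.eval n (solid p) := by
  rw [eval_solid, eval_solid, genQuad_smul, mul_pow, ← Polynomial.C_pow, Polynomial.coeff_C_mul]
  ring

lemma eval_solid_real (p : LM) (x : E3) (hx : x ≠ 0) :
    MvPolynomial.eval (toC x) (solid p) = (‖x‖ : ℂ) ^ p.l * sphericalHarmonic p x := by
  have hn : 0 < ‖x‖ := norm_pos_iff.2 hx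
  have h1 : ‖‖x‖⁻¹ • x‖ = 1 := by rw [norm_smul]; simp [hn.ne']
  have h2 : toC x = (‖x‖ : ℂ) • toC (‖x‖⁻¹ • x) := by
    have : (‖x‖ : ℂ) ≠ 0 := by exact_mod_cast hn.ne'
    ext i; simp [toC]; field_simp
  rw [h2, eval_solid_smul, eval_solid_unit _ _ h1, sphericalHarmonic_smul _ _ _ (inv_pos.2 hn)]

end SphericalWaves
end

/-! ### The sphere integral as a functional on polynomials: Funk–Hecke and orthonormality. -/

noncomputable section
namespace SphericalWaves
open Complex

lemma norm_direction (θ φ : ℝ) : ‖direction θ φ‖ = 1 := by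
  have h := norm_sq_eq (direction θ φ)
  have h2 : ‖direction θ φ‖ ^ 2 = 1 := by
    rw [h]; simp [direction]
    nlinarith [Real.sin_sq_add_cos_sq θ, Real.sin_sq_add_cos_sq φ]
  exact (pow_eq_one_iff_of_nonneg (norm_nonneg _) two_ne_zero).1 h2

lemma continuous_direction : Continuous (fun q : ℝ × ℝ => direction q.1 q.2) := by
  unfold direction
  refine (PiLp.continuous_toLp 2 _).comp (continuous_pi fun i => ?_)
  fin_cases i <;> simp <;> fun_prop

lemma solidAngleIntegral_congr {f g : E3 → ℂ} (h : ∀ n : E3, ‖n‖ = 1 → f n = g n) :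
    solidAngleIntegral f = solidAngleIntegral g := by
  unfold solidAngleIntegral
  simp_rw [h _ (norm_direction _ _)]

lemma continuous_inner_integral {f : E3 → ℂ} (hf : Continuous f) :
    Continuous fun θ : ℝ => ∫ φ in (0 : ℝ)..(2 * Real.pi), f (direction θ φ) * (Real.sin θ : ℂ) := by
  apply intervalIntegral.continuous_parametric_intervalIntegral_of_continuous'
  have h1 := hf.comp continuous_direction
  exact h1.mul (by fun_prop)

lemma continuous_slice {f : E3 → ℂ} (hf : Continuous f) (θ : ℝ) :
    Continuous fun φ : ℝ => f (direction θ φ) * (Real.sin θ : ℂ) :=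
  (hf.comp (continuous_direction.comp (by fun_prop : Continuous fun φ : ℝ => (θ, φ)))).mul
    continuous_const

lemma solidAngleIntegral_add {f g : E3 → ℂ} (hf : Continuous f) (hg : Continuous g) :
    solidAngleIntegral (fun n => f n + g n) = solidAngleIntegral f + solidAngleIntegral g := by
  unfold solidAngleIntegral
  rw [← intervalIntegral.integral_add ((continuous_inner_integral hf).intervalIntegrable _ _)
    ((continuous_inner_integral hg).intervalIntegrable _ _)]
  congr 1; ext θ
  rw [← intervalIntegral.integral_add ((continuous_slice hf θ).intervalIntegrable _ _)
    ((continuous_slice hg θ).intervalIntegrable _ _)]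
  simp_rw [add_mul]

lemma solidAngleIntegral_const_mul (c : ℂ) (f : E3 → ℂ) :
    solidAngleIntegral (fun n => c * f n) = c * solidAngleIntegral f := by
  unfold solidAngleIntegral
  simp_rw [mul_assoc, intervalIntegral.integral_const_mul]

/-- The sine weight is bounded by 1 on the parameter rectangle, giving 2π² instead of the optimal
4π; only a constant independent of `f` matters later. -/
lemma norm_solidAngleIntegral_le {f : E3 → ℂ} {M : ℝ} (hM : ∀ n : E3, ‖n‖ = 1 → ‖f n‖ ≤ M) :
    ‖solidAngleIntegral f‖ ≤ 2 * Real.pi ^ 2 * M := by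
  have hM0 : 0 ≤ M := (norm_nonneg _).trans (hM _ (norm_direction 0 0))
  have h1 : ∀ θ ∈ Set.uIoc (0 : ℝ) Real.pi,
      ‖∫ φ in (0 : ℝ)..(2 * Real.pi), f (direction θ φ) * (Real.sin θ : ℂ)‖ ≤ M * (2 * Real.pi) := by
    intro θ _
    refine (intervalIntegral.norm_integral_le_of_norm_le_const (C := M) fun φ _ => ?_).trans
      (le_of_eq ?_)
    · rw [norm_mul, Complex.norm_real, Real.norm_eq_abs]
      exact (mul_le_mul (hM _ (norm_direction _ _)) (Real.abs_sin_le_one θ) (abs_nonneg _)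
        hM0).trans (by simp)
    · rw [sub_zero, abs_of_nonneg (by positivity)]
  refine (intervalIntegral.norm_integral_le_of_norm_le_const h1).trans (le_of_eq ?_)
  rw [sub_zero, abs_of_nonneg Real.pi_pos.le]; ring

lemma continuous_eval_toC (p : Pol) : Continuous fun n : E3 => MvPolynomial.eval (toC n) p := by
  have : Continuous fun n : E3 => toC n := by
    unfold toC; fun_prop
  exact (MvPolynomial.continuous_eval p).comp this

/-- Integration over the unit sphere as a functional on polynomials. -/
def sphInt : Pol →ₗ[ℂ] ℂ where
  toFun p := solidAngleIntegral fun n => MvPolynomial.eval (toC n) p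
  map_add' p q := by
    simp only [map_add]
    exact solidAngleIntegral_add (continuous_eval_toC p) (continuous_eval_toC q)
  map_smul' c p := by
    simp only [MvPolynomial.smul_eval, RingHom.id_apply, smul_eq_mul]
    exact solidAngleIntegral_const_mul c _

lemma sphInt_apply (p : Pol) :
    sphInt p = solidAngleIntegral fun n => MvPolynomial.eval (toC n) p := rfl

lemma sphInt_C_mul (c : ℂ) (p : Pol) : sphInt (MvPolynomial.C c * p) = c * sphInt p := by
  rw [← MvPolynomial.smul_eq_C_mul, map_smul, smul_eq_mul]

/-- The linear form with coefficients `v`. -/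
def lin (v : Fin 3 → ℂ) : Pol :=
  MvPolynomial.C (v 0) * MvPolynomial.X 0 + MvPolynomial.C (v 1) * MvPolynomial.X 1
    + MvPolynomial.C (v 2) * MvPolynomial.X 2

/-- The complex bilinear extension of the scalar product. -/
def dot (v w : Fin 3 → ℂ) : ℂ := v 0 * w 0 + v 1 * w 1 + v 2 * w 2

lemma eval_lin (v n : Fin 3 → ℂ) : MvPolynomial.eval n (lin v) = dot v n := by
  simp [lin, dot]

lemma lin_add (v w : Fin 3 → ℂ) : lin (v + w) = lin v + lin w := by
  simp [lin]; ring

lemma lin_smul (c : ℂ) (v : Fin 3 → ℂ) : lin (c • v) = MvPolynomial.C c * lin v := by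
  simp [lin]; ring

lemma sphInt_lin_pow (v : Fin 3 → ℂ) (N : ℕ) :
    sphInt (lin v ^ N)
      = if Even N then 4 * Real.pi / (N + 1) * dot v v ^ (N / 2) else 0 := by
  rw [sphInt_apply]
  have := solidAngleIntegral_linear_pow v N
  simp only [map_pow, eval_lin, dot, toC]
  rw [this]; simp only [sq]

/-- The null vector with parameter `τ`. -/
def nullVec (τ : ℂ) : Fin 3 → ℂ := ![1 - τ ^ 2, -(I * (1 + τ ^ 2)), 2 * τ]

lemma dot_nullVec (σ τ : ℂ) : dot (nullVec σ) (nullVec τ) = -2 * (σ - τ) ^ 2 := by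
  simp [dot, nullVec]; linear_combination ((1 + σ ^ 2) * (1 + τ ^ 2)) * I_sq

lemma dot_nullVec_self (τ : ℂ) : dot (nullVec τ) (nullVec τ) = 0 := by
  rw [dot_nullVec]; simp

lemma dot_nullVec_right (v : Fin 3 → ℂ) (τ : ℂ) : dot v (nullVec τ) = (genQuad v).eval τ := by
  simp [dot, nullVec, genQuad, quad]; ring

lemma lin_nullVec (τ : ℂ) : lin (nullVec τ) = polQuad.eval (MvPolynomial.C τ) := by
  simp [lin, nullVec, polQuad, quad]
  rw [show (MvPolynomial.C 2 : Pol) = 2 from map_ofNat _ 2]; ring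

/-- Coefficients of powers of the generating quadratic. -/
def harm (l j : ℕ) : Pol := (polQuad ^ l).coeff j

lemma lin_nullVec_pow (τ : ℂ) (l : ℕ) :
    lin (nullVec τ) ^ l = ∑ j ∈ Finset.range (2 * l + 1), MvPolynomial.C (τ ^ j) * harm l j := by
  rw [lin_nullVec, ← Polynomial.eval_pow,
    Polynomial.eval_eq_sum_range' (p := polQuad ^ l) (Nat.lt_succ_of_le (natDegree_quad_pow_le _ _ _ l))]
  refine Finset.sum_congr rfl fun j _ => ?_
  rw [map_pow, mul_comm]; rfl

/-- The device that passes from generating functions to coefficients: identities valid for all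
values of a complex parameter are compared power by power. -/
lemma coeff_ext {A : ℕ} {a b : ℕ → ℂ}
    (h : ∀ x : ℂ, ∑ i ∈ Finset.range A, a i * x ^ i = ∑ i ∈ Finset.range A, b i * x ^ i) :
    ∀ i < A, a i = b i := by
  intro i hi
  have key : (∑ i ∈ Finset.range A, Polynomial.C (a i) * Polynomial.X ^ i)
      = ∑ i ∈ Finset.range A, Polynomial.C (b i) * Polynomial.X ^ i := by
    apply Polynomial.funext; intro x
    simpa [Polynomial.eval_finsetSum] using h x
  have := congrArg (fun P => Polynomial.coeff P i) key
  simpa [Polynomial.finsetSum_coeff, Polynomial.coeff_X_pow, hi] using this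

/-- Integral of a power of a linear form against a power of a null linear form. -/
lemma sphInt_lin_pow_mul_null (v ζ : Fin 3 → ℂ) (hζ : dot ζ ζ = 0) (n l : ℕ) :
    ((n + l).choose l : ℂ) * sphInt (lin v ^ n * lin ζ ^ l)
      = if Even (n + l) then 4 * Real.pi / (n + l + 1) * ((((n + l) / 2).choose l : ℕ) : ℂ)
          * (2 * dot v ζ) ^ l * dot v v ^ ((n + l) / 2 - l) else 0 := by
  set N := n + l with hN
  have h : ∀ x : ℂ, ∑ i ∈ Finset.range (N + 1),
      ((N.choose i : ℂ) * sphInt (lin v ^ (N - i) * lin ζ ^ i)) * x ^ i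
      = ∑ i ∈ Finset.range (N + 1), (if Even N then 4 * Real.pi / (N + 1)
          * (((N / 2).choose i : ℕ) : ℂ) * (2 * dot v ζ) ^ i * dot v v ^ (N / 2 - i) else 0)
          * x ^ i := by
    intro x
    have h1 := sphInt_lin_pow (x • ζ + v) N
    rw [lin_add, lin_smul, add_pow, map_sum] at h1
    -- The x² term drops out because ζ is null, so the moment is a power of a binomial in x.
    have h2 : dot (x • ζ + v) (x • ζ + v) = x * (2 * dot v ζ) + dot v v := by
      simp only [dot, Pi.add_apply, Pi.smul_apply, smul_eq_mul] at hζ ⊢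
      linear_combination x ^ 2 * hζ
    rw [h2] at h1
    refine Eq.trans (Finset.sum_congr rfl fun i _ => ?_) (h1.trans ?_)
    · rw [mul_pow, ← map_pow, show (MvPolynomial.C (x ^ i) * lin ζ ^ i * lin v ^ (N - i)
        * ((N.choose i : ℕ) : Pol)) = MvPolynomial.C (x ^ i * N.choose i)
          * (lin v ^ (N - i) * lin ζ ^ i) by simp; ring, sphInt_C_mul]
      ring
    · split_ifs with he
      · rw [add_pow, Finset.mul_sum]
        have hsub : Finset.range (N / 2 + 1) ⊆ Finset.range (N + 1) := by
          apply Finset.range_mono; omega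
        rw [← Finset.sum_subset hsub]
        · refine Finset.sum_congr rfl fun i _ => ?_
          rw [mul_pow]; ring
        · intro i _ hi
          rw [Nat.choose_eq_zero_of_lt (by simp at hi; omega)]; simp
      · simp
  have := coeff_ext h l (by omega)
  rw [show N - l = n by omega] at this
  rw [this, hN]; push_cast; rfl

/-- Funk–Hecke eigenvalues of the powers of the scalar product. -/
def funkHecke (N l : ℕ) : ℝ :=
  if l ≤ N ∧ Even (N - l) then
    4 * Real.pi * N.factorial / (2 ^ ((N - l) / 2) * ((N - l) / 2).factorial
      * (l + N + 1).doubleFactorial) else 0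

lemma funkHecke_add (l j : ℕ) : funkHecke (l + 2 * j) l
    = 4 * Real.pi * (l + 2 * j).factorial
      / (2 ^ j * j.factorial * (2 * l + 2 * j + 1).doubleFactorial) := by
  rw [funkHecke, if_pos ⟨by omega, by rw [Nat.add_sub_cancel_left]; exact even_two_mul j⟩,
    show (l + 2 * j - l) / 2 = j by omega, show l + (l + 2 * j) + 1 = 2 * l + 2 * j + 1 by ring]

lemma doubleFactorial_odd (M : ℕ) :
    ((2 * M + 1).factorial : ℂ) = 2 ^ M * M.factorial * (2 * M + 1).doubleFactorial := by
  have h1 : (2 * M + 1).factorial = (2 * M + 1).doubleFactorial * (2 * M).doubleFactorial :=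
    Nat.factorial_eq_mul_doubleFactorial (2 * M)
  rw [h1, Nat.doubleFactorial_two_mul]; push_cast; ring

lemma sphInt_lin_pow_mul_null_unit (v ζ : Fin 3 → ℂ) (hζ : dot ζ ζ = 0) (hv : dot v v = 1)
    (n l : ℕ) : sphInt (lin v ^ n * lin ζ ^ l) = funkHecke n l * dot v ζ ^ l := by
  have h := sphInt_lin_pow_mul_null v ζ hζ n l
  have hch : ((n + l).choose l : ℂ) ≠ 0 := by
    exact_mod_cast (Nat.choose_pos (by omega)).ne'
  apply mul_left_cancel₀ hch
  rw [h, hv, one_pow, mul_one]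
  by_cases hc : l ≤ n ∧ Even (n - l)
  · obtain ⟨hle, j, hj⟩ := hc
    obtain rfl : n = l + 2 * j := by omega
    rw [funkHecke_add, if_pos ⟨l + j, by ring⟩, show (l + 2 * j + l) / 2 = j + l by omega]
    have n1 : ∀ n : ℕ, (n.factorial : ℂ) ≠ 0 := fun n => by exact_mod_cast n.factorial_ne_zero
    have hd := doubleFactorial_odd (l + j)
    have hf : ((2 * (l + j) + 1).factorial : ℂ)
        = (2 * (l + j) + 1) * (l + 2 * j + l).factorial := by
      rw [show l + 2 * j + l = 2 * (l + j) by ring, Nat.factorial_succ]; push_cast; ring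
    have hD : ((2 * l + 2 * j + 1).doubleFactorial : ℂ) ≠ 0 := by
      exact_mod_cast (Nat.doubleFactorial_pos _).ne'
    rw [show 2 * (l + j) + 1 = 2 * l + 2 * j + 1 by ring] at hd hf
    rw [← Nat.choose_symm_add, ← Nat.choose_symm_add, Nat.cast_add_choose, Nat.cast_add_choose]
    have h3 : (2 * (l + j) + 1 : ℂ) ≠ 0 := by exact_mod_cast (2 * (l + j)).succ_ne_zero
    have h4 : (l + 2 * j + l + 1 : ℂ) ≠ 0 := by
      convert h3 using 1; ring
    have := n1 l; have := n1 j; have := n1 (l + 2 * j); have := n1 (l + 2 * j + l)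
    have := n1 (l + j)
    rw [hd] at hf
    push_cast
    rw [mul_pow, add_comm j l]
    field_simp
    rw [show (l + 2 * j + l + 1 : ℂ) = 2 * (l + j) + 1 by ring, pow_add] at *
    linear_combination dot v ζ ^ l * hf
  · rw [funkHecke, if_neg hc]
    split_ifs with he
    · have : n < l := by
        by_contra hlt
        apply hc
        refine ⟨by omega, ?_⟩
        obtain ⟨k, hk⟩ := he; exact ⟨k - l, by omega⟩
      rw [Nat.choose_eq_zero_of_lt (by omega)]; simp
    · simp

/-- Powers of null linear forms generate the harmonics of degree l, so an integral known against all
of them as a polynomial in τ is known against each harmonic. -/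
lemma sphInt_mul_harm_of_forall {q : Pol} {l : ℕ} {P : Polynomial ℂ} (hP : P.natDegree ≤ 2 * l)
    (h : ∀ τ, sphInt (q * lin (nullVec τ) ^ l) = P.eval τ) (j : ℕ) (hj : j ≤ 2 * l) :
    sphInt (q * harm l j) = P.coeff j := by
  refine coeff_ext (A := 2 * l + 1) (a := fun j => sphInt (q * harm l j)) (b := P.coeff)
    (fun x => ?_) j (by omega)
  rw [← Polynomial.eval_eq_sum_range' (by omega), ← h, lin_nullVec_pow, Finset.mul_sum, map_sum]
  refine Finset.sum_congr rfl fun i _ => ?_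
  rw [mul_left_comm, sphInt_C_mul, mul_comm]

lemma natDegree_genQuad_pow_le (v : Fin 3 → ℂ) (l : ℕ) : (genQuad v ^ l).natDegree ≤ 2 * l :=
  natDegree_quad_pow_le _ _ _ l

/-- The Funk–Hecke formula. -/
theorem sphInt_lin_pow_mul_solid (v : Fin 3 → ℂ) (hv : dot v v = 1) (N : ℕ) (p : LM) :
    sphInt (lin v ^ N * solid p) = funkHecke N p.l * MvPolynomial.eval v (solid p) := by
  rw [solid, mul_left_comm, sphInt_C_mul, map_mul (MvPolynomial.eval v), MvPolynomial.eval_C,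
    eval_coeff_polQuad]
  have := sphInt_mul_harm_of_forall (q := lin v ^ N) (l := p.l)
    (P := Polynomial.C (funkHecke N p.l : ℂ) * genQuad v ^ p.l)
    ((Polynomial.natDegree_C_mul_le _ _).trans (natDegree_genQuad_pow_le v p.l)) (fun τ => by
      rw [sphInt_lin_pow_mul_null_unit v _ (dot_nullVec_self τ) hv, dot_nullVec_right]
      simp) p.idx p.idx_le
  rw [show (polQuad ^ p.l).coeff p.idx = harm p.l p.idx from rfl, this, Polynomial.coeff_C_mul]
  ring

/-- The complex conjugate of the solid harmonic, as a polynomial. -/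
def solidBar (p : LM) : Pol := MvPolynomial.C ((-1) ^ p.m.natAbs) * solid p.neg

lemma eval_solidBar_unit (p : LM) (x : E3) (hx : ‖x‖ = 1) :
    MvPolynomial.eval (toC x) (solidBar p) = (starRingEnd ℂ) (sphericalHarmonic p x) := by
  rw [solidBar, map_mul, MvPolynomial.eval_C, eval_solid_unit _ _ hx, conj_sphericalHarmonic]

lemma sphInt_lin_pow_mul_solidBar (v : Fin 3 → ℂ) (hv : dot v v = 1) (N : ℕ) (p : LM) :
    sphInt (lin v ^ N * solidBar p) = funkHecke N p.l * MvPolynomial.eval v (solidBar p) := by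
  rw [solidBar, mul_left_comm, sphInt_C_mul, sphInt_lin_pow_mul_solid v hv, map_mul,
    MvPolynomial.eval_C, LM.neg_l]
  ring

/-- With both vectors null, the moment formula contains a power of 0 or a vanishing binomial unless
n = l: this is the orthogonality of different degrees. -/
lemma sphInt_null_null (σ τ : ℂ) (n l : ℕ) :
    sphInt (lin (nullVec σ) ^ n * lin (nullVec τ) ^ l) = if n = l then
      4 * Real.pi / (2 * l + 1) / ((2 * l).choose l) * (-4) ^ l * (σ - τ) ^ (2 * l) else 0 := by
  have h := sphInt_lin_pow_mul_null (nullVec σ) _ (dot_nullVec_self τ) n l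
  have hch : ((n + l).choose l : ℂ) ≠ 0 := by
    exact_mod_cast (Nat.choose_pos (by omega)).ne'
  apply mul_left_cancel₀ hch
  rw [h, dot_nullVec_self, dot_nullVec]
  split_ifs with h1 h2 h2
  · subst h2
    rw [← two_mul] at hch
    rw [show (n + n) / 2 = n by omega]
    simp only [Nat.sub_self, pow_zero, Nat.choose_self, mul_one, Nat.cast_one]
    rw [show (2 * (-2 * (σ - τ) ^ 2)) = (-4) * (σ - τ) ^ 2 by ring, mul_pow, ← pow_mul,
      show n + n = 2 * n by ring, show (n + n + 1 : ℂ) = 2 * n + 1 by ring]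
    field_simp
  · rcases lt_or_gt_of_ne h2 with h3 | h3
    · rw [Nat.choose_eq_zero_of_lt (by omega)]; simp
    · rw [zero_pow (by obtain ⟨k, hk⟩ := h1; omega)]; simp
  · exfalso; subst h2; exact h1 ⟨n, rfl⟩
  · simp

/-- The value is the coefficient of σ^i τ^j in a multiple of (σ - τ)^(2l), and homogeneity forces i
+ j = 2l. -/
lemma sphInt_harm_mul_harm (n l i j : ℕ) (hi : i ≤ 2 * n) (hj : j ≤ 2 * l) :
    sphInt (harm n i * harm l j) = if n = l ∧ i + j = 2 * l then
      (4 * Real.pi / (2 * l + 1) / ((2 * l).choose l) * (-4) ^ l * ((2 * l).choose j * (-1) ^ j) : ℂ)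
      else 0 := by
  by_cases hnl : n = l
  swap
  · rw [if_neg (by tauto)]
    have h0 := fun σ => sphInt_mul_harm_of_forall (q := lin (nullVec σ) ^ n) (l := l) (P := 0)
      (by simp) (fun τ => by rw [sphInt_null_null, if_neg hnl]; simp) j hj
    have := sphInt_mul_harm_of_forall (q := harm l j) (l := n) (P := 0)
      (by simp) (fun σ => by rw [mul_comm, h0]; simp) i hi
    rw [mul_comm, this]; simp
  subst hnl
  set c : ℂ := 4 * Real.pi / (2 * n + 1) / ((2 * n).choose n) * (-4) ^ n with hc
  have hdeg : ∀ σ : ℂ, (Polynomial.C c * (Polynomial.C σ - Polynomial.X) ^ (2 * n)).natDegree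
      ≤ 2 * n := by
    intro σ
    refine (Polynomial.natDegree_C_mul_le _ _).trans ?_
    refine (Polynomial.natDegree_pow_le_of_le (2 * n) (?_ : _ ≤ 1)).trans (by simp)
    exact (Polynomial.natDegree_sub_le _ _).trans (by simp)
  have h0 := fun σ => sphInt_mul_harm_of_forall (q := lin (nullVec σ) ^ n) (l := n)
      (P := Polynomial.C c * (Polynomial.C σ - Polynomial.X) ^ (2 * n))
      (hdeg σ) (fun τ => by rw [sphInt_null_null, if_pos rfl]; simp [hc]) j hj
  have hcoef : ∀ σ : ℂ, (Polynomial.C c * (Polynomial.C σ - Polynomial.X) ^ (2 * n)).coeff j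
      = c * ((2 * n).choose j * (-1) ^ j) * σ ^ (2 * n - j) := by
    intro σ
    rw [Polynomial.coeff_C_mul, sub_eq_neg_add, show (-Polynomial.X + Polynomial.C σ)
      = (-1) * (Polynomial.X + Polynomial.C (-σ)) by simp; ring, mul_pow]
    simp only [even_two, Even.mul_right, Even.neg_pow, one_pow, one_mul]
    rw [Polynomial.coeff_X_add_C_pow, neg_pow]
    have : (-1 : ℂ) ^ (2 * n - j) = (-1) ^ j := by
      have h2 : (-1 : ℂ) ^ (2 * n - j) * (-1) ^ j = 1 := by
        rw [← pow_add, Nat.sub_add_cancel hj]; simp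
      have h3 : (-1 : ℂ) ^ j * (-1) ^ j = 1 := by rw [← mul_pow]; simp
      calc _ = (-1 : ℂ) ^ (2 * n - j) * ((-1) ^ j * (-1) ^ j) := by rw [h3, mul_one]
        _ = _ := by rw [← mul_assoc, h2, one_mul]
    rw [this]; ring
  have := sphInt_mul_harm_of_forall (q := harm n j) (l := n)
      (P := Polynomial.C (c * ((2 * n).choose j * (-1) ^ j)) * Polynomial.X ^ (2 * n - j))
      ((Polynomial.natDegree_C_mul_X_pow_le _ _).trans (by omega))
      (fun σ => by rw [mul_comm, h0, hcoef]; simp) i hi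
  rw [mul_comm, this, Polynomial.coeff_C_mul_X_pow]
  by_cases hij : i + j = 2 * n
  · rw [if_pos (by omega), if_pos ⟨rfl, hij⟩]
  · rw [if_neg (by omega), if_neg (by tauto)]

/-- Orthonormality of the spherical harmonics. -/
theorem sphInt_solid_mul_solidBar (p q : LM) :
    sphInt (solid p * solidBar q) = if p = q then 1 else 0 := by
  rw [solidBar, mul_left_comm, sphInt_C_mul, solid, solid,
    mul_mul_mul_comm, ← map_mul, sphInt_C_mul]
  have h := sphInt_harm_mul_harm p.l q.l p.idx q.neg.idx p.idx_le q.neg.idx_le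
  simp only [harm] at h
  rw [LM.neg_l, h]
  have h1 := p.idx_cast; have h2 := q.neg.idx_cast
  rw [LM.neg_m, LM.neg_l] at h2
  by_cases hpq : p = q
  · subst hpq
    rw [if_pos rfl, if_pos ⟨rfl, by omega⟩, normCoeff_neg]
    have hle := p.neg.idx_le
    have hidx := p.neg.idx_neg
    rw [LM.neg_neg, LM.neg_l] at hidx
    have hN : (normCoeff p : ℂ) * normCoeff p = (2 * p.l + 1) / (4 * Real.pi)
        * (p.neg.idx.factorial * (2 * p.l - p.neg.idx).factorial)
          / (2 ^ p.l * p.l.factorial) ^ 2 := by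
      rw [← normCoeff_neg, ← ofReal_mul, ← sq, normCoeff, LM.neg_l, div_pow, mul_pow,
        Real.sq_sqrt (by positivity), Real.sq_sqrt (by positivity)]
      push_cast; ring
    rw [hN]
    rw [LM.neg_l] at hle
    rw [Nat.cast_choose ℂ hle, two_mul p.l, Nat.cast_add_choose, ← two_mul p.l]
    have n1 : ∀ n : ℕ, (n.factorial : ℂ) ≠ 0 := fun n => by exact_mod_cast n.factorial_ne_zero
    have := n1 p.l; have := n1 (2 * p.l); have := n1 p.neg.idx
    have := n1 (2 * p.l - p.neg.idx)
    have h3 : (2 * p.l + 1 : ℂ) ≠ 0 := by exact_mod_cast (2 * p.l).succ_ne_zero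
    have h4 : (Real.pi : ℂ) ≠ 0 := by exact_mod_cast Real.pi_ne_zero
    -- The signs of conjugation, of (-4)^l and of the alternating binomial cancel, since `p.neg.idx`
    -- is l - m.
    have hs : (-1 : ℂ) ^ p.m.natAbs * ((-1) ^ p.l * (-1) ^ p.neg.idx) = 1 := by
      rw [← pow_add, ← pow_add]
      apply Even.neg_one_pow
      rcases le_total 0 p.m with hm | hm
      · exact ⟨p.l, by omega⟩
      · exact ⟨p.l + p.m.natAbs, by omega⟩
    have h5 : (-4 : ℂ) ^ p.l = (-1) ^ p.l * (2 ^ p.l) ^ 2 := by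
      rw [← pow_mul, mul_comm p.l 2, pow_mul, ← mul_pow]; norm_num
    rw [h5]
    field_simp
    linear_combination hs
  · rw [if_neg hpq, if_neg, mul_zero, mul_zero]
    rintro ⟨h3, h4⟩
    exact hpq (LM.ext h3 (by omega))

lemma gauntC_eq_sphInt (p p' p'' : LM) :
    gauntC p p' p'' = 4 * Real.pi * sphInt (solid p * solidBar p' * solidBar p'') := by
  rw [gauntC, sphInt_apply]
  congr 1
  apply solidAngleIntegral_congr
  intro n hn
  simp only [map_mul, eval_solid_unit _ _ hn, eval_solidBar_unit _ _ hn]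

end SphericalWaves
end

/-! ### Integrals of three harmonics and Racah's sum. -/

noncomputable section
namespace SphericalWaves
open Complex

/-- This is the coefficient of x^i y^j in the moment of xu + yv + w. The exponents of the three
mutual products are forced by the three degrees, so a single monomial results. -/
lemma sphInt_null_triple (u v w : Fin 3 → ℂ) (hu : dot u u = 0) (hv : dot v v = 0)
    (hw : dot w w = 0) (N i j : ℕ) (hi : i ≤ N) (hj : j ≤ N) :
    (N.choose i : ℂ) * ((N - i).choose j) * sphInt (lin u ^ i * (lin v ^ j * lin w ^ (N - i - j)))
      = if Even N ∧ N / 2 - i ≤ j then 4 * Real.pi / (N + 1) * 2 ^ (N / 2) * ((N / 2).choose i)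
          * (i.choose (j - (N / 2 - i))) * dot u v ^ (j - (N / 2 - i))
          * dot u w ^ (i - (j - (N / 2 - i))) * dot v w ^ (N / 2 - i) else 0 := by
  set K := N / 2 with hK
  -- the coefficient of `x ^ i`
  have h1 : ∀ y x : ℂ, ∑ i ∈ Finset.range (N + 1),
      ((N.choose i : ℂ) * sphInt (lin u ^ i * (lin (y • v + w)) ^ (N - i))) * x ^ i
      = ∑ i ∈ Finset.range (N + 1), (if Even N then 4 * Real.pi / (N + 1) * 2 ^ K
          * (K.choose i) * (y * dot u v + dot u w) ^ i * (y * dot v w) ^ (K - i) else 0) * x ^ i := by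
    intro y x
    have h1 := sphInt_lin_pow (x • u + (y • v + w)) N
    rw [lin_add, lin_smul, add_pow, map_sum] at h1
    -- All three squares vanish; only the cross products survive.
    have h2 : dot (x • u + (y • v + w)) (x • u + (y • v + w))
        = 2 * (x * (y * dot u v + dot u w) + y * dot v w) := by
      simp only [dot, Pi.add_apply, Pi.smul_apply, smul_eq_mul] at hu hv hw ⊢
      linear_combination x ^ 2 * hu + y ^ 2 * hv + hw
    rw [h2] at h1
    refine Eq.trans (Finset.sum_congr rfl fun i _ => ?_) (h1.trans ?_)
    · rw [mul_pow, ← map_pow, show (MvPolynomial.C (x ^ i) * lin u ^ i * lin (y • v + w) ^ (N - i)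
        * ((N.choose i : ℕ) : Pol)) = MvPolynomial.C (x ^ i * N.choose i)
          * (lin u ^ i * lin (y • v + w) ^ (N - i)) by simp; ring, sphInt_C_mul]
      ring
    · split_ifs with he
      · rw [mul_pow, ← hK, add_pow, Finset.mul_sum, Finset.mul_sum]
        have hsub : Finset.range (K + 1) ⊆ Finset.range (N + 1) := by
          apply Finset.range_mono; omega
        rw [← Finset.sum_subset hsub]
        · refine Finset.sum_congr rfl fun i _ => ?_
          rw [mul_pow]; ring
        · intro i _ hi
          rw [Nat.choose_eq_zero_of_lt (by simp at hi; omega)]; simp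
      · simp
  have h2 : ∀ y : ℂ, _ := fun y => coeff_ext (h1 y) i (by omega)
  -- the coefficient of `y ^ j`
  have h3 : ∀ y : ℂ, ∑ j ∈ Finset.range (N + 1),
      ((N.choose i : ℂ) * ((N - i).choose j)
        * sphInt (lin u ^ i * (lin v ^ j * lin w ^ (N - i - j)))) * y ^ j
      = (N.choose i : ℂ) * sphInt (lin u ^ i * (lin (y • v + w)) ^ (N - i)) := by
    intro y
    rw [lin_add, lin_smul, add_pow, Finset.mul_sum, map_sum, Finset.mul_sum]
    have hsub : Finset.range (N - i + 1) ⊆ Finset.range (N + 1) := by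
      apply Finset.range_mono; omega
    rw [← Finset.sum_subset hsub]
    · refine Finset.sum_congr rfl fun j _ => ?_
      rw [mul_pow, ← map_pow, show lin u ^ i * (MvPolynomial.C (y ^ j) * lin v ^ j
        * lin w ^ (N - i - j) * (((N - i).choose j : ℕ) : Pol))
          = MvPolynomial.C (y ^ j * (N - i).choose j)
          * (lin u ^ i * (lin v ^ j * lin w ^ (N - i - j))) by simp; ring, sphInt_C_mul]
      ring
    · intro j _ hj
      rw [Nat.choose_eq_zero_of_lt (n := N - i) (by simp at hj; omega)]; simp
  set P : Polynomial ℂ := if Even N then Polynomial.C (4 * Real.pi / (N + 1) * 2 ^ K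
    * (K.choose i) * dot v w ^ (K - i)) * ((Polynomial.C (dot u v) * Polynomial.X
      + Polynomial.C (dot u w)) ^ i * Polynomial.X ^ (K - i)) else 0 with hP
  have hPdeg : P.natDegree < N + 1 := by
    rw [hP]; split_ifs with he
    · by_cases hiK : i ≤ K
      · refine lt_of_le_of_lt (Polynomial.natDegree_C_mul_le _ _) ?_
        refine lt_of_le_of_lt (Polynomial.natDegree_mul_le_of_le (m := i) (n := K - i) ?_ ?_) ?_
        · refine (Polynomial.natDegree_pow_le_of_le i
            (Polynomial.natDegree_linear_le (a := dot u v) (b := dot u w))).trans (by simp)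
        · exact Polynomial.natDegree_X_pow_le _
        · omega
      · rw [Nat.choose_eq_zero_of_lt (by omega)]; simp
    · simp
  have h4 : ∀ y : ℂ, ∑ j ∈ Finset.range (N + 1),
      ((N.choose i : ℂ) * ((N - i).choose j)
        * sphInt (lin u ^ i * (lin v ^ j * lin w ^ (N - i - j)))) * y ^ j
      = ∑ j ∈ Finset.range (N + 1), P.coeff j * y ^ j := by
    intro y
    rw [h3, h2, ← Polynomial.eval_eq_sum_range' hPdeg, hP]
    split_ifs
    · simp; ring
    · simp
  rw [coeff_ext h4 j (by omega), hP]
  by_cases he : Even N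
  swap
  · rw [if_neg he, if_neg (by tauto)]; simp
  rw [if_pos he, Polynomial.coeff_C_mul, Polynomial.coeff_mul_X_pow']
  split_ifs with h5 h6 h6
  · have : (Polynomial.C (dot u v) * Polynomial.X + Polynomial.C (dot u w)) ^ i
        = ((Polynomial.X + Polynomial.C (dot u w)) ^ i).comp (Polynomial.C (dot u v) * Polynomial.X) := by
      simp
    rw [this, Polynomial.comp_C_mul_X_coeff, Polynomial.coeff_X_add_C_pow]
    ring
  · tauto
  · tauto
  · simp

lemma coeff_ext_sum {ι : Type*} {A : ℕ} {a : ℕ → ℂ} (s : Finset ι) (b : ι → ℂ) (e : ι → ℕ)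
    (he : ∀ k ∈ s, e k < A)
    (h : ∀ x : ℂ, ∑ i ∈ Finset.range A, a i * x ^ i = ∑ k ∈ s, b k * x ^ e k) :
    ∀ i < A, a i = ∑ k ∈ s, if e k = i then b k else 0 := by
  apply coeff_ext
  intro x
  rw [h]
  simp_rw [Finset.sum_mul]
  rw [Finset.sum_comm]
  refine Finset.sum_congr rfl fun k hk => ?_
  rw [Finset.sum_eq_single (e k)]
  · simp
  · intro i _ hi; rw [if_neg (Ne.symm hi), zero_mul]
  · intro hh; exact absurd (Finset.mem_range.2 (he k hk)) hh

/-- The constant in the integral of three null linear forms. -/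
def tripleConst (a b c : ℕ) : ℝ :=
  4 * Real.pi * (-4) ^ (a + b + c) * (a + b + c).factorial
    * ((b + c).factorial * (a + c).factorial * (a + b).factorial)
    / ((2 * (a + b + c) + 1).factorial * (a.factorial * b.factorial * c.factorial))

/-- Degrees of even sum satisfying the triangle inequalities are exactly (b+c, a+c, a+b); in these
parameters a, b, c are the exponents of the three mutual products, each a multiple of the square of
a difference by `dot_nullVec`. -/
lemma sphInt_nullVec_triple (x y z : ℂ) (a b c : ℕ) :
    sphInt (lin (nullVec x) ^ (b + c) * (lin (nullVec y) ^ (a + c) * lin (nullVec z) ^ (a + b)))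
      = tripleConst a b c * ((x - y) ^ (2 * c) * (x - z) ^ (2 * b) * (y - z) ^ (2 * a)) := by
  have h := sphInt_null_triple (nullVec x) (nullVec y) (nullVec z) (dot_nullVec_self x)
    (dot_nullVec_self y) (dot_nullVec_self z) (2 * (a + b + c)) (b + c) (a + c) (by omega) (by omega)
  rw [show 2 * (a + b + c) - (b + c) - (a + c) = a + b by omega,
    show 2 * (a + b + c) - (b + c) = (a + c) + (a + b) by omega,
    show 2 * (a + b + c) / 2 = a + b + c by omega, show a + b + c - (b + c) = a by omega,
    show a + c - a = c by omega, show b + c - c = b by omega,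
    if_pos ⟨even_two_mul _, by omega⟩, dot_nullVec, dot_nullVec, dot_nullVec] at h
  rw [show 2 * (a + b + c) = (b + c) + ((a + c) + (a + b)) by ring, Nat.cast_add_choose,
    Nat.cast_add_choose, show a + b + c = (b + c) + a by ring, Nat.cast_add_choose,
    ← Nat.choose_symm_add, Nat.cast_add_choose] at h
  rw [tripleConst]
  have n1 : ∀ n : ℕ, (n.factorial : ℂ) ≠ 0 := fun n => by exact_mod_cast n.factorial_ne_zero
  have hf : ((2 * (a + b + c) + 1).factorial : ℂ)
      = (2 * (a + b + c) + 1) * (b + c + (a + c + (a + b))).factorial := by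
    rw [Nat.factorial_succ, show 2 * (a + b + c) = b + c + (a + c + (a + b)) by ring]
    push_cast; ring
  have h3 : (2 * (a + b + c) + 1 : ℂ) ≠ 0 := by exact_mod_cast (2 * (a + b + c)).succ_ne_zero
  push_cast
  rw [hf]
  have := n1 a; have := n1 b; have := n1 c; have := n1 (b + c); have := n1 (a + c)
  have := n1 (a + b); have := n1 (b + c + (a + c + (a + b))); have := n1 (a + c + (a + b))
  push_cast at h
  have h4 : ((b + c) + ((a + c) + (a + b)) + 1 : ℂ) = 2 * (a + b + c) + 1 := by ring
  rw [h4] at h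
  rw [show a + b + c = b + c + a by ring]
  field_simp at h ⊢
  rw [h]
  have hneg : ∀ (w : ℂ) (n : ℕ), (-(2 * w ^ 2)) ^ n = (-2) ^ n * w ^ (2 * n) := by
    intro w n
    rw [pow_mul, ← mul_pow]; congr 1; ring
  rw [hneg, hneg, hneg]
  rw [show (-4 : ℂ) = 2 * (-2) by norm_num, mul_pow]
  ring

/-- The sum in Racah's formula. -/
def racahSum (j₁ j₂ j₃ : ℕ) (m₁ m₂ : ℤ) : ℝ :=
  ∑ t ∈ Finset.range (j₁ + j₂ + 1),
    (-1) ^ t * invFactorial t * invFactorial (j₃ - j₂ + t + m₁)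
      * invFactorial (j₃ - j₁ + t - m₂) * invFactorial (j₁ + j₂ - j₃ - t)
      * invFactorial (j₁ - t - m₁) * invFactorial (j₂ - t + m₂)

lemma invFactorial_of_neg {n : ℤ} (h : n < 0) : invFactorial n = 0 := if_neg (by omega)

lemma invFactorial_natCast (n : ℕ) : invFactorial n = 1 / n.factorial := by
  simp [invFactorial]

/-- The convention that 1/k! is 0 for negative k encodes the range of summation, so no case
distinction on the integer `U` is needed afterwards. -/
lemma sum_choose_eq_invFactorial (n : ℕ) (U : ℤ) :
    (∑ u ∈ Finset.range (n + 1), if (u : ℤ) = U then ((n.choose u : ℕ) : ℝ) else 0)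
      = n.factorial * (invFactorial U * invFactorial (n - U)) := by
  by_cases h : 0 ≤ U ∧ U ≤ n
  · obtain ⟨k, rfl⟩ := Int.eq_ofNat_of_zero_le h.1
    have hk : k ≤ n := by exact_mod_cast h.2
    rw [Finset.sum_eq_single k]
    · rw [if_pos rfl, ← Nat.cast_sub hk, invFactorial_natCast, invFactorial_natCast,
        Nat.cast_choose ℝ hk]
      ring
    · intro u _ hu; rw [if_neg (by exact_mod_cast hu)]
    · intro hh; exact absurd (Finset.mem_range.2 (by omega)) hh
  · rw [Finset.sum_eq_zero]
    · rcases not_and_or.1 h with h | h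
      · rw [invFactorial_of_neg (n := U) (by omega)]; simp
      · rw [invFactorial_of_neg (n := n - U) (by omega)]; simp
    · intro u hu
      rw [if_neg]
      rintro rfl
      exact h ⟨by positivity, by simp at hu; omega⟩

lemma sub_pow_eq_sum (x y : ℂ) (n : ℕ) :
    (x - y) ^ n = ∑ t ∈ Finset.range (n + 1), ((-1) ^ t * n.choose t) * (y ^ t * x ^ (n - t)) := by
  rw [sub_eq_neg_add, add_pow]
  refine Finset.sum_congr rfl fun t _ => ?_
  rw [neg_pow]; ring

/-- Coefficients of a triple product of differences. -/
lemma sphInt_harm_triple_sum (a b c i j k : ℕ) (hi : i ≤ 2 * (b + c)) (hj : j ≤ 2 * (a + c))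
    (hk : k ≤ 2 * (a + b)) :
    sphInt (harm (b + c) i * (harm (a + c) j * harm (a + b) k))
      = tripleConst a b c * ∑ t ∈ Finset.range (2 * c + 1), ∑ u ∈ Finset.range (2 * b + 1),
        ∑ v ∈ Finset.range (2 * a + 1), if u + v = k then (if t + (2 * a - v) = j then
          (if 2 * c - t + (2 * b - u) = i then (((-1) ^ t * (2 * c).choose t)
            * ((-1) ^ u * (2 * b).choose u) * ((-1) ^ v * (2 * a).choose v) : ℂ) else 0)
            else 0) else 0 := by
  set s := (Finset.range (2 * c + 1) ×ˢ (Finset.range (2 * b + 1) ×ˢ Finset.range (2 * a + 1)))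
    with hs
  set w : ℕ × ℕ × ℕ → ℂ := fun q => tripleConst a b c * (((-1) ^ q.1 * (2 * c).choose q.1)
            * ((-1) ^ q.2.1 * (2 * b).choose q.2.1) * ((-1) ^ q.2.2 * (2 * a).choose q.2.2)) with hw
  have h0 : ∀ x y z : ℂ,
      sphInt (lin (nullVec x) ^ (b + c) * (lin (nullVec y) ^ (a + c) * lin (nullVec z) ^ (a + b)))
      = ∑ q ∈ s, w q * z ^ (q.2.1 + q.2.2) * y ^ (q.1 + (2 * a - q.2.2))
          * x ^ (2 * c - q.1 + (2 * b - q.2.1)) := by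
    intro x y z
    rw [sphInt_nullVec_triple, sub_pow_eq_sum x y, sub_pow_eq_sum x z, sub_pow_eq_sum y z, hs,
      Finset.sum_product, Finset.sum_mul_sum, Finset.sum_mul, Finset.mul_sum]
    refine Finset.sum_congr rfl fun t _ => ?_
    rw [Finset.sum_product, Finset.sum_mul_sum, Finset.mul_sum]
    refine Finset.sum_congr rfl fun u _ => ?_
    rw [Finset.mul_sum]
    refine Finset.sum_congr rfl fun v _ => ?_
    simp only [hw, pow_add]; ring
  have e1 : ∀ (q : Pol) (x : ℂ) (l : ℕ), sphInt (lin (nullVec x) ^ l * q)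
      = ∑ i ∈ Finset.range (2 * l + 1), sphInt (harm l i * q) * x ^ i := by
    intro q x l
    rw [lin_nullVec_pow, Finset.sum_mul, map_sum]
    refine Finset.sum_congr rfl fun i _ => ?_
    rw [mul_assoc, sphInt_C_mul, mul_comm]
  have hmem : ∀ q ∈ s, q.1 ≤ 2 * c ∧ q.2.1 ≤ 2 * b ∧ q.2.2 ≤ 2 * a := by
    intro q hq
    simp only [hs, Finset.mem_product, Finset.mem_range] at hq; omega
  -- The exponents of x, y and z are fixed one variable at a time; each extraction adds one
  -- condition on the summation indices.
  have h1 : ∀ y z : ℂ, _ := fun y z => coeff_ext_sum (A := 2 * (b + c) + 1) s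
    (fun q => w q * z ^ (q.2.1 + q.2.2) * y ^ (q.1 + (2 * a - q.2.2)))
    (fun q => 2 * c - q.1 + (2 * b - q.2.1)) (fun q hq => by have := hmem q hq; omega)
    (fun x => by rw [← h0, e1]) i (by omega)
  have h2 : ∀ z : ℂ, _ := fun z => coeff_ext_sum (A := 2 * (a + c) + 1)
    (a := fun j => sphInt (harm (a + c) j * (harm (b + c) i * lin (nullVec z) ^ (a + b)))) s
    (fun q => if 2 * c - q.1 + (2 * b - q.2.1) = i then w q * z ^ (q.2.1 + q.2.2) else 0)
    (fun q => q.1 + (2 * a - q.2.2)) (fun q hq => by have := hmem q hq; omega)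
    (fun y => by
      rw [← e1, mul_left_comm, h1]
      refine Finset.sum_congr rfl fun q _ => ?_
      split_ifs <;> simp) j (by omega)
  have h3 := coeff_ext_sum (A := 2 * (a + b) + 1)
    (a := fun k => sphInt (harm (a + b) k * (harm (a + c) j * harm (b + c) i))) s
    (fun q => if q.1 + (2 * a - q.2.2) = j then
      (if 2 * c - q.1 + (2 * b - q.2.1) = i then w q else 0) else 0)
    (fun q => q.2.1 + q.2.2) (fun q hq => by have := hmem q hq; omega)
    (fun z => by
      rw [← e1, mul_comm, mul_assoc, h2]
      refine Finset.sum_congr rfl fun q _ => ?_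
      split_ifs <;> simp) k (by omega)
  rw [show harm (b + c) i * (harm (a + c) j * harm (a + b) k)
    = harm (a + b) k * (harm (a + c) j * harm (b + c) i) by ring, h3, hs, Finset.sum_product,
    Finset.mul_sum]
  refine Finset.sum_congr rfl fun t _ => ?_
  rw [Finset.sum_product, Finset.mul_sum]
  refine Finset.sum_congr rfl fun u _ => ?_
  rw [Finset.mul_sum]
  refine Finset.sum_congr rfl fun v _ => ?_
  simp only [hw]
  split_ifs <;> simp

/-- Of the three binomial indices, fixing the exponents leaves only t free: u = 2c + 2b - t - i and
v = t + 2a - j. The remaining sum of products of binomials is Racah's, and the signs of u and v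
combine to (-1)^k. -/
lemma sphInt_harm_triple (a b c i j k : ℕ) (hi : i ≤ 2 * (b + c)) (hj : j ≤ 2 * (a + c))
    (hk : k ≤ 2 * (a + b)) :
    sphInt (harm (b + c) i * (harm (a + c) j * harm (a + b) k))
      = if i + j + k = 2 * (a + b + c) then ((tripleConst a b c * ((-1) ^ k
          * ((2 * a).factorial * (2 * b).factorial * (2 * c).factorial)
          * racahSum (b + c) (a + c) (a + b) (i - (b + c : ℕ)) (j - (a + c : ℕ))) : ℝ) : ℂ)
        else 0 := by
  rw [sphInt_harm_triple_sum a b c i j k hi hj hk]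
  split_ifs with hsum
  swap
  · rw [Finset.sum_eq_zero, mul_zero]
    intro t ht
    refine Finset.sum_eq_zero fun u hu => Finset.sum_eq_zero fun v hv => ?_
    simp only [Finset.mem_range] at ht hu hv
    split_ifs <;> first | rfl | omega
  rw [ofReal_mul]
  congr 1
  have h1 : ∀ t ∈ Finset.range (2 * c + 1), (∑ u ∈ Finset.range (2 * b + 1),
        ∑ v ∈ Finset.range (2 * a + 1), if u + v = k then (if t + (2 * a - v) = j then
          (if 2 * c - t + (2 * b - u) = i then ((-1 : ℂ) ^ t * (2 * c).choose t)
            * ((-1) ^ u * (2 * b).choose u) * ((-1) ^ v * (2 * a).choose v) else 0) else 0) else 0)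
      = (((-1) ^ k * ((-1) ^ t * (2 * c).choose t)
          * (∑ u ∈ Finset.range (2 * b + 1), if (u : ℤ) = 2 * c + 2 * b - t - i
            then (((2 * b).choose u : ℕ) : ℝ) else 0)
          * (∑ v ∈ Finset.range (2 * a + 1), if (v : ℤ) = t + 2 * a - j
            then (((2 * a).choose v : ℕ) : ℝ) else 0) : ℝ) : ℂ) := by
    intro t ht
    rw [mul_assoc, Finset.sum_mul_sum]
    push_cast
    rw [Finset.mul_sum]
    refine Finset.sum_congr rfl fun u hu => ?_
    rw [Finset.mul_sum]
    refine Finset.sum_congr rfl fun v hv => ?_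
    simp only [Finset.mem_range] at ht hu hv
    by_cases hu' : (u : ℤ) = 2 * c + 2 * b - t - i
    · by_cases hv' : (v : ℤ) = t + 2 * a - j
      · rw [if_pos hu', if_pos hv', if_pos (by omega), if_pos (by omega), if_pos (by omega)]
        have : (-1 : ℂ) ^ k = (-1) ^ u * (-1) ^ v := by
          rw [← pow_add]; congr 1; omega
        rw [this]; push_cast; ring
      · rw [if_neg hv']
        split_ifs <;> first | omega | simp
    · rw [if_neg hu']
      split_ifs <;> first | omega | simp
  rw [Finset.sum_congr rfl h1, ← ofReal_sum]
  congr 1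
  rw [racahSum, mul_assoc ((-1 : ℝ) ^ k), Finset.mul_sum, Finset.mul_sum]
  -- Racah's range is longer, but its terms with t > 2c vanish through 1/(2c - t)!.
  have hsub : Finset.range (2 * c + 1) ⊆ Finset.range (b + c + (a + c) + 1) := by
    apply Finset.range_mono; omega
  rw [← Finset.sum_subset hsub]
  · refine Finset.sum_congr rfl fun t ht => ?_
    rw [sum_choose_eq_invFactorial, sum_choose_eq_invFactorial]
    have ht' : t ≤ 2 * c := by simp at ht; omega
    rw [Nat.cast_choose ℝ ht', invFactorial_natCast]
    have e1 : (((b + c : ℕ) : ℤ) + (a + c : ℕ) - (a + b : ℕ) - t) = ((2 * c - t : ℕ) : ℤ) := by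
      push_cast [ht']; ring
    rw [e1, invFactorial_natCast]
    have e2 : (((a + b : ℕ) : ℤ) - (a + c : ℕ) + t + (i - (b + c : ℕ)))
        = ((2 * b : ℕ) : ℤ) - (2 * c + 2 * b - t - i) := by push_cast; ring
    have e3 : (((a + b : ℕ) : ℤ) - (b + c : ℕ) + t - (j - (a + c : ℕ))) = t + 2 * a - j := by
      push_cast; ring
    have e4 : (((b + c : ℕ) : ℤ) - t - (i - (b + c : ℕ))) = 2 * c + 2 * b - t - i := by
      push_cast; ring
    have e5 : (((a + c : ℕ) : ℤ) - t + (j - (a + c : ℕ)))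
        = ((2 * a : ℕ) : ℤ) - (t + 2 * a - j) := by push_cast; ring
    rw [e2, e3, e4, e5]
    ring
  · intro t _ ht
    rw [invFactorial_of_neg (n := ((b + c : ℕ) : ℤ) + (a + c : ℕ) - (a + b : ℕ) - t)]
    · simp
    · simp at ht; push_cast; omega

end SphericalWaves
end

/-! ### Selection rules and Dixon's identity. -/

noncomputable section
namespace SphericalWaves
open Complex

/-- An odd total degree kills the moment; if l₁ > l₂ + l₃ then l₁ exceeds half the total degree and
the binomial in `sphInt_null_triple` is zero. -/
lemma sphInt_harm_triple_eq_zero (l₁ l₂ l₃ i j k : ℕ) (hi : i ≤ 2 * l₁) (hj : j ≤ 2 * l₂)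
    (hk : k ≤ 2 * l₃) (h : Odd (l₁ + l₂ + l₃) ∨ l₂ + l₃ < l₁) :
    sphInt (harm l₁ i * (harm l₂ j * harm l₃ k)) = 0 := by
  have h0 : ∀ x y z : ℂ,
      sphInt (lin (nullVec x) ^ l₁ * (lin (nullVec y) ^ l₂ * lin (nullVec z) ^ l₃)) = 0 := by
    intro x y z
    have h1 := sphInt_null_triple (nullVec x) (nullVec y) (nullVec z) (dot_nullVec_self x)
      (dot_nullVec_self y) (dot_nullVec_self z) (l₁ + l₂ + l₃) l₁ l₂ (by omega) (by omega)
    rw [show l₁ + l₂ + l₃ - l₁ - l₂ = l₃ by omega] at h1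
    have h2 : ((l₁ + l₂ + l₃).choose l₁ : ℂ) * ((l₁ + l₂ + l₃ - l₁).choose l₂) ≠ 0 := by
      have a1 := (Nat.choose_pos (show l₁ ≤ l₁ + l₂ + l₃ by omega)).ne'
      have a2 := (Nat.choose_pos (show l₂ ≤ l₁ + l₂ + l₃ - l₁ by omega)).ne'
      exact_mod_cast mul_ne_zero a1 a2
    apply (mul_eq_zero.1 (h1.trans ?_)).resolve_left h2
    rcases h with h | h
    · rw [if_neg]
      rw [← Nat.not_even_iff_odd] at h; tauto
    · rw [Nat.choose_eq_zero_of_lt (n := (l₁ + l₂ + l₃) / 2) (k := l₁) (by omega)]; simp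
  have h1 : ∀ x y, sphInt (lin (nullVec x) ^ l₁ * (lin (nullVec y) ^ l₂ * harm l₃ k)) = 0 := by
    intro x y
    have := sphInt_mul_harm_of_forall (q := lin (nullVec x) ^ l₁ * lin (nullVec y) ^ l₂) (l := l₃)
      (P := 0) (by simp) (fun z => by rw [mul_assoc, h0]; simp) k hk
    simpa [mul_assoc] using this
  have h2 : ∀ x, sphInt (lin (nullVec x) ^ l₁ * (harm l₂ j * harm l₃ k)) = 0 := by
    intro x
    have := sphInt_mul_harm_of_forall (q := lin (nullVec x) ^ l₁ * harm l₃ k) (l := l₂)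
      (P := 0) (by simp) (fun z => by rw [mul_assoc, mul_comm (harm l₃ k), h1]; simp) j hj
    rw [mul_comm (harm l₂ j), ← mul_assoc]; simpa using this
  have := sphInt_mul_harm_of_forall (q := harm l₂ j * harm l₃ k) (l := l₁)
      (P := 0) (by simp) (fun z => by rw [mul_comm, h2]; simp) i hi
  rw [mul_comm]; simpa using this

/-- Valid for every integer, including n ≤ 0, which makes the hypergeometric shift relations below
free of boundary cases. -/
lemma invFactorial_sub_one (n : ℤ) : invFactorial (n - 1) = n * invFactorial n := by
  rcases lt_trichotomy n 0 with h | h | h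
  · rw [invFactorial_of_neg h, invFactorial_of_neg (by omega)]; simp
  · subst h; rw [invFactorial_of_neg (by omega)]; simp
  · obtain ⟨k, rfl⟩ : ∃ k : ℕ, n = k + 1 := ⟨(n - 1).toNat, by omega⟩
    rw [add_sub_cancel_right, invFactorial_natCast,
      show ((k : ℤ) + 1) = ((k + 1 : ℕ) : ℤ) by push_cast; ring, invFactorial_natCast,
      Nat.factorial_succ]
    have : (k.factorial : ℝ) ≠ 0 := by positivity
    push_cast; field_simp

/-- The summand of Dixon's identity. -/
def dixonTerm (a b c k : ℤ) : ℝ :=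
  invFactorial (a + k) * invFactorial (a - k) * (invFactorial (b + k) * invFactorial (b - k))
    * (invFactorial (c + k) * invFactorial (c - k))

lemma dixonTerm_eq_zero {a b c k : ℤ} (h : c < |k|) : dixonTerm a b c k = 0 := by
  rw [dixonTerm]
  rcases abs_cases k with ⟨h1, _⟩ | ⟨h1, _⟩
  · rw [invFactorial_of_neg (n := c - k) (by omega)]; simp
  · rw [invFactorial_of_neg (n := c + k) (by omega)]; simp

lemma dixonTerm_succ (a b c k : ℤ) :
    dixonTerm a b c k = ((c + 1 + k) * (c + 1 - k)) * dixonTerm a b (c + 1) k := by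
  have h1 := invFactorial_sub_one (c + 1 + k)
  have h2 := invFactorial_sub_one (c + 1 - k)
  rw [show c + 1 + k - 1 = c + k by ring] at h1
  rw [show c + 1 - k - 1 = c - k by ring] at h2
  rw [dixonTerm, h1, h2, dixonTerm]; push_cast; ring

/-- The telescoping certificate for Dixon's identity. -/
def dixonCert (a b C k : ℤ) : ℝ :=
  invFactorial (a + k - 1) * invFactorial (a - k)
    * (invFactorial (b + k - 1) * invFactorial (b - k))
    * (invFactorial (C + k - 1) * invFactorial (C - k)) / 2

lemma dixonCert_eq (a b C k : ℤ) :
    dixonCert a b C k = (a + k) * (b + k) * (C + k) / 2 * dixonTerm a b C k := by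
  rw [dixonCert, invFactorial_sub_one, invFactorial_sub_one, invFactorial_sub_one, dixonTerm]
  push_cast; ring

lemma dixonCert_succ (a b C k : ℤ) :
    dixonCert a b C (k + 1) = (a - k) * (b - k) * (C - k) / 2 * dixonTerm a b C k := by
  rw [dixonCert, show a + (k + 1) - 1 = a + k by ring, show b + (k + 1) - 1 = b + k by ring,
    show C + (k + 1) - 1 = C + k by ring, show a - (k + 1) = a - k - 1 by ring,
    show b - (k + 1) = b - k - 1 by ring, show C - (k + 1) = C - k - 1 by ring,
    invFactorial_sub_one, invFactorial_sub_one, invFactorial_sub_one, dixonTerm]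
  push_cast; ring

/-- The alternating sum in Dixon's identity. -/
def dixonSum (a b c : ℕ) : ℝ :=
  ∑ t ∈ Finset.range (2 * c + 1), (-1) ^ t * dixonTerm a b c (t - c)

/-- Creative telescoping in c: the recursion holds summand by summand up to a difference of values
of `dixonCert`, which vanishes at both ends. -/
lemma dixonSum_succ (a b c : ℕ) :
    ((c + 1) * (b + c + 1) * (a + c + 1) : ℝ) * dixonSum a b (c + 1)
      = -(a + b + c + 1) * dixonSum a b c := by
  have a1 : (c : ℤ) < |((2 * c + 1 + 1 : ℕ) : ℤ) - (c + 1)| := by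
    push_cast; rw [abs_of_nonneg (by omega)]; omega
  have a2 : (c : ℤ) < |((0 : ℕ) : ℤ) - (c + 1)| := by
    push_cast; rw [abs_of_nonpos (by omega)]; omega
  -- Centring the sum at c + 1 adds two end terms with |k| = c + 1, which are zero, and shifts t by
  -- one, which flips the sign.
  have h1 : dixonSum a b c = - ∑ t ∈ Finset.range (2 * (c + 1) + 1),
      (-1) ^ t * dixonTerm a b c (t - (c + 1)) := by
    rw [show 2 * (c + 1) + 1 = 2 * c + 1 + 1 + 1 by ring, Finset.sum_range_succ,
      Finset.sum_range_succ', dixonTerm_eq_zero (k := ((2 * c + 1 + 1 : ℕ) : ℤ) - (c + 1)) a1,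
      dixonTerm_eq_zero (k := ((0 : ℕ) : ℤ) - (c + 1)) a2]
    simp only [mul_zero, add_zero, dixonSum, ← Finset.sum_neg_distrib]
    refine Finset.sum_congr rfl fun t _ => ?_
    rw [pow_succ, show ((t + 1 : ℕ) : ℤ) - (c + 1) = t - c by push_cast; ring]; ring
  have h2 : ∀ t : ℕ, ((c + 1) * (b + c + 1) * (a + c + 1) : ℝ)
        * ((-1) ^ t * dixonTerm a b (c + 1 : ℕ) (t - (c + 1 : ℕ)))
        - (a + b + c + 1) * ((-1) ^ t * dixonTerm a b c (t - (c + 1)))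
      = (-1) ^ t * dixonCert a b (c + 1) (t - (c + 1))
        - (-1) ^ (t + 1) * dixonCert a b (c + 1) ((t + 1 : ℕ) - (c + 1)) := by
    intro t
    rw [show (((t + 1 : ℕ) : ℤ) - (c + 1)) = (t - (c + 1)) + 1 by push_cast; ring,
      dixonCert_succ, dixonCert_eq, dixonTerm_succ a b c, pow_succ,
      show ((c + 1 : ℕ) : ℤ) = c + 1 by push_cast; ring]
    push_cast; ring
  have h3 := Finset.sum_range_sub'
    (fun t : ℕ => (-1 : ℝ) ^ t * dixonCert a b (c + 1) (t - (c + 1))) (2 * (c + 1) + 1)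
  rw [← Finset.sum_congr rfl (fun t _ => h2 t), Finset.sum_sub_distrib, ← Finset.mul_sum,
    ← Finset.mul_sum] at h3
  have h4 : dixonCert a b (c + 1) ((0 : ℕ) - (c + 1)) = 0 := by
    rw [dixonCert, invFactorial_of_neg (n := (c : ℤ) + 1 + ((0 : ℕ) - (c + 1)) - 1) (by push_cast; omega)]
    simp
  have h5 : dixonCert a b (c + 1) ((2 * (c + 1) + 1 : ℕ) - (c + 1)) = 0 := by
    rw [dixonCert, invFactorial_of_neg (n := (c : ℤ) + 1 - (((2 * (c + 1) + 1 : ℕ) : ℤ) - (c + 1)))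
      (by push_cast; omega)]
    simp
  rw [h4, h5] at h3
  rw [h1]
  simp only [dixonSum]
  linarith

/-- Dixon's identity. -/
theorem dixonSum_eq (a b c : ℕ) : dixonSum a b c = (-1) ^ c * (a + b + c).factorial
    / (a.factorial * b.factorial * c.factorial
      * ((a + b).factorial * (b + c).factorial * (a + c).factorial)) := by
  induction c with
  | zero =>
    simp only [dixonSum, dixonTerm]
    simp [invFactorial_natCast]
    have : ((a + b).factorial : ℝ) ≠ 0 := by positivity
    have : (a.factorial : ℝ) ≠ 0 := by positivity
    have : (b.factorial : ℝ) ≠ 0 := by positivity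
    simp [invFactorial]
    field_simp
  | succ c ih =>
    have h := dixonSum_succ a b c
    have h1 : ((c + 1) * (b + c + 1) * (a + c + 1) : ℝ) ≠ 0 := by positivity
    apply mul_left_cancel₀ h1
    rw [h, ih, ← add_assoc, ← add_assoc, ← add_assoc, Nat.factorial_succ, Nat.factorial_succ c,
      Nat.factorial_succ (b + c), Nat.factorial_succ (a + c)]
    have : (a.factorial : ℝ) ≠ 0 := by positivity
    have : (b.factorial : ℝ) ≠ 0 := by positivity
    have : (c.factorial : ℝ) ≠ 0 := by positivity
    have : ((a + b).factorial : ℝ) ≠ 0 := by positivity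
    have : ((b + c).factorial : ℝ) ≠ 0 := by positivity
    have : ((a + c).factorial : ℝ) ≠ 0 := by positivity
    push_cast; field_simp; ring

lemma racahSum_zero_eq_dixonSum (a b c : ℕ) :
    racahSum (b + c) (a + c) (a + b) 0 0 = dixonSum a b c := by
  rw [racahSum, dixonSum]
  have hsub : Finset.range (2 * c + 1) ⊆ Finset.range (b + c + (a + c) + 1) := by
    apply Finset.range_mono; omega
  rw [← Finset.sum_subset hsub]
  · refine Finset.sum_congr rfl fun t _ => ?_
    rw [dixonTerm]
    have e1 : (((b + c : ℕ) : ℤ) + (a + c : ℕ) - (a + b : ℕ) - t) = c - (t - c) := by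
      push_cast; ring
    have e2 : (((a + b : ℕ) : ℤ) - (a + c : ℕ) + t + 0) = b + (t - c) := by push_cast; ring
    have e3 : (((a + b : ℕ) : ℤ) - (b + c : ℕ) + t - 0) = a + (t - c) := by push_cast; ring
    have e4 : (((b + c : ℕ) : ℤ) - t - 0) = b - (t - c) := by push_cast; ring
    have e5 : (((a + c : ℕ) : ℤ) - t + 0) = a - (t - c) := by push_cast; ring
    have e6 : (t : ℤ) = c + (t - c) := by ring
    rw [e1, e2, e3, e4, e5]
    nth_rewrite 2 [e6]
    ring_nf
  · intro t _ ht
    rw [invFactorial_of_neg (n := ((b + c : ℕ) : ℤ) + (a + c : ℕ) - (a + b : ℕ) - t)]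
    · simp
    · simp at ht; push_cast; omega

/-- The reflection t ↦ j₁ + j₂ - j₃ - t permutes the factorials and reverses the sign, so the sum
equals its own negative. -/
lemma racahSum_zero_of_odd (j₁ j₂ j₃ : ℕ) (h3 : j₃ ≤ j₁ + j₂) (hodd : Odd (j₁ + j₂ + j₃)) :
    racahSum j₁ j₂ j₃ 0 0 = 0 := by
  obtain ⟨n, hn⟩ : ∃ n, j₁ + j₂ = j₃ + n := ⟨j₁ + j₂ - j₃, by omega⟩
  have hnodd : Odd n := by
    obtain ⟨k, hk⟩ := hodd
    exact ⟨k - j₃, by omega⟩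
  set f : ℕ → ℝ := fun t => (-1) ^ t * invFactorial t * invFactorial (j₃ - j₂ + t + 0)
      * invFactorial (j₃ - j₁ + t - 0) * invFactorial (j₁ + j₂ - j₃ - t)
      * invFactorial (j₁ - t - 0) * invFactorial (j₂ - t + 0) with hf
  have h1 : racahSum j₁ j₂ j₃ 0 0 = ∑ t ∈ Finset.range (n + 1), f t := by
    rw [racahSum]
    refine (Finset.sum_subset (Finset.range_mono (by omega)) fun t _ ht => ?_).symm
    rw [invFactorial_of_neg (n := (j₁ : ℤ) + j₂ - j₃ - t)]
    · simp
    · simp at ht; omega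
  have h2 : ∑ t ∈ Finset.range (n + 1), f t = ∑ t ∈ Finset.range (n + 1), -f t := by
    rw [← Finset.sum_range_reflect]
    refine Finset.sum_congr rfl fun t ht => ?_
    have ht' : t ≤ n := by simp at ht; omega
    have hc : ((n - t : ℕ) : ℤ) = n - t := by push_cast [ht']; ring
    have hs : (-1 : ℝ) ^ (n - t) = -(-1) ^ t := by
      have h2 : (-1 : ℝ) ^ (n - t) * (-1) ^ t = -1 := by
        rw [← pow_add, Nat.sub_add_cancel ht', hnodd.neg_one_pow]
      have h3 : (-1 : ℝ) ^ t * (-1) ^ t = 1 := by rw [← mul_pow]; simp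
      calc _ = (-1 : ℝ) ^ (n - t) * ((-1) ^ t * (-1) ^ t) := by rw [h3, mul_one]
        _ = _ := by rw [← mul_assoc, h2]; ring
    simp only [hf, show n + 1 - 1 - t = n - t by omega, hc, hs]
    rw [show (j₃ : ℤ) - j₂ + (n - t) + 0 = j₁ - t - 0 by omega,
      show (j₃ : ℤ) - j₁ + (n - t) - 0 = j₂ - t + 0 by omega,
      show (j₁ : ℤ) + j₂ - j₃ - (n - t) = t by omega,
      show (j₁ : ℤ) - (n - t) - 0 = j₃ - j₂ + t + 0 by omega,
      show (j₂ : ℤ) - (n - t) + 0 = j₃ - j₁ + t - 0 by omega,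
      show (n : ℤ) - t = j₁ + j₂ - j₃ - t by omega]
    ring
  rw [Finset.sum_neg_distrib] at h2
  rw [h1]; linarith

/-! ### Wigner 3j symbols and the Gaunt coefficients. -/

lemma wigner3j_eq (j₁ j₂ j₃ : ℕ) (m₁ m₂ m₃ : ℤ) :
    wigner3j j₁ j₂ j₃ m₁ m₂ m₃ =
  if m₁ + m₂ + m₃ = 0 ∧ |m₁| ≤ (j₁ : ℤ) ∧ |m₂| ≤ (j₂ : ℤ) ∧ |m₃| ≤ (j₃ : ℤ)
      ∧ j₃ ≤ j₁ + j₂ ∧ j₁ ≤ j₂ + j₃ ∧ j₂ ≤ j₁ + j₃ then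
    (-1) ^ ((j₁ : ℤ) - j₂ - m₃)
      * Real.sqrt (((j₁ + j₂ - j₃).factorial * (j₁ + j₃ - j₂).factorial
          * (j₂ + j₃ - j₁).factorial : ℝ) / (j₁ + j₂ + j₃ + 1).factorial)
      * Real.sqrt ((j₁ + m₁).toNat.factorial * (j₁ - m₁).toNat.factorial
          * (j₂ + m₂).toNat.factorial * (j₂ - m₂).toNat.factorial
          * (j₃ + m₃).toNat.factorial * (j₃ - m₃).toNat.factorial)
      * racahSum j₁ j₂ j₃ m₁ m₂
  else 0 := rfl

lemma wigner3j_zero_of_odd (j₁ j₂ j₃ : ℕ) (hodd : Odd (j₁ + j₂ + j₃)) :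
    wigner3j j₁ j₂ j₃ 0 0 0 = 0 := by
  rw [wigner3j_eq]
  split_ifs with h
  · rw [racahSum_zero_of_odd _ _ _ h.2.2.2.2.1 hodd, mul_zero]
  · rfl

lemma wigner3j_zero_eq (a b c : ℕ) :
    wigner3j (b + c) (a + c) (a + b) 0 0 0 = (-1) ^ (a + b + c)
      * Real.sqrt (((2 * a).factorial * (2 * b).factorial * (2 * c).factorial : ℝ)
        / (2 * (a + b + c) + 1).factorial)
      * ((a + b + c).factorial / (a.factorial * b.factorial * c.factorial)) := by
  rw [wigner3j_eq, if_pos, racahSum_zero_eq_dixonSum, dixonSum_eq,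
    show b + c + (a + c) - (a + b) = 2 * c by omega, show b + c + (a + b) - (a + c) = 2 * b by omega,
    show a + c + (a + b) - (b + c) = 2 * a by omega,
    show b + c + (a + c) + (a + b) + 1 = 2 * (a + b + c) + 1 by ring]
  · have hs : ∀ x : ℕ, ((x : ℤ) + 0).toNat = x := by intro x; simp
    have hs' : ∀ x : ℕ, ((x : ℤ) - 0).toNat = x := by intro x; simp
    simp only [hs, hs']
    have e : ((b + c).factorial * (b + c).factorial * (a + c).factorial * (a + c).factorial
        * (a + b).factorial * (a + b).factorial : ℝ)
        = ((b + c).factorial * (a + c).factorial * (a + b).factorial) ^ 2 := by ring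
    rw [e, Real.sqrt_sq (by positivity)]
    have e2 : (-1 : ℝ) ^ (((b + c : ℕ) : ℤ) - (a + c : ℕ) - 0) * (-1) ^ c = (-1) ^ (a + b + c) := by
      rw [← zpow_natCast, ← zpow_natCast, ← zpow_add₀ (by norm_num)]
      have : (((a + b + c : ℕ) : ℤ)) = (((b + c : ℕ) : ℤ) - (a + c : ℕ) - 0 + (c : ℕ)) + (2 * a) := by
        push_cast; ring
      rw [this, zpow_add₀ (by norm_num) _ (2 * (a : ℤ)), (even_two_mul (a : ℤ)).neg_one_zpow, mul_one]
    rw [← e2]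
    rw [show ((2 * c).factorial * (2 * b).factorial * (2 * a).factorial : ℝ)
      = (2 * a).factorial * (2 * b).factorial * (2 * c).factorial by ring]
    have : (a.factorial : ℝ) ≠ 0 := by positivity
    have : (b.factorial : ℝ) ≠ 0 := by positivity
    have : (c.factorial : ℝ) ≠ 0 := by positivity
    have : ((a + b).factorial : ℝ) ≠ 0 := by positivity
    have : ((b + c).factorial : ℝ) ≠ 0 := by positivity
    have : ((a + c).factorial : ℝ) ≠ 0 := by positivity
    field_simp
  · simp; omega

lemma neg_one_zpow_eq_natAbs (m : ℤ) : (-1 : ℝ) ^ m = (-1) ^ m.natAbs := by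
  rcases Int.natAbs_eq m with h | h
  · nth_rewrite 1 [h]; exact zpow_natCast _ _
  · nth_rewrite 1 [h]; rw [zpow_neg, zpow_natCast, ← inv_pow]; norm_num

lemma idx_toNat (p : LM) : ((p.l : ℤ) + p.m).toNat = p.idx := rfl

lemma idx_toNat_sub (p : LM) : ((p.l : ℤ) - p.m).toNat = 2 * p.l - p.idx := by
  have := p.idx_cast; omega

/-- Outside the triangle range, or for odd l-sum, both sides vanish. Otherwise `sphInt_harm_triple`
supplies the Racah sum of the symbol with the m's, and Dixon's identity identifies the remaining
constant with the symbol at m = 0. -/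
lemma sphInt_solid_triple (p q r : LM) :
    sphInt (solid p * (solid q * solid r))
      = ((Real.sqrt ((2 * p.l + 1) * (2 * q.l + 1) * (2 * r.l + 1) / (4 * Real.pi))
          * wigner3j p.l q.l r.l 0 0 0 * wigner3j p.l q.l r.l p.m q.m r.m : ℝ) : ℂ) := by
  have hN : sphInt (solid p * (solid q * solid r)) = ((normCoeff p * normCoeff q * normCoeff r : ℝ) : ℂ)
      * sphInt (harm p.l p.idx * (harm q.l q.idx * harm r.l r.idx)) := by
    rw [← sphInt_C_mul]; congr 1
    simp only [solid, harm]; push_cast; simp only [map_mul]; ring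
  rw [hN]
  by_cases htri : r.l ≤ p.l + q.l ∧ p.l ≤ q.l + r.l ∧ q.l ≤ p.l + r.l
  swap
  · have h0 : wigner3j p.l q.l r.l 0 0 0 = 0 := by
      rw [wigner3j_eq, if_neg (by tauto)]
    have : sphInt (harm p.l p.idx * (harm q.l q.idx * harm r.l r.idx)) = 0 := by
      by_cases h1 : p.l ≤ q.l + r.l
      · by_cases h2 : q.l ≤ p.l + r.l
        · rw [show harm p.l p.idx * (harm q.l q.idx * harm r.l r.idx)
            = harm r.l r.idx * (harm p.l p.idx * harm q.l q.idx) by ring]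
          exact sphInt_harm_triple_eq_zero _ _ _ _ _ _ r.idx_le p.idx_le q.idx_le (by omega)
        · rw [show harm p.l p.idx * (harm q.l q.idx * harm r.l r.idx)
            = harm q.l q.idx * (harm p.l p.idx * harm r.l r.idx) by ring]
          exact sphInt_harm_triple_eq_zero _ _ _ _ _ _ q.idx_le p.idx_le r.idx_le (by omega)
      · exact sphInt_harm_triple_eq_zero _ _ _ _ _ _ p.idx_le q.idx_le r.idx_le (by omega)
    rw [this, h0]; simp
  by_cases hodd : Odd (p.l + q.l + r.l)
  · rw [sphInt_harm_triple_eq_zero _ _ _ _ _ _ p.idx_le q.idx_le r.idx_le (Or.inl hodd),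
      wigner3j_zero_of_odd _ _ _ hodd]; simp
  rw [Nat.not_odd_iff_even] at hodd
  obtain ⟨a, b, c, h1, h2, h3⟩ : ∃ a b c, p.l = b + c ∧ q.l = a + c ∧ r.l = a + b := by
    obtain ⟨K, hK⟩ := hodd
    exact ⟨K - p.l, K - q.l, K - r.l, by omega, by omega, by omega⟩
  have hp := p.idx_cast; have hq := q.idx_cast; have hr := r.idx_cast
  have key := sphInt_harm_triple a b c p.idx q.idx r.idx (h1 ▸ p.idx_le) (h2 ▸ q.idx_le)
    (h3 ▸ r.idx_le)
  obtain ⟨K, hK⟩ : ∃ K, K = a + b + c := ⟨_, rfl⟩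
  rw [← hK, ← h1, ← h2, ← h3, hp, hq] at key
  rw [show (p.l : ℤ) + p.m - p.l = p.m by ring, show (q.l : ℤ) + q.m - q.l = q.m by ring] at key
  rw [key, wigner3j_eq p.l q.l r.l p.m q.m r.m]
  have hsum : p.idx + q.idx + r.idx = 2 * K ↔ p.m + q.m + r.m = 0 := by omega
  by_cases hm : p.m + q.m + r.m = 0
  swap
  · rw [if_neg (by tauto), if_neg (by tauto)]; simp
  rw [if_pos (by tauto), if_pos ⟨hm, p.abs_m_le, q.abs_m_le, r.abs_m_le, htri⟩, ← ofReal_mul]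
  congr 1
  rw [idx_toNat, idx_toNat, idx_toNat, idx_toNat_sub, idx_toNat_sub, idx_toNat_sub]
  have hw0 := wigner3j_zero_eq a b c
  rw [← hK, ← h1, ← h2, ← h3] at hw0
  rw [hw0]
  simp only [normCoeff]
  have hsq : ∀ (x y : ℝ), 0 ≤ x → Real.sqrt (x * y) = Real.sqrt x * Real.sqrt y :=
    fun x y hx => Real.sqrt_mul hx y
  have e0 : (p.idx.factorial * (2 * p.l - p.idx).factorial * q.idx.factorial
      * (2 * q.l - q.idx).factorial * r.idx.factorial * (2 * r.l - r.idx).factorial : ℝ)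
      = (p.idx.factorial * (2 * p.l - p.idx).factorial) * ((q.idx.factorial
      * (2 * q.l - q.idx).factorial) * (r.idx.factorial * (2 * r.l - r.idx).factorial)) := by ring
  rw [e0, hsq (p.idx.factorial * (2 * p.l - p.idx).factorial) _ (by positivity),
    hsq (q.idx.factorial * (2 * q.l - q.idx).factorial) _ (by positivity)]
  have e1 : p.l + q.l - r.l = 2 * c := by omega
  have e2 : p.l + r.l - q.l = 2 * b := by omega
  have e3 : q.l + r.l - p.l = 2 * a := by omega
  have e4 : p.l + q.l + r.l + 1 = 2 * (K) + 1 := by omega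
  rw [e1, e2, e3, e4]
  rw [show ((2 * c).factorial * (2 * b).factorial * (2 * a).factorial : ℝ)
      = (2 * a).factorial * (2 * b).factorial * (2 * c).factorial by ring]
  -- The same irrational triangle factor occurs in both 3j symbols, so their product contains its
  -- square.
  have hD : Real.sqrt (((2 * a).factorial * (2 * b).factorial * (2 * c).factorial : ℝ)
        / (2 * (K) + 1).factorial) * Real.sqrt (((2 * a).factorial * (2 * b).factorial
        * (2 * c).factorial : ℝ) / (2 * (K) + 1).factorial)
      = ((2 * a).factorial * (2 * b).factorial * (2 * c).factorial : ℝ)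
        / (2 * (K) + 1).factorial := Real.mul_self_sqrt (by positivity)
  have hP : Real.sqrt ((2 * p.l + 1) / (4 * Real.pi)) * Real.sqrt ((2 * q.l + 1) / (4 * Real.pi))
      * Real.sqrt ((2 * r.l + 1) / (4 * Real.pi)) * (4 * Real.pi)
      = Real.sqrt ((2 * p.l + 1) * (2 * q.l + 1) * (2 * r.l + 1) / (4 * Real.pi)) := by
    rw [← Real.sqrt_mul (by positivity), ← Real.sqrt_mul (by positivity)]
    nth_rewrite 4 [← Real.sqrt_sq (show 0 ≤ 4 * Real.pi by positivity)]
    rw [← Real.sqrt_mul (by positivity)]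
    congr 1; field_simp
  have hsgn : (-1 : ℝ) ^ ((p.l : ℤ) - q.l - r.m) = (-1) ^ r.idx := by
    rw [← zpow_natCast, hr]
    have : (p.l : ℤ) - q.l - r.m = (r.l + r.m) + 2 * (-a - r.m) := by omega
    rw [this, zpow_add₀ (by norm_num), (even_two_mul _).neg_one_zpow, mul_one]
  rw [hsgn, ← hP, tripleConst, ← hK]
  set D := Real.sqrt (((2 * a).factorial * (2 * b).factorial * (2 * c).factorial : ℝ)
        / (2 * (K) + 1).factorial) with hDdef
  rw [← h1, ← h2, ← h3]
  have h44 : (-4 : ℝ) ^ (K) = (-1) ^ (K) * (2 ^ p.l * 2 ^ q.l * 2 ^ r.l) := by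
    rw [← pow_add, ← pow_add, show p.l + q.l + r.l = 2 * (K) by omega, pow_mul, ← mul_pow]
    norm_num
  rw [h44]
  have : (a.factorial : ℝ) ≠ 0 := by positivity
  have : (b.factorial : ℝ) ≠ 0 := by positivity
  have : (c.factorial : ℝ) ≠ 0 := by positivity
  have : (p.l.factorial : ℝ) ≠ 0 := by positivity
  have : (q.l.factorial : ℝ) ≠ 0 := by positivity
  have : (r.l.factorial : ℝ) ≠ 0 := by positivity
  have : ((2 * (K) + 1).factorial : ℝ) ≠ 0 := by positivity
  generalize racahSum p.l q.l r.l p.m q.m = R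
  generalize Real.sqrt ((2 * p.l + 1) / (4 * Real.pi)) = s1
  generalize Real.sqrt ((2 * q.l + 1) / (4 * Real.pi)) = s2
  generalize Real.sqrt ((2 * r.l + 1) / (4 * Real.pi)) = s3
  generalize Real.sqrt (p.idx.factorial * (2 * p.l - p.idx).factorial) = t1
  generalize Real.sqrt (q.idx.factorial * (2 * q.l - q.idx).factorial) = t2
  generalize Real.sqrt (r.idx.factorial * (2 * r.l - r.idx).factorial) = t3
  rw [eq_div_iff (by assumption)] at hD
  field_simp
  linear_combination (-s1 * t1 * s2 * t2 * s3 * t3 * R) * hD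

/-- The Gaunt coefficients in terms of `3j` symbols. -/
theorem gauntC_eq_wigner3j (p p' p'' : LM) : gauntC p p' p'' =
      (((-1) ^ p.m
        * Real.sqrt (4 * Real.pi * (2 * p.l + 1) * (2 * p'.l + 1) * (2 * p''.l + 1))
        * wigner3j p.l p'.l p''.l 0 0 0
        * wigner3j p.l p'.l p''.l p.m (-p'.m) (-p''.m) : ℝ) : ℂ) := by
  have h := sphInt_solid_triple p p'.neg p''.neg
  simp only [LM.neg_l, LM.neg_m] at h
  rw [gauntC_eq_sphInt, solidBar, solidBar, show solid p * (MvPolynomial.C ((-1) ^ p'.m.natAbs)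
    * solid p'.neg) * (MvPolynomial.C ((-1) ^ p''.m.natAbs) * solid p''.neg)
    = MvPolynomial.C ((-1) ^ p'.m.natAbs * (-1) ^ p''.m.natAbs)
      * (solid p * (solid p'.neg * solid p''.neg)) by simp only [map_mul]; ring, sphInt_C_mul, h]
  by_cases hm : p.m = p'.m + p''.m
  · have hs : Real.sqrt (4 * Real.pi * (2 * p.l + 1) * (2 * p'.l + 1) * (2 * p''.l + 1))
        = 4 * Real.pi * Real.sqrt ((2 * p.l + 1) * (2 * p'.l + 1) * (2 * p''.l + 1)
          / (4 * Real.pi)) := by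
      nth_rewrite 2 [← Real.sqrt_sq (show 0 ≤ 4 * Real.pi by positivity)]
      rw [← Real.sqrt_mul (by positivity)]
      congr 1; field_simp
    have hg : (-1 : ℝ) ^ p.m = (-1) ^ p'.m.natAbs * (-1) ^ p''.m.natAbs := by
      rw [hm, zpow_add₀ (by norm_num), neg_one_zpow_eq_natAbs, neg_one_zpow_eq_natAbs]
    rw [hs, hg]; push_cast; ring
  · rw [wigner3j_eq p.l p'.l p''.l p.m (-p'.m) (-p''.m), if_neg]
    · simp
    · rintro ⟨h, -⟩; omega

lemma gauntC_eq_zero_of_m_ne (p p' p'' : LM) (hm : p.m ≠ p'.m + p''.m) : gauntC p p' p'' = 0 := by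
  rw [gauntC_eq_wigner3j, wigner3j_eq p.l p'.l p''.l p.m (-p'.m) (-p''.m), if_neg]
  · simp
  · rintro ⟨h, -⟩; omega

lemma gauntC_eq_zero_of_l_lt (p p' p'' : LM) (hl : p.l + p'.l < p''.l) : gauntC p p' p'' = 0 := by
  rw [gauntC_eq_wigner3j, wigner3j_eq p.l p'.l p''.l p.m (-p'.m) (-p''.m), if_neg]
  · simp
  · rintro ⟨-, -, -, -, h, -⟩; omega

lemma finite_setOf_l_le (d : ℕ) : {p : LM | p.l ≤ d}.Finite := by
  apply Set.Finite.of_finite_image (f := fun p : LM => (p.1 : ℕ × ℤ))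
  · apply (Set.Finite.prod (Set.finite_Iic d) (Set.finite_Icc (-(d : ℤ)) d)).subset
    rintro _ ⟨p, hp, rfl⟩
    have h1 := p.abs_m_le
    rw [abs_le] at h1
    simp only [Set.mem_ofPred_eq] at hp
    refine ⟨hp, ?_⟩
    change -(d : ℤ) ≤ p.m ∧ p.m ≤ d
    omega
  · exact Subtype.val_injective.injOn

theorem finite_gauntC_ne_zero (p p' : LM) : {p'' : LM | gauntC p p' p'' ≠ 0}.Finite := by
  apply (finite_setOf_l_le (p.l + p'.l)).subset
  intro p'' h
  by_contra hlt
  exact h (gauntC_eq_zero_of_l_lt p p' p'' (by simpa using hlt))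

end SphericalWaves
end

/-! ### Completeness of the spherical harmonics and a pointwise bound. -/

noncomputable section
namespace SphericalWaves
open Complex

/-- The squared radius. -/
def polR2 : Pol := MvPolynomial.X 0 ^ 2 + MvPolynomial.X 1 ^ 2 + MvPolynomial.X 2 ^ 2

/-- Functionals on polynomials that only depend on the restriction to the sphere `x · x = 1`. -/
def IsSphereFunctional (Φ : Pol →ₗ[ℂ] ℂ) : Prop := ∀ q, Φ ((polR2 - 1) * q) = 0

lemma eval_polR2 (n : Fin 3 → ℂ) : MvPolynomial.eval n polR2 = dot n n := by
  simp [polR2, dot]; ring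

lemma dot_toC (x y : E3) : dot (toC x) (toC y) = (inner ℝ x y : ℝ) := by
  simp [dot, toC, PiLp.inner_apply, Fin.sum_univ_three]; ring

lemma dot_toC_self (x : E3) : dot (toC x) (toC x) = (‖x‖ : ℂ) ^ 2 := by
  rw [dot_toC, real_inner_self_eq_norm_sq]; push_cast; rfl

lemma isSphereFunctional_sphInt (q' : Pol) : IsSphereFunctional
    (sphInt.comp (LinearMap.mulRight ℂ q')) := by
  intro q
  simp only [LinearMap.comp_apply, LinearMap.mulRight_apply]
  rw [sphInt_apply, solidAngleIntegral_congr (g := fun _ => 0)]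
  · simp [solidAngleIntegral]
  · intro n hn
    simp [eval_polR2, dot_toC_self, hn]

lemma isSphereFunctional_eval (n : Fin 3 → ℂ) (hn : dot n n = 1) :
    IsSphereFunctional (MvPolynomial.aeval n).toLinearMap := by
  intro q
  simp only [AlgHom.toLinearMap_apply, map_mul, map_sub, map_one]
  rw [MvPolynomial.aeval_eq_eval, eval_polR2, hn]; simp

/-- Polynomials that agree on the sphere with combinations of spherical harmonics. -/
def harmSpan : Submodule ℂ Pol :=
  (Ideal.span {polR2 - 1}).restrictScalars ℂ ⊔ Submodule.span ℂ (Set.range fun q : ℕ × ℕ => harm q.1 q.2)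

lemma harm_mem (l j : ℕ) : harm l j ∈ harmSpan :=
  Submodule.mem_sup_right (Submodule.subset_span ⟨(l, j), rfl⟩)

lemma mul_mem_ideal (q : Pol) : (polR2 - 1) * q ∈ harmSpan :=
  Submodule.mem_sup_left (Ideal.mul_mem_right _ _ (Ideal.mem_span_singleton_self _))

/-- All coefficients lie in `harmSpan`. -/
def CoeffsIn (P : Polynomial Pol) : Prop := ∀ j, P.coeff j ∈ harmSpan

lemma CoeffsIn.add {P Q : Polynomial Pol} (hP : CoeffsIn P) (hQ : CoeffsIn Q) : CoeffsIn (P + Q) :=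
  fun j => by rw [Polynomial.coeff_add]; exact add_mem (hP j) (hQ j)

lemma CoeffsIn.sub {P Q : Polynomial Pol} (hP : CoeffsIn P) (hQ : CoeffsIn Q) : CoeffsIn (P - Q) :=
  fun j => by rw [Polynomial.coeff_sub]; exact sub_mem (hP j) (hQ j)

lemma CoeffsIn.const_mul {P : Polynomial Pol} (c : ℂ) (hP : CoeffsIn P) :
    CoeffsIn (Polynomial.C (MvPolynomial.C c) * P) := fun j => by
  rw [Polynomial.coeff_C_mul, ← MvPolynomial.smul_eq_C_mul]; exact Submodule.smul_mem _ _ (hP j)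

lemma CoeffsIn.X_mul {P : Polynomial Pol} (hP : CoeffsIn P) : CoeffsIn (Polynomial.X * P) := by
  rintro (_ | j)
  · simp
  · rw [Polynomial.coeff_X_mul]; exact hP j

lemma CoeffsIn.derivative {P : Polynomial Pol} (hP : CoeffsIn P) :
    CoeffsIn (Polynomial.derivative P) := fun j => by
  rw [Polynomial.coeff_derivative, show (P.coeff (j + 1) * ((j : Pol) + 1))
    = ((j + 1 : ℂ)) • P.coeff (j + 1) by
      rw [MvPolynomial.smul_eq_C_mul]; simp; ring]
  exact Submodule.smul_mem _ _ (hP _)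

lemma coeffsIn_pow (l : ℕ) : CoeffsIn (polQuad ^ l) := fun j => harm_mem l j

lemma coeffsIn_of_const_mul {P : Polynomial Pol} (c : ℂ) (hc : c ≠ 0)
    (h : CoeffsIn (Polynomial.C (MvPolynomial.C c) * P)) : CoeffsIn P := by
  have := h.const_mul c⁻¹
  rwa [← mul_assoc, ← Polynomial.C_mul, ← MvPolynomial.C_mul, inv_mul_cancel₀ hc,
    MvPolynomial.C_1, Polynomial.C_1, one_mul] at this

lemma derivative_polQuad : Polynomial.derivative polQuad
    = Polynomial.C (2 * MvPolynomial.X 2) - 2 * (Polynomial.X * Polynomial.C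
      (MvPolynomial.X 0 + MvPolynomial.C I * MvPolynomial.X 1)) := by
  simp [polQuad, quad]; rw [show (Polynomial.C 2 : Polynomial Pol) = 2 from map_ofNat _ 2]; ring

/-- For a quadratic Q with leading coefficient α one has Q'² = disc + 4αQ, and the discriminant of
the generating quadratic is 4r². -/
lemma derivative_polQuad_sq : Polynomial.derivative polQuad ^ 2
    = 4 * Polynomial.C polR2 - 4 * (Polynomial.C
      (MvPolynomial.X 0 + MvPolynomial.C I * MvPolynomial.X 1) * polQuad) := by
  have h : (MvPolynomial.C I : Pol) ^ 2 = -1 := by rw [← map_pow, I_sq]; simp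
  have h2 : (Polynomial.C (MvPolynomial.C I) : Polynomial Pol) ^ 2 = -1 := by
    rw [← Polynomial.C_pow, h]; simp
  rw [derivative_polQuad]
  simp only [polQuad, quad, polR2]
  simp only [map_add, map_mul, map_sub, map_pow, map_neg]
  rw [show (Polynomial.C 2 : Polynomial Pol) = 2 from map_ofNat _ 2]
  linear_combination (-4 * Polynomial.C (MvPolynomial.X 1) ^ 2) * h2

/-- Put w = x₀ + i x₁. Since Q'' = -2w and Q'² = 4r² - 4wQ, the second derivative of Q^(l+2) is
(l+2)(4(l+1) r² Q^l - (4l+6) w Q^(l+1)). On the sphere r² = 1, so w Q^(l+1) is a combination of Q^l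
and a derivative of Q^(l+2). -/
lemma coeffsIn_w_mul (l : ℕ) : CoeffsIn (Polynomial.C
    (MvPolynomial.X 0 + MvPolynomial.C I * MvPolynomial.X 1) * polQuad ^ l) := by
  have hd2 : Polynomial.derivative (Polynomial.derivative polQuad) = -2 * Polynomial.C
      (MvPolynomial.X 0 + MvPolynomial.C I * MvPolynomial.X 1) := by
    rw [derivative_polQuad]; simp; ring
  have hd := derivative_polQuad_sq
  rcases l with _ | l
  · apply coeffsIn_of_const_mul (-2) (by norm_num)
    have := ((coeffsIn_pow 1).derivative).derivative
    rw [pow_one, hd2] at this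
    convert this using 1
    rw [show (MvPolynomial.C (-2) : Pol) = -2 by rw [map_neg]; congr 1]
    rw [show (Polynomial.C (-2 : Pol)) = -2 by rw [map_neg]; congr 1]
    simp
  · have hc : ((l + 2) * (4 * l + 6) : ℂ) ≠ 0 := by
      exact_mod_cast (show (l + 2) * (4 * l + 6) ≠ 0 by positivity)
    apply coeffsIn_of_const_mul _ hc
    have hR : CoeffsIn (Polynomial.C polR2 * polQuad ^ l) := by
      intro j
      rw [Polynomial.coeff_C_mul, show polR2 * (polQuad ^ l).coeff j
        = (polR2 - 1) * (polQuad ^ l).coeff j + harm l j by rw [harm]; ring]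
      exact add_mem (mul_mem_ideal _) (harm_mem _ _)
    have h := (hR.const_mul ((l + 2) * (4 * (l + 1)))).sub
      ((coeffsIn_pow (l + 2)).derivative.derivative)
    convert h using 1
    rw [Polynomial.derivative_pow, Polynomial.derivative_mul, Polynomial.derivative_mul,
      Polynomial.derivative_pow, hd2]
    simp only [Nat.add_sub_cancel, show l + 2 - 1 = l + 1 by omega, map_mul, map_add, map_natCast,
      Polynomial.derivative_natCast, show (MvPolynomial.C (4 : ℂ) : Pol) = 4 from map_ofNat _ 4,
      show (MvPolynomial.C (2 : ℂ) : Pol) = 2 from map_ofNat _ 2,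
      show (MvPolynomial.C (6 : ℂ) : Pol) = 6 from map_ofNat _ 6,
      show (Polynomial.C (4 : Pol)) = 4 from map_ofNat _ 4, map_one,
      show (Polynomial.C (2 : Pol)) = 2 from map_ofNat _ 2,
      show (Polynomial.C (6 : Pol)) = 6 from map_ofNat _ 6]
    push_cast
    simp only [map_add, map_mul] at hd
    linear_combination ((l + 2) * (l + 1) * polQuad ^ l) * hd

/-- Solve (Q^(l+1))' = (l+1) Q^l (2z - 2Xw) for z Q^l. -/
lemma coeffsIn_z_mul (l : ℕ) : CoeffsIn (Polynomial.C (MvPolynomial.X 2) * polQuad ^ l) := by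
  have hc : (2 * (l + 1) : ℂ) ≠ 0 := by exact_mod_cast (show 2 * (l + 1) ≠ 0 by positivity)
  apply coeffsIn_of_const_mul _ hc
  have h := ((coeffsIn_pow (l + 1)).derivative).add ((coeffsIn_w_mul l).X_mul.const_mul (2 * (l + 1)))
  convert h using 1
  rw [Polynomial.derivative_pow, derivative_polQuad]
  simp only [Nat.add_sub_cancel, map_mul, map_add, map_natCast,
    show (MvPolynomial.C (2 : ℂ) : Pol) = 2 from map_ofNat _ 2, map_one,
    show (Polynomial.C (2 : Pol)) = 2 from map_ofNat _ 2]
  push_cast; ring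

lemma coeffsIn_wbar_mul (l : ℕ) : CoeffsIn (Polynomial.C
    (MvPolynomial.X 0 - MvPolynomial.C I * MvPolynomial.X 1) * polQuad ^ l) := by
  have h := ((coeffsIn_pow (l + 1)).sub ((coeffsIn_z_mul l).X_mul.const_mul 2)).add
    (coeffsIn_w_mul l).X_mul.X_mul
  convert h using 1
  rw [pow_succ]
  nth_rewrite 3 [polQuad]
  simp only [quad, map_mul, map_add, map_sub, map_neg,
    show (MvPolynomial.C (2 : ℂ) : Pol) = 2 from map_ofNat _ 2,
    show (Polynomial.C (2 : Pol)) = 2 from map_ofNat _ 2]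
  ring

lemma X_mul_harm_mem (i : Fin 3) (l j : ℕ) : MvPolynomial.X i * harm l j ∈ harmSpan := by
  have h1 := coeffsIn_w_mul l j
  have h2 := coeffsIn_wbar_mul l j
  have h3 := coeffsIn_z_mul l j
  rw [Polynomial.coeff_C_mul] at h1 h2 h3
  fin_cases i
  · have := Submodule.smul_mem _ (1 / 2 : ℂ) (add_mem h1 h2)
    convert this using 1
    rw [← add_mul, show (MvPolynomial.X 0 + MvPolynomial.C I * MvPolynomial.X 1
      + (MvPolynomial.X 0 - MvPolynomial.C I * MvPolynomial.X 1) : Pol)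
      = (2 : ℂ) • MvPolynomial.X 0 by rw [two_smul]; ring, smul_mul_assoc, smul_smul]
    norm_num; rfl
  · have := Submodule.smul_mem _ (-I / 2 : ℂ) (sub_mem h1 h2)
    convert this using 1
    rw [← sub_mul, show (MvPolynomial.X 0 + MvPolynomial.C I * MvPolynomial.X 1
      - (MvPolynomial.X 0 - MvPolynomial.C I * MvPolynomial.X 1) : Pol)
      = (2 * I : ℂ) • MvPolynomial.X 1 by rw [MvPolynomial.smul_eq_C_mul, map_mul,
        show (MvPolynomial.C (2 : ℂ) : Pol) = 2 from map_ofNat _ 2]; ring, smul_mul_assoc, smul_smul,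
        show -I / 2 * (2 * I) = 1 by linear_combination -I_sq, one_smul]
    rfl
  · exact h3

/-- The space contains the constants and is stable under multiplication by each coordinate. -/
lemma harmSpan_eq_top : harmSpan = ⊤ := by
  have hX : ∀ (i : Fin 3) (p : Pol), p ∈ harmSpan → MvPolynomial.X i * p ∈ harmSpan := by
    intro i p hp
    obtain ⟨u, hu, v, hv, rfl⟩ := Submodule.mem_sup.1 hp
    rw [mul_add]
    refine add_mem (Submodule.mem_sup_left (Ideal.mul_mem_left _ _ hu)) ?_
    clear hp
    induction hv using Submodule.span_induction with
    | mem x hx => obtain ⟨⟨l, j⟩, rfl⟩ := hx; exact X_mul_harm_mem i l j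
    | zero => simp
    | add x y _ _ h1 h2 =>
      rw [mul_add]
      exact add_mem h1 h2
    | smul c x _ h => rw [mul_smul_comm]; exact Submodule.smul_mem _ _ h
  rw [eq_top_iff]
  intro p _
  induction p using MvPolynomial.induction_on with
  | C a =>
    have : (MvPolynomial.C a : Pol) = a • harm 0 0 := by
      simp [harm, MvPolynomial.smul_eq_C_mul]
    rw [this]; exact Submodule.smul_mem _ _ (harm_mem 0 0)
  | add p q hp hq => exact add_mem (hp trivial) (hq trivial)
  | mul_X p i hp => rw [mul_comm]; exact hX i p (hp trivial)

lemma harm_eq_zero {l j : ℕ} (h : 2 * l < j) : harm l j = 0 :=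
  Polynomial.coeff_eq_zero_of_natDegree_lt ((natDegree_quad_pow_le _ _ _ l).trans_lt h)

lemma exists_LM (l j : ℕ) (h : j ≤ 2 * l) : ∃ p : LM, p.l = l ∧ p.idx = j :=
  ⟨⟨(l, (j : ℤ) - l), by rw [abs_le]; constructor <;> (simp only; omega)⟩, rfl, by
    simp only [LM.idx, LM.l, LM.m]; omega⟩

/-- Expansion of a polynomial on the sphere in spherical harmonics. -/
theorem hasSum_sphere_expansion (Φ : Pol →ₗ[ℂ] ℂ) (hΦ : IsSphereFunctional Φ) (p : Pol) :
    HasSum (fun q : LM => sphInt (p * solidBar q) * Φ (solid q)) (Φ p) := by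
  have hp : p ∈ harmSpan := by rw [harmSpan_eq_top]; trivial
  obtain ⟨u, hu, v, hv, rfl⟩ := Submodule.mem_sup.1 hp
  simp only [add_mul, map_add]
  refine HasSum.add ?_ ?_
  · obtain ⟨t, rfl⟩ := Ideal.mem_span_singleton.1 hu
    rw [hΦ]
    have : ∀ q, sphInt ((polR2 - 1) * t * solidBar q) = 0 := fun q =>
      isSphereFunctional_sphInt (solidBar q) t
    simp [this, hasSum_zero]
  · clear hp
    induction hv using Submodule.span_induction with
    | mem x hx =>
      obtain ⟨⟨l, j⟩, rfl⟩ := hx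
      by_cases hj : j ≤ 2 * l
      · obtain ⟨q₀, rfl, rfl⟩ := exists_LM l j hj
        have hN : (normCoeff q₀ : ℂ) ≠ 0 := by exact_mod_cast (normCoeff_pos q₀).ne'
        have h1 : harm q₀.l q₀.idx = (normCoeff q₀ : ℂ)⁻¹ • solid q₀ := by
          rw [solid, MvPolynomial.smul_eq_C_mul, ← mul_assoc, ← map_mul, inv_mul_cancel₀ hN]
          simp [harm]
        simp only [h1, smul_mul_assoc, map_smul, smul_eq_mul, sphInt_solid_mul_solidBar]
        convert hasSum_ite_eq q₀ ((normCoeff q₀ : ℂ)⁻¹ * Φ (solid q₀)) using 2 with q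
        by_cases h : q₀ = q
        · subst h; simp
        · rw [if_neg h, if_neg (Ne.symm h)]; simp
      · simp [harm_eq_zero (not_le.1 hj), hasSum_zero]
    | zero => simp [hasSum_zero]
    | add x y _ _ h1 h2 =>
      simp only [add_mul, map_add]
      exact h1.add h2
    | smul c x _ h =>
      simp only [smul_mul_assoc, map_smul, smul_eq_mul, mul_assoc]
      exact h.mul_left c

lemma funkHecke_self_pos (l : ℕ) : 0 < funkHecke l l := by
  rw [funkHecke, if_pos (by simp)]
  have := Nat.doubleFactorial_pos (l + l + 1)
  positivity

lemma funkHecke_of_lt {N l : ℕ} (h : N < l) : funkHecke N l = 0 := if_neg (by omega)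

/-- The labels with given `l`. -/
def shell (l : ℕ) : Finset LM :=
  ((finite_setOf_l_le l).subset (fun p (h : p.l = l) => h.le) : {p : LM | p.l = l}.Finite).toFinset

lemma mem_shell {l : ℕ} {p : LM} : p ∈ shell l ↔ p.l = l := by simp [shell]

lemma card_shell_le (l : ℕ) : (shell l).card ≤ 2 * l + 1 := by
  have h := Finset.card_le_card_of_injOn (s := shell l) (t := Finset.Icc (-(l : ℤ)) l)
    (fun p => p.m) (fun p hp => by
      have h1 := p.abs_m_le
      have h2 := mem_shell.1 hp
      rw [abs_le, h2] at h1
      simpa using h1) (fun p hp q hq h => LM.ext (by rw [mem_shell.1 hp, mem_shell.1 hq]) h)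
  simp at h; omega

/-- Expand the polynomial x ↦ (n·x)^N in spherical harmonics by Funk–Hecke and evaluate at x = n,
where it equals 1. -/
lemma sum_funkHecke_shell (n : E3) (hn : ‖n‖ = 1) (N : ℕ) :
    ∑ l ∈ Finset.range (N + 1), funkHecke N l * ∑ q ∈ shell l, ‖sphericalHarmonic q n‖ ^ 2 = 1 := by
  have hd : dot (toC n) (toC n) = 1 := by rw [dot_toC_self, hn]; simp
  have h := hasSum_sphere_expansion _ (isSphereFunctional_eval _ hd) (lin (toC n) ^ N)
  simp only [sphInt_lin_pow_mul_solidBar _ hd, AlgHom.toLinearMap_apply, MvPolynomial.aeval_eq_eval,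
    map_pow] at h
  have e : ∀ q : Pol, (MvPolynomial.eval (toC n) : Pol → ℂ) q = MvPolynomial.eval (toC n) q :=
    fun _ => rfl
  simp only [eval_lin, hd, one_pow, eval_solidBar_unit _ _ hn,
    eval_solid_unit _ _ hn] at h
  have h2 : HasSum (fun q : LM => funkHecke N q.l * ‖sphericalHarmonic q n‖ ^ 2) 1 := by
    have : (fun q : LM => (funkHecke N q.l : ℂ) * (starRingEnd ℂ) (sphericalHarmonic q n)
        * sphericalHarmonic q n) = fun q : LM =>
          ((funkHecke N q.l * ‖sphericalHarmonic q n‖ ^ 2 : ℝ) : ℂ) := by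
      ext q; rw [mul_assoc, Complex.conj_mul']; push_cast; ring
    rw [this] at h
    exact Complex.hasSum_ofReal.1 (by simpa using h)
  have h3 := h2.unique (hasSum_sum_of_ne_finset_zero
    (s := (Finset.range (N + 1)).biUnion shell) (fun q hq => by
      have : N < q.l := by
        by_contra hlt
        exact hq (Finset.mem_biUnion.2 ⟨q.l, by simp; omega, mem_shell.2 rfl⟩)
      rw [funkHecke_of_lt this, zero_mul]))
  rw [h3, Finset.sum_biUnion]
  · refine Finset.sum_congr rfl fun l _ => ?_
    rw [Finset.mul_sum]
    refine Finset.sum_congr rfl fun q hq => ?_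
    rw [mem_shell.1 hq]
  · intro l _ l' _ hl
    refine Finset.disjoint_left.2 fun q h1 h2 => hl ?_
    rw [← mem_shell.1 h1, mem_shell.1 h2]

/-- The identities of `sum_funkHecke_shell` form a triangular system with nonzero diagonal whose
coefficients do not involve the point, so neither does its solution. -/
lemma sum_shell_const (n n' : E3) (hn : ‖n‖ = 1) (hn' : ‖n'‖ = 1) (l : ℕ) :
    ∑ q ∈ shell l, ‖sphericalHarmonic q n‖ ^ 2 = ∑ q ∈ shell l, ‖sphericalHarmonic q n'‖ ^ 2 := by
  induction l using Nat.strong_induction_on with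
  | _ l ih =>
    have h1 := sum_funkHecke_shell n hn l
    rw [← sum_funkHecke_shell n' hn' l, Finset.sum_range_succ, Finset.sum_range_succ,
      Finset.sum_congr rfl (fun i hi => by rw [ih i (Finset.mem_range.1 hi)])] at h1
    exact mul_left_cancel₀ (funkHecke_self_pos l).ne' (add_left_cancel h1)

/-- A crude form of Unsöld's theorem. -/
lemma norm_sphericalHarmonic_le (p : LM) (n : E3) (hn : ‖n‖ = 1) :
    ‖sphericalHarmonic p n‖ ≤ 2 * p.l + 1 := by
  set A := ∑ q ∈ shell p.l, ‖sphericalHarmonic q n‖ ^ 2 with hA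
  -- The sum of squares is constant on the sphere; integrating it counts the normalised harmonics of
  -- degree l.
  have h1 : (A : ℂ) * sphInt 1 = ((shell p.l).card : ℂ) := by
    have h2 : sphInt (∑ q ∈ shell p.l, solid q * solidBar q) = (shell p.l).card := by
      simp [map_sum, sphInt_solid_mul_solidBar]
    rw [← h2, ← sphInt_C_mul, sphInt_apply, sphInt_apply]
    apply solidAngleIntegral_congr
    intro n' hn'
    rw [mul_one, MvPolynomial.eval_C, hA, sum_shell_const n n' hn hn', map_sum]
    push_cast
    refine Finset.sum_congr rfl fun q _ => ?_
    rw [map_mul, eval_solid_unit _ _ hn', eval_solidBar_unit _ _ hn', Complex.mul_conj']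
  have h3 : sphInt 1 = 4 * Real.pi := by
    have := sphInt_lin_pow 0 0
    simpa using this
  have h4 : A * (4 * Real.pi) = (shell p.l).card := by
    rw [h3] at h1; exact_mod_cast h1
  have h5 : A ≤ 2 * p.l + 1 := by
    have hc : ((shell p.l).card : ℝ) ≤ 2 * p.l + 1 := by exact_mod_cast card_shell_le p.l
    have : 0 ≤ A := Finset.sum_nonneg fun _ _ => by positivity
    nlinarith [Real.pi_gt_three]
  have h6 : ‖sphericalHarmonic p n‖ ^ 2 ≤ A :=
    Finset.single_le_sum (f := fun q => ‖sphericalHarmonic q n‖ ^ 2) (fun _ _ => by positivity)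
      (mem_shell.2 rfl)
  have h7 : (0 : ℝ) ≤ p.l := by positivity
  nlinarith [norm_nonneg (sphericalHarmonic p n)]

lemma exists_unit_smul (x : E3) : ∃ n : E3, ‖n‖ = 1 ∧ x = ‖x‖ • n := by
  by_cases h : x = 0
  · exact ⟨direction 0 0, norm_direction 0 0, by simp [h]⟩
  · have hpos := norm_pos_iff.2 h
    exact ⟨‖x‖⁻¹ • x, by rw [norm_smul]; simp [hpos.ne'], by rw [smul_smul]; simp [hpos.ne']⟩

lemma norm_eval_solid_le (p : LM) (x : E3) :
    ‖MvPolynomial.eval (toC x) (solid p)‖ ≤ (2 * p.l + 1) * ‖x‖ ^ p.l := by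
  obtain ⟨n, hn, hx⟩ := exists_unit_smul x
  have h1 : toC x = (‖x‖ : ℂ) • toC n := by
    ext i
    have := congrArg (fun y : E3 => y i) hx
    simp only [PiLp.smul_apply, smul_eq_mul] at this
    simp only [toC, Pi.smul_apply, smul_eq_mul]; exact_mod_cast this
  rw [h1, eval_solid_smul, eval_solid_unit _ _ hn, norm_mul, norm_pow, Complex.norm_real, norm_norm,
    mul_comm]
  gcongr
  exact norm_sphericalHarmonic_le p n hn

end SphericalWaves
end

/-! ### Spherical Hankel functions and their radial derivatives. -/

noncomputable section
namespace SphericalWaves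
open Complex

section Hankel

/-- Coefficients of the reverse Bessel polynomials. -/
def besselCoeff (l k : ℕ) : ℂ :=
  if k ≤ l then ((l + k).factorial : ℂ) / (2 ^ k * k.factorial * (l - k).factorial) else 0

lemma besselCoeff_of_lt {l k : ℕ} (h : l < k) : besselCoeff l k = 0 := if_neg (by omega)

lemma besselCoeff_zero (l : ℕ) : besselCoeff l 0 = 1 := by
  have : (l.factorial : ℂ) ≠ 0 := by exact_mod_cast l.factorial_ne_zero
  simp [besselCoeff, this]

lemma besselCoeff_succ_succ (l k : ℕ) :
    besselCoeff (l + 1) (k + 1) = besselCoeff l (k + 1) + (k + 1 + l) * besselCoeff l k := by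
  have n1 : ∀ n : ℕ, (n.factorial : ℂ) ≠ 0 := fun n => by exact_mod_cast n.factorial_ne_zero
  rcases lt_trichotomy k l with h | h | h
  · obtain ⟨d, rfl⟩ : ∃ d, l = k + 1 + d := ⟨l - k - 1, by omega⟩
    rw [besselCoeff, besselCoeff, besselCoeff, if_pos (by omega), if_pos (by omega), if_pos (by omega),
      show k + 1 + d + 1 - (k + 1) = d + 1 by omega, show k + 1 + d - (k + 1) = d by omega,
      show k + 1 + d - k = d + 1 by omega,
      show k + 1 + d + 1 + (k + 1) = (2 * k + 1 + d) + 1 + 1 by ring,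
      show k + 1 + d + (k + 1) = (2 * k + 1 + d) + 1 by ring,
      show k + 1 + d + k = 2 * k + 1 + d by ring,
      Nat.factorial_succ (2 * k + 1 + d + 1), Nat.factorial_succ (2 * k + 1 + d),
      Nat.factorial_succ k, Nat.factorial_succ d]
    have := n1 k; have := n1 d
    have h1 : (k + 1 : ℂ) ≠ 0 := by exact_mod_cast k.succ_ne_zero
    have h2 : (d + 1 : ℂ) ≠ 0 := by exact_mod_cast d.succ_ne_zero
    push_cast; field_simp; ring
  · subst h
    rw [besselCoeff_of_lt (Nat.lt_succ_self k), besselCoeff, besselCoeff, if_pos le_rfl, if_pos le_rfl,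
      show k + 1 + (k + 1) = (k + k) + 1 + 1 by ring, Nat.factorial_succ (k + k + 1),
      Nat.factorial_succ (k + k), Nat.factorial_succ k]
    have := n1 k
    have h1 : (k + 1 : ℂ) ≠ 0 := by exact_mod_cast k.succ_ne_zero
    simp only [Nat.sub_self, Nat.factorial_zero]
    push_cast; field_simp; ring
  · rw [besselCoeff_of_lt (by omega), besselCoeff_of_lt (by omega), besselCoeff_of_lt h]; simp

lemma sphericalHankel_eq (l : ℕ) (z : ℂ) : sphericalHankel l z = ∑ k ∈ Finset.range (l + 1),
    I ^ ((k : ℤ) - l - 1) * besselCoeff l k * (exp (I * z) * (z ^ (k + 1))⁻¹) := by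
  rw [sphericalHankel, Finset.mul_sum]
  refine Finset.sum_congr rfl fun k hk => ?_
  rw [besselCoeff, if_pos (by simp at hk; omega)]
  simp only [div_eq_mul_inv, mul_inv]; ring

/-- `z^{-l} h_l(z)`. -/
def hankelRed (l : ℕ) (z : ℂ) : ℂ := sphericalHankel l z / z ^ l

lemma hankelRed_eq (l : ℕ) (z : ℂ) : hankelRed l z = ∑ k ∈ Finset.range (l + 1),
    I ^ ((k : ℤ) - l - 1) * besselCoeff l k * (exp (I * z) * (z ^ (k + 1 + l))⁻¹) := by
  rw [hankelRed, sphericalHankel_eq, Finset.sum_div]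
  refine Finset.sum_congr rfl fun k _ => ?_
  rw [pow_add z (k + 1) l, mul_inv]; ring

/-- The classical rule (z^(-l) h_l)' = -z^(-l) h_{l+1}, checked on the closed form. It amounts to
the coefficient recursion `besselCoeff_succ_succ` together with a shift of the summation index. -/
lemma hasDerivAt_hankelRed (l : ℕ) {z : ℂ} (hz : z ≠ 0) :
    HasDerivAt (hankelRed l) (-z * hankelRed (l + 1) z) z := by
  have hterm : ∀ k : ℕ, HasDerivAt (fun z => I ^ ((k : ℤ) - l - 1) * besselCoeff l k
      * (exp (I * z) * (z ^ (k + 1 + l))⁻¹)) (I ^ ((k : ℤ) - l - 1) * besselCoeff l k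
      * (exp (I * z) * (I * (z ^ (k + 1 + l))⁻¹ - (k + 1 + l) * (z ^ (k + 2 + l))⁻¹))) z := by
    intro k
    have h1 : HasDerivAt (fun z => exp (I * z)) (exp (I * z) * (I * 1)) z :=
      ((hasDerivAt_id z).const_mul I).cexp
    have h2 := (hasDerivAt_pow (k + 1 + l) z).inv (pow_ne_zero _ hz)
    refine ((h1.mul h2).const_mul _).congr_deriv ?_
    congr 1
    rw [show k + 1 + l - 1 = k + l by omega]
    have : z ^ (k + 2 + l) = z ^ (k + l) * z ^ 2 := by rw [← pow_add]; congr 1; ring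
    rw [this]
    have : z ^ (k + 1 + l) = z ^ (k + l) * z := by rw [← pow_succ]; congr 1; ring
    rw [this]
    have := pow_ne_zero (k + l) hz
    simp only [Pi.inv_apply]
    push_cast; field_simp; ring
  have hsum := HasDerivAt.fun_sum (u := Finset.range (l + 1)) (fun k _ => hterm k)
  have hfun : hankelRed l = fun z => ∑ k ∈ Finset.range (l + 1),
    I ^ ((k : ℤ) - l - 1) * besselCoeff l k * (exp (I * z) * (z ^ (k + 1 + l))⁻¹) :=
    funext (hankelRed_eq l)
  rw [hfun]
  refine hsum.congr_deriv ?_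
  rw [hankelRed_eq, Finset.mul_sum, Finset.sum_range_succ' _ (l + 1)]
  have e1 : ∀ k : ℕ, -z * (I ^ (((k + 1 : ℕ) : ℤ) - (l + 1 : ℕ) - 1) * besselCoeff (l + 1) (k + 1)
      * (exp (I * z) * (z ^ (k + 1 + 1 + (l + 1)))⁻¹))
      = (-(I ^ ((k : ℤ) - l - 1)) * besselCoeff l (k + 1) * (exp (I * z) * (z ^ (k + 2 + l))⁻¹))
      + (-(I ^ ((k : ℤ) - l - 1)) * besselCoeff l k * ((k + 1 + l)
        * (exp (I * z) * (z ^ (k + 2 + l))⁻¹))) := by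
    intro k
    rw [besselCoeff_succ_succ, show (((k + 1 : ℕ) : ℤ) - (l + 1 : ℕ) - 1) = (k : ℤ) - l - 1 by
      push_cast; ring, show k + 1 + 1 + (l + 1) = (k + 2 + l) + 1 by ring, pow_succ]
    have := pow_ne_zero (k + 2 + l) hz
    field_simp; ring
  rw [Finset.sum_congr rfl fun k _ => e1 k, Finset.sum_add_distrib]
  have e2 : ∑ k ∈ Finset.range (l + 1), (-(I ^ ((k : ℤ) - l - 1)) * besselCoeff l (k + 1)
      * (exp (I * z) * (z ^ (k + 2 + l))⁻¹)) + -z * (I ^ (((0 : ℕ) : ℤ) - (l + 1 : ℕ) - 1)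
        * besselCoeff (l + 1) 0 * (exp (I * z) * (z ^ (0 + 1 + (l + 1)))⁻¹))
      = ∑ k ∈ Finset.range (l + 1), I ^ ((k : ℤ) - l - 1) * besselCoeff l k
        * (exp (I * z) * (I * (z ^ (k + 1 + l))⁻¹)) := by
    have hI : ∀ n : ℤ, I ^ (n - 1) * I = I ^ n := fun n => by
      rw [zpow_sub_one₀ I_ne_zero, inv_mul_cancel_right₀ I_ne_zero]
    have hI2 : ∀ n : ℤ, -I ^ (n - 2) = I ^ n := fun n => by
      rw [zpow_sub₀ I_ne_zero, show (2 : ℤ) = ((2 : ℕ) : ℤ) from rfl, zpow_natCast, I_sq, div_neg,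
        div_one, neg_neg]
    rw [Finset.sum_range_succ, besselCoeff_of_lt (Nat.lt_succ_self l), Finset.sum_range_succ' _ l]
    simp only [mul_zero, zero_mul, add_zero]
    congr 1
    · refine Finset.sum_congr rfl fun k _ => ?_
      have h1 := hI ((k : ℤ) + 1 - l)
      have h2 := hI2 ((k : ℤ) + 1 - l)
      rw [show (((k + 1 : ℕ) : ℤ) - l - 1) = (k : ℤ) + 1 - l - 1 by push_cast; ring,
        show (k : ℤ) - l - 1 = (k : ℤ) + 1 - l - 2 by ring, h2, ← h1,
        show k + 1 + 1 + l = k + 2 + l by ring]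
      ring
    · rw [besselCoeff_zero, besselCoeff_zero, show (0 + 1 + (l + 1)) = (0 + 1 + l) + 1 by ring, pow_succ]
      have h1 := hI (-(l : ℤ))
      have h2 := hI2 (-(l : ℤ))
      rw [show (((0 : ℕ) : ℤ) - (l + 1 : ℕ) - 1) = -(l : ℤ) - 2 by push_cast; ring,
        show (((0 : ℕ) : ℤ) - l - 1) = -(l : ℤ) - 1 by push_cast; ring]
      have := pow_ne_zero (0 + 1 + l) hz
      field_simp
      linear_combination h2 - h1
  rw [add_right_comm, e2, ← Finset.sum_add_distrib]
  refine Finset.sum_congr rfl fun k _ => ?_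
  ring

lemma hankelRed_zero (z : ℂ) : hankelRed 0 z = -I * exp (I * z) / z := by
  rw [hankelRed_eq]
  simp [besselCoeff]; ring

/-- The three-term relation behind the Helmholtz equation. -/
lemma hankelRed_helmholtz {z : ℂ} (hz : z ≠ 0) :
    3 * hankelRed 1 z - z ^ 2 * hankelRed 2 z = hankelRed 0 z := by
  have h3 : I ^ (-3 : ℤ) = I := by
    rw [zpow_neg, show (3 : ℤ) = ((3 : ℕ) : ℤ) by norm_num, zpow_natCast, I_pow_three]
    rw [inv_neg, Complex.inv_I, neg_neg]
  have h2 : I ^ (-2 : ℤ) = -1 := by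
    rw [zpow_neg, show (2 : ℤ) = ((2 : ℕ) : ℤ) by norm_num, zpow_natCast, I_sq]; norm_num
  have h1 : I ^ (-1 : ℤ) = -I := by rw [zpow_neg_one, Complex.inv_I]
  rw [hankelRed_eq, hankelRed_eq, hankelRed_zero]
  simp only [Finset.sum_range_succ, Finset.sum_range_zero]
  norm_num [besselCoeff, Nat.factorial, h3, h2, h1]
  field_simp
  ring

end Hankel

/-- The radial functions of the derivatives of the outgoing wave, as functions of `q = y · y`. -/
def radial (k : ℂ) (j : ℕ) (q : ℂ) : ℂ := (-k ^ 2 / 2) ^ j * hankelRed j (k * q ^ (1 / 2 : ℂ))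

lemma sqrt_ne_zero {q : ℂ} (hq : q ∈ slitPlane) : q ^ (1 / 2 : ℂ) ≠ 0 := by
  intro h
  rw [cpow_eq_zero_iff] at h
  exact slitPlane_ne_zero hq h.1

lemma sqrt_sq (q : ℂ) : (q ^ (1 / 2 : ℂ)) ^ 2 = q := by
  rw [← cpow_nat_mul]; norm_num

/-- The prefactor (-k²/2)^j in `radial` is chosen so that differentiation in q just raises the
index. -/
lemma hasDerivAt_radial {k : ℂ} (hk : k ≠ 0) (j : ℕ) {q : ℂ} (hq : q ∈ slitPlane) :
    HasDerivAt (radial k j) (radial k (j + 1) q) q := by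
  have hs := sqrt_ne_zero hq
  have h1 : HasDerivAt (fun q : ℂ => k * q ^ (1 / 2 : ℂ)) (k * (1 / 2 * q ^ (1 / 2 - 1 : ℂ) * 1)) q :=
    ((hasDerivAt_id q).cpow_const hq).const_mul k
  have h2 := ((hasDerivAt_hankelRed j (mul_ne_zero hk hs)).comp q h1).const_mul ((-k ^ 2 / 2) ^ j)
  refine h2.congr_deriv ?_
  have h3 : q ^ (1 / 2 - 1 : ℂ) = (q ^ (1 / 2 : ℂ))⁻¹ := by
    rw [← cpow_neg]; norm_num
  rw [h3, radial, pow_succ]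
  field_simp
  ring


end SphericalWaves
end

/-! ### Polynomial differential operators applied to the outgoing wave. -/

noncomputable section
namespace SphericalWaves
open Complex

/-- Combinations `∑ⱼ pⱼ fⱼ` of the radial functions `fⱼ = radial k j` with polynomial coefficients. -/
abbrev RadialComb := ℕ →₀ Pol

/-- The partial derivative `∂ᵢ` of `∑ⱼ pⱼ fⱼ(y · y)`, using `fⱼ' = fⱼ₊₁`. -/
def gradComb (i : Fin 3) : Module.End ℂ RadialComb :=
  Finsupp.lsum ℂ fun j => Finsupp.lsingle j ∘ₗ (MvPolynomial.pderiv i).toLinearMap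
    + Finsupp.lsingle (j + 1) ∘ₗ LinearMap.mulLeft ℂ (2 * MvPolynomial.X i)

lemma gradComb_single (i : Fin 3) (j : ℕ) (p : Pol) :
    gradComb i (Finsupp.single j p) = Finsupp.single j (MvPolynomial.pderiv i p)
      + Finsupp.single (j + 1) (2 * MvPolynomial.X i * p) := by
  rw [gradComb, Finsupp.lsum_single]; rfl

lemma pderiv_comm (i j : Fin 3) (p : Pol) : MvPolynomial.pderiv i (MvPolynomial.pderiv j p)
    = MvPolynomial.pderiv j (MvPolynomial.pderiv i p) := by
  have h : ⁅MvPolynomial.pderiv (R := ℂ) i, MvPolynomial.pderiv (R := ℂ) j⁆ = 0 := by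
    apply MvPolynomial.derivation_ext
    intro l
    rw [Derivation.commutator_apply]
    simp [MvPolynomial.pderiv_X, Pi.single_apply, apply_ite]
  have := congrArg (fun D => D p) h
  simpa [Derivation.commutator_apply, sub_eq_zero] using this

/-- Needed so that `diffOp`, defined on monomials in a fixed order of the variables, turns
multiplication by any coordinate into a derivative (`diffOp_X_mul`). -/
lemma gradComb_commute (i j : Fin 3) : Commute (gradComb i) (gradComb j) := by
  refine Finsupp.lhom_ext fun n p => ?_
  simp only [Module.End.mul_apply, gradComb_single, map_add, Derivation.leibniz,
    pderiv_comm i j p, smul_eq_mul]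
  have h2 : ∀ a : Fin 3, MvPolynomial.pderiv a (2 : Pol) = 0 := fun a => by
    rw [show (2 : Pol) = MvPolynomial.C 2 from (map_ofNat _ 2).symm, MvPolynomial.pderiv_C]
  simp only [h2, Finsupp.single_add, MvPolynomial.pderiv_X, Pi.single_apply, mul_zero, add_zero]
  by_cases hij : i = j
  · subst hij; rfl
  · rw [if_neg (Ne.symm hij), if_neg hij]
    simp only [mul_zero, add_zero, Finsupp.single_zero]
    rw [show 2 * MvPolynomial.X i * (2 * MvPolynomial.X j * p)
      = 2 * MvPolynomial.X j * (2 * MvPolynomial.X i * p) by ring]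
    abel

/-- The value of `∑ⱼ pⱼ fⱼ` at `y`. -/
def evalComb (k : ℂ) (y : Fin 3 → ℂ) : RadialComb →ₗ[ℂ] ℂ :=
  Finsupp.lsum ℂ fun j => radial k j (dot y y) • (MvPolynomial.aeval y).toLinearMap

lemma evalComb_single (k : ℂ) (y : Fin 3 → ℂ) (j : ℕ) (p : Pol) :
    evalComb k y (Finsupp.single j p) = radial k j (dot y y) * MvPolynomial.eval y p := by
  simp [evalComb, MvPolynomial.aeval_eq_eval]

lemma hasDerivAt_eval_line (p : Pol) (y v : Fin 3 → ℂ) (t : ℂ) :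
    HasDerivAt (fun t : ℂ => MvPolynomial.eval (y + t • v) p)
      (∑ i, v i * MvPolynomial.eval (y + t • v) (MvPolynomial.pderiv i p)) t := by
  induction p using MvPolynomial.induction_on with
  | C a => simpa using hasDerivAt_const t a
  | add p q hp hq =>
    simp only [map_add, mul_add, Finset.sum_add_distrib]
    exact hp.add hq
  | mul_X p i hp =>
    have h1 : HasDerivAt (fun t : ℂ => y i + t * v i) (v i) t := by
      simpa using ((hasDerivAt_id t).mul_const (v i)).const_add (y i)
    have h2 := hp.mul h1
    simp only [map_mul, MvPolynomial.eval_X, Pi.add_apply, Pi.smul_apply, smul_eq_mul]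
    refine h2.congr_deriv ?_
    simp only [Derivation.leibniz, smul_eq_mul, map_add, map_mul, MvPolynomial.eval_X,
      MvPolynomial.pderiv_X, Pi.add_apply, Pi.smul_apply, Fin.sum_univ_three]
    fin_cases i <;> simp <;> ring

/-- Shows that the formal gradient computes genuine derivatives along complex lines, as long as y·y
avoids the branch cut of the square root. -/
lemma hasDerivAt_evalComb {k : ℂ} (hk : k ≠ 0) (y v : Fin 3 → ℂ) (t : ℂ)
    (ht : dot (y + t • v) (y + t • v) ∈ slitPlane) (m : RadialComb) :
    HasDerivAt (fun t : ℂ => evalComb k (y + t • v) m)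
      (∑ i, v i * evalComb k (y + t • v) (gradComb i m)) t := by
  induction m using Finsupp.induction_linear with
  | zero => simpa using hasDerivAt_const t (0 : ℂ)
  | add f g hf hg =>
    simp only [map_add, mul_add, Finset.sum_add_distrib]
    exact hf.add hg
  | single j p =>
    simp only [gradComb_single, map_add, evalComb_single, map_mul, MvPolynomial.eval_X, map_ofNat]
    have hd : HasDerivAt (fun t : ℂ => dot (y + t • v) (y + t • v))
        (2 * dot v (y + t • v)) t := by
      have h1 : ∀ i, HasDerivAt (fun t : ℂ => y i + t * v i) (v i) t := fun i => by
        simpa using ((hasDerivAt_id t).mul_const (v i)).const_add (y i)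
      have h2 := (((h1 0).mul (h1 0)).add ((h1 1).mul (h1 1))).add ((h1 2).mul (h1 2))
      refine h2.congr_deriv ?_
      simp only [dot, Pi.add_apply, Pi.smul_apply, smul_eq_mul]
      ring
    have h := ((hasDerivAt_radial hk j ht).comp t hd).mul (hasDerivAt_eval_line p y v t)
    refine h.congr_deriv ?_
    simp only [Fin.sum_univ_three, dot, Pi.add_apply, Pi.smul_apply, smul_eq_mul, Function.comp_apply]
    ring

/-- The polynomial differential operator `p(∇ / (ik))` applied to `f₀`. -/
def diffOp (k : ℂ) : Pol →ₗ[ℂ] RadialComb :=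
  (MvPolynomial.basisMonomials (Fin 3) ℂ).constr ℂ fun α =>
    (((I * k)⁻¹ • gradComb 0) ^ α 0 * ((I * k)⁻¹ • gradComb 1) ^ α 1
      * ((I * k)⁻¹ • gradComb 2) ^ α 2) (Finsupp.single 0 1)

lemma diffOp_monomial (k : ℂ) (α : Fin 3 →₀ ℕ) : diffOp k (MvPolynomial.monomial α 1) =
    (((I * k)⁻¹ • gradComb 0) ^ α 0 * ((I * k)⁻¹ • gradComb 1) ^ α 1
      * ((I * k)⁻¹ • gradComb 2) ^ α 2) (Finsupp.single 0 1) := by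
  rw [diffOp, show (MvPolynomial.monomial α 1 : Pol) = MvPolynomial.basisMonomials (Fin 3) ℂ α by
    rw [MvPolynomial.coe_basisMonomials], Module.Basis.constr_basis]

lemma diffOp_one (k : ℂ) : diffOp k 1 = Finsupp.single 0 1 := by
  have := diffOp_monomial k 0
  simpa using this

lemma commute_mul_pow {R : Type*} [Monoid R] (A : Fin 3 → R) (h : ∀ i j, Commute (A i) (A j))
    (i : Fin 3) (α : Fin 3 →₀ ℕ) : A 0 ^ (α + Finsupp.single i 1 : Fin 3 →₀ ℕ) 0
      * A 1 ^ (α + Finsupp.single i 1 : Fin 3 →₀ ℕ) 1 * A 2 ^ (α + Finsupp.single i 1 : Fin 3 →₀ ℕ) 2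
      = A i * (A 0 ^ α 0 * A 1 ^ α 1 * A 2 ^ α 2) := by
  fin_cases i
  · simp [pow_succ', mul_assoc]
  · simp [pow_succ']
    rw [← mul_assoc (A 1), ← mul_assoc (A 1), ((h 1 0).pow_right (α 0)).eq]
    simp only [mul_assoc]
  · simp [pow_succ']
    rw [← mul_assoc (A 2), (((h 2 0).pow_right (α 0)).mul_right ((h 2 1).pow_right (α 1))).eq]
    simp only [mul_assoc]

lemma diffOp_X_mul (k : ℂ) (i : Fin 3) (p : Pol) :
    diffOp k (MvPolynomial.X i * p) = (I * k)⁻¹ • gradComb i (diffOp k p) := by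
  have h : (diffOp k) ∘ₗ LinearMap.mulLeft ℂ (MvPolynomial.X i)
      = ((I * k)⁻¹ • gradComb i) ∘ₗ diffOp k := by
    refine (MvPolynomial.basisMonomials (Fin 3) ℂ).ext fun α => ?_
    simp only [MvPolynomial.coe_basisMonomials, LinearMap.comp_apply, LinearMap.mulLeft_apply]
    rw [show (MvPolynomial.X i * MvPolynomial.monomial α 1 : Pol)
      = MvPolynomial.monomial (α + Finsupp.single i 1) 1 by
        rw [MvPolynomial.X, MvPolynomial.monomial_mul, one_mul, add_comm],
      diffOp_monomial, diffOp_monomial, ← Module.End.mul_apply]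
    exact congrArg (fun f : Module.End ℂ RadialComb => f (Finsupp.single 0 1)) (commute_mul_pow
      (fun i => (I * k)⁻¹ • gradComb i)
      (fun i j => ((gradComb_commute i j).smul_left _).smul_right _) i α)
  exact congrArg (fun f => f p) h

/-- The functional `p ↦ p(∇ / (ik)) h₀(k |y|)`. -/
def waveFun (k : ℂ) (y : Fin 3 → ℂ) : Pol →ₗ[ℂ] ℂ := evalComb k y ∘ₗ diffOp k

lemma waveFun_one (k : ℂ) (y : Fin 3 → ℂ) : waveFun k y 1 = hankelRed 0 (k * dot y y ^ (1 / 2 : ℂ)) := by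
  simp [waveFun, diffOp_one, evalComb_single, radial]

lemma hasDerivAt_waveFun {k : ℂ} (hk : k ≠ 0) (y v : Fin 3 → ℂ) (t : ℂ)
    (ht : dot (y + t • v) (y + t • v) ∈ slitPlane) (p : Pol) :
    HasDerivAt (fun t : ℂ => waveFun k (y + t • v) p)
      (I * k * waveFun k (y + t • v) (lin v * p)) t := by
  refine (hasDerivAt_evalComb hk y v t ht (diffOp k p)).congr_deriv ?_
  have hik : I * k ≠ 0 := mul_ne_zero I_ne_zero hk
  have h : ∀ i, diffOp k (MvPolynomial.C (v i) * MvPolynomial.X i * p)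
      = (v i * (I * k)⁻¹) • gradComb i (diffOp k p) := fun i => by
    rw [mul_assoc, ← MvPolynomial.smul_eq_C_mul, map_smul, diffOp_X_mul, smul_smul]
  simp only [waveFun, lin, add_mul, map_add, LinearMap.comp_apply, h, map_smul, smul_eq_mul,
    Fin.sum_univ_three]
  field_simp

lemma gradComb_eval_zero {k : ℂ} (hk : k ≠ 0) {m : RadialComb}
    (h : ∀ y, dot y y ∈ slitPlane → evalComb k y m = 0) (i : Fin 3) (y : Fin 3 → ℂ)
    (hy : dot y y ∈ slitPlane) : evalComb k y (gradComb i m) = 0 := by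
  have hd := hasDerivAt_evalComb hk y (Pi.single i 1) 0 (by simpa using hy) m
  have hcont : Continuous fun t : ℂ => dot (y + t • (Pi.single i 1 : Fin 3 → ℂ))
      (y + t • (Pi.single i 1 : Fin 3 → ℂ)) := by
    unfold dot; fun_prop
  have hev : (fun t : ℂ => evalComb k (y + t • (Pi.single i 1 : Fin 3 → ℂ)) m) =ᶠ[nhds 0]
      fun _ => (0 : ℂ) := by
    have := hcont.continuousAt.eventually_mem (x := 0) (isOpen_slitPlane.mem_nhds (by simpa using hy))
    filter_upwards [this] with t ht
    exact h _ ht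
  have h0 := hd.unique ((hasDerivAt_const (0 : ℂ) (0 : ℂ)).congr_of_eventuallyEq hev)
  simpa [Pi.single_apply] using h0

/-- For constant `q` this is the Helmholtz equation for h₀(k|y|), in the form `hankelRed_helmholtz`.
A further factor X_i differentiates a function that vanishes on an open set, which again gives zero.
-/
lemma isSphereFunctional_waveFun {k : ℂ} (hk : k ≠ 0) (q : Pol) :
    ∀ y, dot y y ∈ slitPlane → waveFun k y ((polR2 - 1) * q) = 0 := by
  induction q using MvPolynomial.induction_on with
  | C a =>
    intro y hy
    rw [mul_comm, ← MvPolynomial.smul_eq_C_mul, map_smul]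
    have hs := sqrt_ne_zero hy
    have hX : ∀ i : Fin 3, diffOp k (MvPolynomial.X i ^ 2) = ((I * k)⁻¹ * (I * k)⁻¹) •
        (Finsupp.single 1 2 + Finsupp.single 2 (4 * MvPolynomial.X i ^ 2)) := fun i => by
      have h1 := diffOp_X_mul k i (MvPolynomial.X i * 1)
      rw [diffOp_X_mul k i 1, diffOp_one, gradComb_single, map_smul, smul_smul, map_add,
        gradComb_single] at h1
      have h2 : MvPolynomial.pderiv i (2 : Pol) = 0 := by
        rw [show (2 : Pol) = MvPolynomial.C 2 from (map_ofNat _ 2).symm, MvPolynomial.pderiv_C]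
      rw [show (MvPolynomial.X i ^ 2 : Pol) = MvPolynomial.X i * (MvPolynomial.X i * 1) by ring, h1]
      rw [MvPolynomial.pderiv_one, map_zero, mul_zero, Finsupp.single_zero, Finsupp.single_zero,
        zero_add, zero_add, mul_one, gradComb_single, Derivation.leibniz, h2,
        MvPolynomial.pderiv_X_self]
      congr 3
      · simp
      · ring
    have hh := hankelRed_helmholtz (mul_ne_zero hk hs)
    have h0 : waveFun k y (polR2 - 1) = 0 := by
      simp only [waveFun, polR2, map_sub, map_add, LinearMap.comp_apply, hX, diffOp_one, map_smul,
        evalComb_single, radial, map_mul, map_pow, MvPolynomial.eval_X, map_one, smul_eq_mul]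
      have h4 : ∀ z : Fin 3 → ℂ, MvPolynomial.eval z (4 : Pol) = 4 := fun z => map_ofNat _ 4
      have h2 : ∀ z : Fin 3 → ℂ, MvPolynomial.eval z (2 : Pol) = 2 := fun z => map_ofNat _ 2
      rw [mul_pow, sqrt_sq] at hh
      simp only [h2, h4]
      rw [← hh, ← mul_inv, show I * k * (I * k) = - k ^ 2 by linear_combination k ^ 2 * I_sq]
      field_simp
      simp only [dot]
      ring
    rw [h0, smul_zero]
  | add p q hp hq =>
    intro y hy
    rw [mul_add, map_add, hp y hy, hq y hy, add_zero]
  | mul_X p i hp =>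
    intro y hy
    rw [mul_comm p, mul_left_comm, waveFun, LinearMap.comp_apply, diffOp_X_mul, map_smul,
      gradComb_eval_zero hk hp i y hy, smul_zero]

/-- The operator ζ·∇ annihilates (ζ·y)^l because ζ·ζ = 0, so it acts on the radial factor alone:
each application contributes 2(ζ·y) and raises the radial index. -/
lemma diffOp_null_pow (k : ℂ) (ζ : Fin 3 → ℂ) (hζ : dot ζ ζ = 0) (l : ℕ) :
    diffOp k (lin ζ ^ l) = (2 * (I * k)⁻¹) ^ l • Finsupp.single l (lin ζ ^ l) := by
  induction l with
  | zero => simp [diffOp_one]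
  | succ l ih =>
    have h : ∀ (i : Fin 3) (p : Pol), diffOp k (MvPolynomial.C (ζ i) * MvPolynomial.X i * p)
        = (ζ i * (I * k)⁻¹) • gradComb i (diffOp k p) := fun i p => by
      rw [mul_assoc, ← MvPolynomial.smul_eq_C_mul, map_smul, diffOp_X_mul, smul_smul]
    have hp : ∀ i, MvPolynomial.pderiv i (lin ζ ^ l) = MvPolynomial.C (ζ i) * ((l : Pol) * lin ζ ^ (l - 1)) := by
      intro i
      rw [Derivation.leibniz_pow]
      have : MvPolynomial.pderiv i (lin ζ) = MvPolynomial.C (ζ i) := by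
        fin_cases i <;> simp [lin, Derivation.leibniz, MvPolynomial.pderiv_X]
      rw [this]; simp; ring
    have key : ∑ i, ζ i • gradComb i (Finsupp.single l (lin ζ ^ l))
        = Finsupp.single (l + 1) (2 * lin ζ ^ (l + 1)) := by
      simp only [gradComb_single, hp, smul_add, Finsupp.smul_single, Finset.sum_add_distrib]
      rw [← Finsupp.single_finsetSum, ← Finsupp.single_finsetSum]
      have h1 : ∑ i, ζ i • (MvPolynomial.C (ζ i) * ((l : Pol) * lin ζ ^ (l - 1))) = 0 := by
        have : ∑ i, ζ i • (MvPolynomial.C (ζ i) * ((l : Pol) * lin ζ ^ (l - 1)))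
            = MvPolynomial.C (dot ζ ζ) * ((l : Pol) * lin ζ ^ (l - 1)) := by
          simp [Fin.sum_univ_three, dot, MvPolynomial.smul_eq_C_mul]; ring
        rw [this, hζ]; simp
      rw [h1, Finsupp.single_zero, zero_add]
      congr 1
      simp only [Fin.sum_univ_three, MvPolynomial.smul_eq_C_mul]
      rw [pow_succ, show lin ζ ^ l * lin ζ = lin ζ ^ l * (MvPolynomial.C (ζ 0) * MvPolynomial.X 0
        + MvPolynomial.C (ζ 1) * MvPolynomial.X 1 + MvPolynomial.C (ζ 2) * MvPolynomial.X 2) from rfl]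
      ring
    have hsplit : lin ζ ^ (l + 1) = MvPolynomial.C (ζ 0) * MvPolynomial.X 0 * lin ζ ^ l
        + MvPolynomial.C (ζ 1) * MvPolynomial.X 1 * lin ζ ^ l
        + MvPolynomial.C (ζ 2) * MvPolynomial.X 2 * lin ζ ^ l := by
      rw [pow_succ', ← add_mul, ← add_mul]; rfl
    rw [congrArg (diffOp k) hsplit, map_add, map_add, h, h, h, ih]
    simp only [map_smul, smul_smul]
    simp only [Fin.sum_univ_three] at key
    have e : ∀ i, (ζ i * (I * k)⁻¹ * (2 * (I * k)⁻¹) ^ l) • gradComb i (Finsupp.single l (lin ζ ^ l))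
      = ((I * k)⁻¹ * (2 * (I * k)⁻¹) ^ l) • (ζ i • gradComb i (Finsupp.single l (lin ζ ^ l))) :=
      fun i => by rw [smul_smul]; ring_nf
    rw [e, e, e, ← smul_add, ← smul_add, key, pow_succ (2 * (I * k)⁻¹),
      show (2 * lin ζ ^ (l + 1) : Pol) = (2 : ℂ) • lin ζ ^ (l + 1) by
        rw [MvPolynomial.smul_eq_C_mul, map_ofNat], ← Finsupp.smul_single, smul_smul]
    congr 1; ring

lemma waveFun_harm {k : ℂ} (hk : k ≠ 0) (y : Fin 3 → ℂ) (l j : ℕ) : waveFun k y (harm l j)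
    = (I * k) ^ l * hankelRed l (k * dot y y ^ (1 / 2 : ℂ)) * MvPolynomial.eval y (harm l j) := by
  by_cases hj : 2 * l < j
  · simp [harm_eq_zero hj]
  refine coeff_ext (A := 2 * l + 1) (a := fun j => waveFun k y (harm l j)) (b := fun j => (I * k) ^ l
    * hankelRed l (k * dot y y ^ (1 / 2 : ℂ)) * MvPolynomial.eval y (harm l j)) (fun τ => ?_) j (by omega)
  have h1 : waveFun k y (lin (nullVec τ) ^ l) = (I * k) ^ l * hankelRed l (k * dot y y ^ (1 / 2 : ℂ))
      * MvPolynomial.eval y (lin (nullVec τ) ^ l) := by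
    rw [waveFun, LinearMap.comp_apply, diffOp_null_pow k _ (dot_nullVec_self τ), map_smul,
      evalComb_single, radial, smul_eq_mul, ← mul_assoc, ← mul_assoc, ← mul_pow]
    congr 3
    have := mul_ne_zero I_ne_zero hk
    field_simp
    linear_combination -I_sq
  rw [lin_nullVec_pow] at h1
  simp only [map_sum, ← MvPolynomial.smul_eq_C_mul, map_smul, MvPolynomial.smul_eval] at h1
  rw [Finset.mul_sum] at h1
  convert h1 using 2
  · rw [smul_eq_mul, mul_comm]
  · ring

lemma waveFun_solid {k : ℂ} (hk : k ≠ 0) (y : Fin 3 → ℂ) (p : LM) : waveFun k y (solid p)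
    = (I * k) ^ p.l * hankelRed p.l (k * dot y y ^ (1 / 2 : ℂ)) * MvPolynomial.eval y (solid p) := by
  have : solid p = MvPolynomial.C (normCoeff p : ℂ) * harm p.l p.idx := rfl
  rw [this, ← MvPolynomial.smul_eq_C_mul, map_smul, waveFun_harm hk, MvPolynomial.smul_eval,
    smul_eq_mul]
  ring

lemma waveFun_solid_real {k : ℂ} (hk : k ≠ 0) {y : E3} (hy : y ≠ 0) (p : LM) :
    waveFun k (toC y) (solid p) = I ^ p.l * sphericalHankel p.l (k * ‖y‖) * sphericalHarmonic p y := by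
  have hn : (‖y‖ : ℂ) ≠ 0 := by exact_mod_cast norm_ne_zero_iff.2 hy
  rw [waveFun_solid hk, eval_solid_real _ _ hy, dot_toC_self]
  have : ((‖y‖ : ℂ) ^ 2) ^ (1 / 2 : ℂ) = ‖y‖ := by
    have h := Complex.ofReal_cpow (x := ‖y‖ ^ 2) (by positivity) (1 / 2)
    rw [← Real.sqrt_eq_rpow, Real.sqrt_sq (norm_nonneg y)] at h
    push_cast at h; exact h.symm
  rw [this, hankelRed, mul_pow, mul_pow]
  field_simp

end SphericalWaves
end

/-! ### The complex domain of the wave, Cauchy estimates and Taylor series. -/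

noncomputable section
namespace SphericalWaves
open Complex

lemma toC_add (x y : E3) : toC (x + y) = toC x + toC y := by ext i; simp [toC]

lemma toC_neg (x : E3) : toC (-x) = -toC x := by ext i; simp [toC]

lemma toC_smul (c : ℝ) (x : E3) : toC (c • x) = (c : ℂ) • toC x := by ext i; simp [toC]

/-- Bessel's inequality for an orthogonal pair, allowing norms below 1 so that zero vectors are
covered. -/
lemma sq_inner_add_sq_inner_le {α β n : E3} (hα : ‖α‖ ≤ 1) (hβ : ‖β‖ ≤ 1)
    (h : inner ℝ α β = 0) : inner ℝ n α ^ 2 + inner ℝ n β ^ 2 ≤ ‖n‖ ^ 2 := by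
  set p := inner ℝ n α
  set q := inner ℝ n β
  have h1 : inner ℝ n (p • α + q • β) = p ^ 2 + q ^ 2 := by
    rw [inner_add_right, inner_smul_right, inner_smul_right]; ring
  have h2 : ‖p • α + q • β‖ ^ 2 ≤ p ^ 2 + q ^ 2 := by
    rw [norm_add_sq_real, inner_smul_left, inner_smul_right, h, norm_smul, norm_smul, mul_pow, mul_pow,
      Real.norm_eq_abs, Real.norm_eq_abs, sq_abs, sq_abs]
    have := mul_le_mul_of_nonneg_left (pow_le_one₀ (norm_nonneg α) hα (n := 2)) (sq_nonneg p)
    have := mul_le_mul_of_nonneg_left (pow_le_one₀ (norm_nonneg β) hβ (n := 2)) (sq_nonneg q)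
    simp; linarith
  have h3 := real_inner_le_norm n (p • α + q • β)
  rw [h1] at h3
  have h0 : 0 ≤ p ^ 2 + q ^ 2 := by positivity
  have h4 : (p ^ 2 + q ^ 2) ^ 2 ≤ ‖n‖ ^ 2 * (p ^ 2 + q ^ 2) := by
    calc (p ^ 2 + q ^ 2) ^ 2 ≤ (‖n‖ * ‖p • α + q • β‖) ^ 2 := by gcongr
      _ = ‖n‖ ^ 2 * ‖p • α + q • β‖ ^ 2 := by ring
      _ ≤ _ := by gcongr
  rcases h0.eq_or_lt with h5 | h5
  · rw [← h5]; positivity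
  · nlinarith

/-- A vector `w` for which `a + w` leaves the slit plane is large in the norm dual to the one
occurring in the conclusion. -/
lemma exists_dual_of_notMem_slitPlane (a u v : E3)
    (h : dot (toC a + (toC u + I • toC v)) (toC a + (toC u + I • toC v)) ∉ slitPlane) :
    ∃ Z : Fin 3 → ℂ, (∀ n : E3, ‖dot (toC n) Z‖ ≤ ‖n‖) ∧ ‖a‖ ≤ ‖dot (toC u + I • toC v) Z‖ := by
  have hdot : ∀ s t : Fin 3 → ℂ, dot s t = s 0 * t 0 + s 1 * t 1 + s 2 * t 2 := fun _ _ => rfl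
  set b := a + u with hb
  have e1 : dot (toC a + (toC u + I • toC v)) (toC a + (toC u + I • toC v))
      = ((‖b‖ ^ 2 - ‖v‖ ^ 2 : ℝ) : ℂ) + ((2 * inner ℝ b v : ℝ) : ℂ) * I := by
    rw [← add_assoc, ← toC_add, ← hb]
    have : dot (toC b + I • toC v) (toC b + I • toC v)
        = dot (toC b) (toC b) + 2 * I * dot (toC b) (toC v) + I ^ 2 * dot (toC v) (toC v) := by
      simp only [hdot, Pi.add_apply, Pi.smul_apply, smul_eq_mul]; ring
    rw [this, dot_toC_self, dot_toC_self, dot_toC, I_sq]; push_cast; ring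
  rw [e1, mem_slitPlane_iff] at h
  push Not at h
  simp only [add_re, add_im, mul_re, mul_im, ofReal_re, ofReal_im, I_re, I_im] at h
  obtain ⟨hre, him⟩ := h
  have hbv : inner ℝ b v = 0 := by linarith
  have hle : ‖b‖ ≤ ‖v‖ := by
    apply le_of_sq_le_sq _ (norm_nonneg v); linarith
  set w := ‖v‖⁻¹ • v with hw
  have hvw : v = ‖v‖ • w := by
    by_cases hv : v = 0
    · simp [hv]
    · rw [hw, smul_smul, mul_inv_cancel₀ (norm_ne_zero_iff.2 hv), one_smul]
  -- Only ≤ is available: normalising the zero vector returns zero.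
  have hunit : ∀ x : E3, ‖‖x‖⁻¹ • x‖ ≤ 1 := fun x => by
    rw [norm_smul, norm_inv, norm_norm]; exact inv_mul_le_one
  have hww : ∀ x : E3, inner ℝ (‖x‖⁻¹ • x) x = ‖x‖ := fun x => by
    rw [inner_smul_left, real_inner_self_eq_norm_sq]
    by_cases hx : ‖x‖ = 0
    · simp [hx]
    · simp; field_simp
  set c := a - inner ℝ a w • w with hc
  set α := ‖c‖⁻¹ • c with hα
  have hbw : inner ℝ b w = 0 := by rw [hw, inner_smul_right, hbv, mul_zero]
  have hcw : inner ℝ c w = 0 := by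
    by_cases hv : v = 0
    · simp [hw, hv]
    · rw [hc, inner_sub_left, inner_smul_left, real_inner_self_eq_norm_sq, hw, norm_smul, norm_inv,
        norm_norm, inv_mul_cancel₀ (norm_ne_zero_iff.2 hv)]
      simp
  have hαw : inner ℝ α w = 0 := by rw [hα, inner_smul_left, hcw, mul_zero]
  have hac : inner ℝ a α = ‖c‖ := by
    have : a = c + inner ℝ a w • w := by rw [hc]; abel
    have h1 : inner ℝ c α = ‖c‖ := by rw [real_inner_comm, hα, hww]
    have h2 : inner ℝ w α = 0 := by rw [real_inner_comm, hαw]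
    nth_rewrite 1 [this]
    rw [inner_add_left, inner_smul_left, h1, h2, mul_zero, add_zero]
  have hnorm : ‖a‖ ^ 2 ≤ ‖c‖ ^ 2 + inner ℝ a w ^ 2 := by
    have : a = c + inner ℝ a w • w := by rw [hc]; abel
    have h2 : ‖a‖ ^ 2 = ‖c‖ ^ 2 + ‖inner ℝ a w • w‖ ^ 2 := by
      nth_rewrite 1 [this]
      rw [norm_add_sq_real, inner_smul_right, hcw]; ring
    rw [h2, norm_smul, mul_pow, Real.norm_eq_abs, sq_abs]
    have := mul_le_mul_of_nonneg_left (pow_le_one₀ (norm_nonneg w) (hunit v) (n := 2))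
      (sq_nonneg (inner ℝ a w))
    linarith
  -- Here w is the direction of v, and α that of the part of a orthogonal to w. Orthogonality of α
  -- and w gives the bound on real vectors. In the pairing with u + iv the imaginary part is a·w,
  -- while b·α ≤ ‖b‖ ≤ ‖v‖ keeps the real part at least ‖c‖.
  refine ⟨-(toC α + I • toC w), fun n => ?_, ?_⟩
  · have e : dot (toC n) (-(toC α + I • toC w)) = ((-inner ℝ n α : ℝ) : ℂ) + ((-inner ℝ n w : ℝ) : ℂ) * I := by
      have : dot (toC n) (-(toC α + I • toC w)) = -dot (toC n) (toC α) - I * dot (toC n) (toC w) := by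
        simp only [hdot, Pi.neg_apply, Pi.add_apply, Pi.smul_apply, smul_eq_mul]; ring
      rw [this, dot_toC, dot_toC]; push_cast; ring
    rw [e, Complex.norm_add_mul_I]
    apply Real.sqrt_le_iff.2 ⟨norm_nonneg n, _⟩
    have := sq_inner_add_sq_inner_le (n := n) (hunit c) (hunit v) hαw
    simpa using this
  · have hu : u = b - a := by rw [hb]; abel
    have e : dot (toC u + I • toC v) (-(toC α + I • toC w))
        = ((‖c‖ + (‖v‖ - inner ℝ b α) : ℝ) : ℂ) + ((inner ℝ a w : ℝ) : ℂ) * I := by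
      have : dot (toC u + I • toC v) (-(toC α + I • toC w)) = -dot (toC u) (toC α)
          - I * dot (toC u) (toC w) - I * dot (toC v) (toC α) - I ^ 2 * dot (toC v) (toC w) := by
        simp only [hdot, Pi.neg_apply, Pi.add_apply, Pi.smul_apply, smul_eq_mul]; ring
      have hva : inner ℝ v α = 0 := by
        rw [hvw, inner_smul_left, real_inner_comm, hαw, mul_zero]
      have hvw2 : inner ℝ v w = ‖v‖ := by rw [real_inner_comm, hw, hww]
      rw [this, dot_toC, dot_toC, dot_toC, dot_toC, I_sq, hu, inner_sub_left, inner_sub_left, hbw, hac,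
        hva, hvw2]
      push_cast; ring
    rw [e, Complex.norm_add_mul_I]
    apply Real.le_sqrt_of_sq_le
    have h3 : inner ℝ b α ≤ ‖v‖ := (real_inner_le_norm b α).trans
      ((mul_le_of_le_one_right (norm_nonneg b) (hunit c)).trans hle)
    have h4 : ‖c‖ ^ 2 ≤ (‖c‖ + (‖v‖ - inner ℝ b α)) ^ 2 := by
      have := norm_nonneg c
      gcongr; linarith
    linarith

/-- If the value left the slit plane, pairing with the dual vector of
`exists_dual_of_notMem_slitPlane` would give ‖a‖ ≤ ‖s‖‖b‖ + ‖t‖‖c‖. No loss of constants occurs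
here, which is why the double series converges on all of r + r' < a. -/
lemma dot_mem_slitPlane (a b c : E3) (s t : ℂ) (h : ‖s‖ * ‖b‖ + ‖t‖ * ‖c‖ < ‖a‖) :
    dot (toC a + s • toC b + t • toC c) (toC a + s • toC b + t • toC c) ∈ slitPlane := by
  by_contra hn
  have e : toC a + s • toC b + t • toC c = toC a + (toC (s.re • b + t.re • c)
      + I • toC (s.im • b + t.im • c)) := by
    rw [toC_add, toC_add, toC_smul, toC_smul, toC_smul, toC_smul]
    nth_rewrite 1 [← Complex.re_add_im s, ← Complex.re_add_im t]
    ext i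
    simp only [Pi.add_apply, Pi.smul_apply, smul_eq_mul]; ring
  have e2 : s • toC b + t • toC c = (toC (s.re • b + t.re • c)
      + I • toC (s.im • b + t.im • c)) := by
    rw [add_assoc] at e; exact add_left_cancel e
  rw [e] at hn
  obtain ⟨Z, h1, h2⟩ := exists_dual_of_notMem_slitPlane a _ _ hn
  rw [← e2] at h2
  have h3 : dot (s • toC b + t • toC c) Z = s * dot (toC b) Z + t * dot (toC c) Z := by
    simp only [dot, Pi.add_apply, Pi.smul_apply, smul_eq_mul]; ring
  have h4 := norm_add_le (s * dot (toC b) Z) (t * dot (toC c) Z)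
  rw [norm_mul, norm_mul] at h4
  have h5 := mul_le_mul_of_nonneg_left (h1 b) (norm_nonneg s)
  have h6 := mul_le_mul_of_nonneg_left (h1 c) (norm_nonneg t)
  rw [h3] at h2
  linarith

lemma iteratedDeriv_waveFun {k : ℂ} (hk : k ≠ 0) (y v : Fin 3 → ℂ) (q : Pol) {ρ : ℝ}
    (h : ∀ t : ℂ, ‖t‖ < ρ → dot (y + t • v) (y + t • v) ∈ slitPlane) (N : ℕ) :
    ∀ t : ℂ, ‖t‖ < ρ → iteratedDeriv N (fun t : ℂ => waveFun k (y + t • v) q) t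
      = (I * k) ^ N * waveFun k (y + t • v) (lin v ^ N * q) := by
  induction N with
  | zero => intro t _; simp
  | succ N ih =>
    intro t ht
    rw [iteratedDeriv_succ]
    have he : iteratedDeriv N (fun t : ℂ => waveFun k (y + t • v) q) =ᶠ[nhds t]
        fun t => (I * k) ^ N * waveFun k (y + t • v) (lin v ^ N * q) := by
      have : Metric.ball (0 : ℂ) ρ ∈ nhds t := Metric.isOpen_ball.mem_nhds (by simpa using ht)
      filter_upwards [this] with s hs
      exact ih s (by simpa using hs)
    rw [he.deriv_eq, ((hasDerivAt_waveFun hk y v t (h t ht) (lin v ^ N * q)).const_mul _).deriv,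
      ← mul_assoc (lin v), ← pow_succ', pow_succ (I * k), mul_assoc ((I * k) ^ N)]

/-- Cauchy's estimate: up to (ik)^N the left side is the N-th derivative at t = 0 of the functional
along the line y + tv. -/
lemma norm_waveFun_lin_pow_mul_le {k : ℂ} (hk : k ≠ 0) (y v : Fin 3 → ℂ) (q : Pol) {R C : ℝ} (hR : 0 < R)
    (h : ∀ t : ℂ, ‖t‖ ≤ R → dot (y + t • v) (y + t • v) ∈ slitPlane)
    (hC : ∀ t : ℂ, ‖t‖ = R → ‖waveFun k (y + t • v) q‖ ≤ C) (N : ℕ) :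
    ‖waveFun k y (lin v ^ N * q)‖ ≤ N.factorial * C / (‖k‖ * R) ^ N := by
  have hd : DifferentiableOn ℂ (fun t : ℂ => waveFun k (y + t • v) q) (Metric.closedBall 0 R) :=
    fun t ht => (hasDerivAt_waveFun hk y v t (h t (by simpa using ht)) q).differentiableAt.differentiableWithinAt
  have h1 := Complex.norm_iteratedDeriv_le_of_forall_mem_sphere_norm_le N hR
    (hd.diffContOnCl_ball subset_rfl) (fun z hz => hC z (by simpa using hz))
  rw [iteratedDeriv_waveFun hk y v q (ρ := R) (fun t ht => h t ht.le) N 0 (by simpa using hR)] at h1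
  rw [zero_smul, add_zero, norm_mul, norm_pow, norm_mul, norm_I, one_mul] at h1
  have hk' : 0 < ‖k‖ := norm_pos_iff.2 hk
  rw [mul_pow, le_div_iff₀ (by positivity)]
  rw [le_div_iff₀ (by positivity)] at h1
  linarith

lemma hasSum_waveFun_taylor {k : ℂ} (hk : k ≠ 0) (y v : Fin 3 → ℂ) (q : Pol) {ρ : ℝ} (hρ : 1 < ρ)
    (h : ∀ t : ℂ, ‖t‖ < ρ → dot (y + t • v) (y + t • v) ∈ slitPlane) :
    HasSum (fun N : ℕ => (I * k) ^ N / N.factorial * waveFun k y (lin v ^ N * q))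
      (waveFun k (y + v) q) := by
  have hd : DifferentiableOn ℂ (fun t : ℂ => waveFun k (y + t • v) q) (Metric.ball 0 ρ) :=
    fun t ht => (hasDerivAt_waveFun hk y v t (h t (by simpa using ht)) q).differentiableAt.differentiableWithinAt
  have h1 := Complex.hasSum_taylorSeries_on_ball (r := ρ.toNNReal) (z := 1)
    (by rw [Real.coe_toNNReal _ (by linarith)]; exact hd)
    (by rw [Real.coe_toNNReal _ (by linarith)]; simpa using hρ)
  have h2 := iteratedDeriv_waveFun hk y v q h
  simp only [h2 _ 0 (by simp; linarith), zero_smul, add_zero, one_smul, sub_zero, one_pow,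
    smul_eq_mul] at h1
  have e : ∀ N : ℕ, (N.factorial : ℂ)⁻¹ * (1 * ((I * k) ^ N * waveFun k y (lin v ^ N * q)))
      = (I * k) ^ N / N.factorial * waveFun k y (lin v ^ N * q) := fun N => by ring
  simp only [e] at h1
  exact h1

end SphericalWaves
end

/-! ### Growth of the wave functional on solid harmonics. -/

noncomputable section
namespace SphericalWaves
open Complex

lemma isSphereFunctional_waveFun' {k : ℂ} (hk : k ≠ 0) {y : Fin 3 → ℂ} (hy : dot y y ∈ slitPlane) :
    IsSphereFunctional (waveFun k y) := fun q => isSphereFunctional_waveFun hk q y hy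

lemma IsSphereFunctional.comp_mulRight {Φ : Pol →ₗ[ℂ] ℂ} (hΦ : IsSphereFunctional Φ) (q' : Pol) :
    IsSphereFunctional (Φ ∘ₗ LinearMap.mulRight ℂ q') := fun q => by
  simp only [LinearMap.comp_apply, LinearMap.mulRight_apply, mul_assoc]
  exact hΦ _

lemma dot_toC_mem_slitPlane {a : E3} (ha : a ≠ 0) : dot (toC a) (toC a) ∈ slitPlane := by
  have := dot_mem_slitPlane a 0 0 0 0 (by simpa using ha)
  simpa using this

/-- Norm growth of the solid harmonics relative to powers of linear forms. -/
def growth (l : ℕ) : ℝ := 2 * Real.pi ^ 2 * (2 * l + 1) * (l.factorial / funkHecke l l)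

lemma growth_eq (l : ℕ) : growth l = Real.pi / 2 * (2 * l + 1) * (2 * l + 1).doubleFactorial := by
  have h := funkHecke_add l 0
  have h1 : (l.factorial : ℝ) ≠ 0 := by exact_mod_cast l.factorial_ne_zero
  have h2 : ((2 * l + 1).doubleFactorial : ℝ) ≠ 0 := by
    exact_mod_cast (Nat.doubleFactorial_pos _).ne'
  simp only [mul_zero, add_zero, pow_zero, Nat.factorial_zero] at h
  rw [growth, h]
  have := Real.pi_pos.ne'
  push_cast; field_simp; norm_num

lemma growth_nonneg (l : ℕ) : 0 ≤ growth l := by rw [growth_eq]; positivity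

/-- By Funk–Hecke, integrating n ↦ Φ((n·x)^l) against Y_{lm} returns `funkHecke l l` times Φ of the
solid harmonic; bounds on powers of real linear forms therefore transfer to solid harmonics. -/
lemma norm_apply_solid_le {Φ : Pol →ₗ[ℂ] ℂ} (hΦ : IsSphereFunctional Φ) (p : LM) {B : ℝ}
    (hB : ∀ n : E3, ‖n‖ = 1 → ‖Φ (lin (toC n) ^ p.l)‖ ≤ p.l.factorial * B) :
    ‖Φ (solid p)‖ ≤ growth p.l * B := by
  set s := (finite_setOf_l_le p.l).toFinset with hs
  set P : Pol := ∑ q ∈ s, MvPolynomial.C (funkHecke p.l q.l * Φ (solid q)) * solidBar q with hP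
  have hps : p ∈ s := by simp [hs]
  have h1 : ∀ n : E3, ‖n‖ = 1 → MvPolynomial.eval (toC n) P = Φ (lin (toC n) ^ p.l) := by
    intro n hn
    have hd : dot (toC n) (toC n) = 1 := by rw [dot_toC_self, hn]; simp
    have h := hasSum_sphere_expansion Φ hΦ (lin (toC n) ^ p.l)
    simp only [sphInt_lin_pow_mul_solidBar _ hd] at h
    rw [h.unique (hasSum_sum_of_ne_finset_zero (s := s) (fun q hq => by
      rw [funkHecke_of_lt (by simpa [hs] using hq)]; simp)), hP, map_sum]
    refine Finset.sum_congr rfl fun q _ => ?_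
    rw [map_mul, MvPolynomial.eval_C]; ring
  have h2 : sphInt (P * solid p) = funkHecke p.l p.l * Φ (solid p) := by
    rw [hP, Finset.sum_mul, map_sum, Finset.sum_eq_single p]
    · rw [mul_assoc, sphInt_C_mul, mul_comm (solidBar p), sphInt_solid_mul_solidBar]; simp
    · intro q _ hq
      rw [mul_assoc, sphInt_C_mul, mul_comm (solidBar q), sphInt_solid_mul_solidBar,
        if_neg (Ne.symm hq), mul_zero]
    · exact fun h => absurd hps h
  have h3 : ‖sphInt (P * solid p)‖ ≤ 2 * Real.pi ^ 2 * (p.l.factorial * B * (2 * p.l + 1)) := by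
    rw [sphInt_apply]
    refine norm_solidAngleIntegral_le fun n hn => ?_
    rw [map_mul, h1 n hn, eval_solid_unit _ _ hn, norm_mul]
    exact mul_le_mul (hB n hn) (norm_sphericalHarmonic_le p n hn) (norm_nonneg _)
      ((norm_nonneg _).trans (hB n hn))
  have h4 := funkHecke_self_pos p.l
  rw [h2, norm_mul, Complex.norm_real, Real.norm_of_nonneg h4.le] at h3
  rw [growth]
  have : 2 * Real.pi ^ 2 * (2 * (p.l : ℝ) + 1) * (p.l.factorial / funkHecke p.l p.l) * B
    = 2 * Real.pi ^ 2 * (p.l.factorial * B * (2 * p.l + 1)) / funkHecke p.l p.l := by ring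
  rw [this, le_div_iff₀ h4]; linarith

lemma continuousOn_waveFun {k : ℂ} (hk : k ≠ 0) (s : Pol) :
    ContinuousOn (fun y => waveFun k y s) {y | dot y y ∈ slitPlane} := by
  unfold waveFun
  simp only [LinearMap.comp_apply]
  induction diffOp k s using Finsupp.induction_linear with
  | zero => simpa using continuousOn_const
  | add f g hf hg =>
    simp only [map_add]
    exact hf.add hg
  | single j p =>
    simp only [evalComb_single]
    refine ContinuousOn.mul ?_ (MvPolynomial.continuous_eval p).continuousOn
    have h1 : ContinuousOn (radial k j) slitPlane := fun q hq =>
      (hasDerivAt_radial hk j hq).continuousAt.continuousWithinAt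
    refine h1.comp (Continuous.continuousOn ?_) (fun y hy => hy)
    unfold dot; fun_prop

lemma continuous_toC : Continuous toC := by unfold toC; fun_prop

lemma exists_waveFun_solid_bound {k : ℂ} (hk : k ≠ 0) {a : E3} {R : ℝ} (hR : 0 < R) (hRa : R < ‖a‖)
    (s : Pol) : ∃ M : ℝ, 0 ≤ M ∧ ∀ p : LM, ‖waveFun k (toC a) (solid p * s)‖
      ≤ M * (growth p.l / (‖k‖ * R) ^ p.l) := by
  have hk' : 0 < ‖k‖ := norm_pos_iff.2 hk
  have ha : a ≠ 0 := norm_pos_iff.1 (hR.trans hRa)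
  have hmem : ∀ (t : ℂ) (n : E3), ‖t‖ ≤ R → ‖n‖ = 1 →
      dot (toC a + t • toC n) (toC a + t • toC n) ∈ slitPlane := by
    intro t n ht hn
    have := dot_mem_slitPlane a n 0 t 0 (by rw [hn]; simp; linarith)
    simpa using this
  have hcont : ContinuousOn (fun z : ℂ × E3 => waveFun k (toC a + z.1 • toC z.2) s)
      (Metric.sphere 0 R ×ˢ Metric.sphere 0 1) := by
    refine (continuousOn_waveFun hk s).comp (Continuous.continuousOn ?_) ?_
    · exact continuous_const.add (continuous_fst.smul (continuous_toC.comp continuous_snd))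
    · rintro ⟨t, n⟩ ⟨ht, hn⟩
      exact hmem t n (le_of_eq (by simpa using ht)) (by simpa using hn)
  obtain ⟨M, hM⟩ := ((isCompact_sphere (0 : ℂ) R).prod
    (isCompact_sphere (0 : E3) 1)).exists_bound_of_continuousOn hcont
  refine ⟨max M 0, le_max_right _ _, fun p => ?_⟩
  have h := norm_apply_solid_le ((isSphereFunctional_waveFun' hk
    (dot_toC_mem_slitPlane ha)).comp_mulRight s) p (B := max M 0 / (‖k‖ * R) ^ p.l) (fun n hn => by
      have := norm_waveFun_lin_pow_mul_le hk (toC a) (toC n) s hR (fun t ht => hmem t n ht hn)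
        (C := max M 0) (fun t ht => (hM (t, n) ⟨by simpa using ht, by simpa using hn⟩).trans
          (le_max_left _ _)) p.l
      rw [mul_div_assoc] at this
      simpa using this)
  simp only [LinearMap.comp_apply, LinearMap.mulRight_apply] at h
  refine h.trans (le_of_eq ?_)
  ring

/-- Cauchy's estimate in two independent complex directions, uniform over unit vectors by
compactness, followed by `norm_apply_solid_le` in each factor. The condition R + R' < ‖a‖ keeps the
whole bidisc inside the domain of the wave. -/
lemma exists_waveFun_solid_mul_solid_bound {k : ℂ} (hk : k ≠ 0) {a : E3} {R R' : ℝ} (hR : 0 < R)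
    (hR' : 0 < R') (hRa : R + R' < ‖a‖) : ∃ M : ℝ, 0 ≤ M ∧ ∀ p p' : LM,
      ‖waveFun k (toC a) (solid p * solid p')‖
        ≤ M * (growth p.l / (‖k‖ * R) ^ p.l * (growth p'.l / (‖k‖ * R') ^ p'.l)) := by
  have hk' : 0 < ‖k‖ := norm_pos_iff.2 hk
  have ha : a ≠ 0 := norm_pos_iff.1 (by linarith)
  have hmem : ∀ (t t' : ℂ) (n n' : E3), ‖t‖ ≤ R → ‖t'‖ ≤ R' → ‖n‖ = 1 → ‖n'‖ = 1 →
      dot (toC a + t • toC n + t' • toC n') (toC a + t • toC n + t' • toC n') ∈ slitPlane := by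
    intro t t' n n' ht ht' hn hn'
    exact dot_mem_slitPlane a n n' t t' (by rw [hn, hn']; linarith)
  have hcont : ContinuousOn (fun z : (ℂ × ℂ) × (E3 × E3) =>
      waveFun k (toC a + z.1.1 • toC z.2.1 + z.1.2 • toC z.2.2) 1)
      ((Metric.sphere 0 R ×ˢ Metric.sphere 0 R') ×ˢ (Metric.sphere 0 1 ×ˢ Metric.sphere 0 1)) := by
    refine (continuousOn_waveFun hk 1).comp (Continuous.continuousOn ?_) ?_
    · have := continuous_toC
      fun_prop
    · rintro ⟨⟨t, t'⟩, n, n'⟩ ⟨⟨ht, ht'⟩, hn, hn'⟩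
      exact hmem t t' n n' (le_of_eq (by simpa using ht)) (le_of_eq (by simpa using ht'))
        (by simpa using hn) (by simpa using hn')
  obtain ⟨M, hM⟩ := (((isCompact_sphere (0 : ℂ) R).prod (isCompact_sphere (0 : ℂ) R')).prod
    ((isCompact_sphere (0 : E3) 1).prod
      (isCompact_sphere (0 : E3) 1))).exists_bound_of_continuousOn hcont
  set M' := max M 0
  have hM0 : 0 ≤ M' := le_max_right _ _
  have hsf := isSphereFunctional_waveFun' hk (dot_toC_mem_slitPlane ha)
  have h1 : ∀ (l l' : ℕ) (n n' : E3), ‖n‖ = 1 → ‖n'‖ = 1 →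
      ‖waveFun k (toC a) (lin (toC n) ^ l * lin (toC n') ^ l')‖
        ≤ l.factorial * (l'.factorial * M' / (‖k‖ * R') ^ l') / (‖k‖ * R) ^ l := by
    intro l l' n n' hn hn'
    refine norm_waveFun_lin_pow_mul_le hk _ _ _ hR (fun t ht => ?_) (fun t ht => ?_) l
    · have := hmem t 0 n n' ht (by simpa using hR'.le) hn hn'
      simpa using this
    · have := norm_waveFun_lin_pow_mul_le hk (toC a + t • toC n) (toC n') 1 hR' (C := M')
        (fun t' ht' => hmem t t' n n' ht.le ht' hn hn') (fun t' ht' =>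
          (hM ((t, t'), (n, n')) ⟨⟨by simpa using ht, by simpa using ht'⟩, by simpa using hn,
            by simpa using hn'⟩).trans (le_max_left _ _)) l'
      rwa [mul_one] at this
  have h2 : ∀ (p : LM) (l' : ℕ) (n' : E3), ‖n'‖ = 1 →
      ‖waveFun k (toC a) (solid p * lin (toC n') ^ l')‖
        ≤ growth p.l * (l'.factorial * M' / (‖k‖ * R') ^ l' / (‖k‖ * R) ^ p.l) := by
    intro p l' n' hn'
    have h := norm_apply_solid_le (hsf.comp_mulRight (lin (toC n') ^ l')) p
      (B := l'.factorial * M' / (‖k‖ * R') ^ l' / (‖k‖ * R) ^ p.l) (fun n hn => by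
        have := h1 p.l l' n n' hn hn'
        rw [mul_div_assoc] at this
        simpa using this)
    simpa using h
  refine ⟨M', hM0, fun p p' => ?_⟩
  have h := norm_apply_solid_le (hsf.comp_mulRight (solid p)) p'
      (B := growth p.l * (M' / (‖k‖ * R') ^ p'.l / (‖k‖ * R) ^ p.l)) (fun n' hn' => by
        refine le_trans (le_of_eq ?_) ((h2 p p'.l n' hn').trans (le_of_eq ?_))
        · simp [mul_comm]
        · ring)
  simp only [LinearMap.comp_apply, LinearMap.mulRight_apply] at h
  rw [mul_comm (solid p)]
  refine h.trans (le_of_eq ?_)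
  ring

/-- Writing x = y² and using |m| ≤ l, one factor y^l is weakened to y^|m|, so the sum is dominated
by a product of independent sums over l and m. -/
lemma summable_LM {x : ℝ} (hx : 0 ≤ x) (hx1 : x < 1) (c : ℕ) :
    Summable fun p : LM => (2 * p.l + 1 : ℝ) ^ c * x ^ p.l := by
  set y := Real.sqrt x
  have hy0 : 0 ≤ y := Real.sqrt_nonneg x
  have hy1 : y < 1 := by rw [Real.sqrt_lt' one_pos]; simpa using hx1
  have hxy : x = y * y := (Real.mul_self_sqrt hx).symm
  have h1 : Summable fun l : ℕ => (2 * l + 1 : ℝ) ^ c * y ^ l := by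
    have h := (summable_pow_mul_geometric_of_norm_lt_one c
      (by rwa [Real.norm_of_nonneg hy0] : ‖y‖ < 1)).mul_left (3 ^ c)
    have h0 := (summable_geometric_of_lt_one hy0 hy1)
    refine Summable.of_nonneg_of_le (fun l => by positivity) (fun l => ?_) (h.add h0)
    rcases Nat.eq_zero_or_pos l with rfl | hl
    · simp
    · have hl' : (1 : ℝ) ≤ l := by exact_mod_cast hl
      have : (2 * l + 1 : ℝ) ^ c ≤ (3 * l) ^ c := by gcongr; linarith
      rw [mul_pow] at this
      have h3 := mul_le_mul_of_nonneg_right this (pow_nonneg hy0 l)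
      have := pow_nonneg hy0 l
      linarith
  have h2 : Summable fun m : ℤ => y ^ m.natAbs := by
    refine Summable.of_nat_of_neg ?_ ?_ <;> simpa using summable_geometric_of_lt_one hy0 hy1
  have h3 := (h1.mul_of_nonneg h2 (fun l => by positivity) (fun m => by positivity)).comp_injective
    (Subtype.val_injective (p := fun p : ℕ × ℤ => |p.2| ≤ (p.1 : ℤ)))
  refine Summable.of_nonneg_of_le (fun p => by positivity) (fun p => ?_) h3
  simp only [Function.comp_apply]
  change _ ≤ (2 * p.l + 1 : ℝ) ^ c * y ^ p.l * y ^ p.m.natAbs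
  rw [hxy, mul_pow, ← mul_assoc]
  exact mul_le_mul_of_nonneg_left (pow_le_pow_of_le_one hy0 hy1.le p.natAbs_le) (by positivity)

end SphericalWaves
end

/-! ### Regular waves and the translation theorem. -/

noncomputable section
namespace SphericalWaves
open Complex

lemma sphericalHarmonic_of_l_eq_zero {p : LM} (h : p.l = 0) (x y : E3) :
    sphericalHarmonic p x = sphericalHarmonic p y := by
  have hm : p.m = 0 := by have := p.natAbs_le; omega
  simp [sphericalHarmonic, harmonicNonneg, h, hm]

/-- Extends `eval_solid_real` to the origin, where the direction is meaningless: for l > 0 both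
sides vanish, and for l = 0 the harmonic is constant. -/
lemma norm_pow_mul_sphericalHarmonic (p : LM) (x : E3) :
    (‖x‖ : ℂ) ^ p.l * sphericalHarmonic p x = MvPolynomial.eval (toC x) (solid p) := by
  by_cases hx : x = 0
  · obtain ⟨n, hn, hxn⟩ := exists_unit_smul x
    rw [hxn, toC_smul, eval_solid_smul, eval_solid_unit _ _ hn, ← hxn]
    by_cases hl : p.l = 0
    · rw [sphericalHarmonic_of_l_eq_zero hl x n]
    · simp [hx, hl]
  · exact (eval_solid_real p x hx).symm

lemma doubleFactorial_odd_le (l j : ℕ) :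
    ((2 * l + 1).doubleFactorial : ℝ) ≤ (2 * l + 2 * j + 1).doubleFactorial := by
  have h : (2 * l + 1).doubleFactorial ≤ (2 * l + 2 * j + 1).doubleFactorial := by
    induction j with
    | zero => exact le_rfl
    | succ j ih =>
      rw [show 2 * l + 2 * (j + 1) + 1 = (2 * l + 2 * j + 1) + 2 by ring, Nat.doubleFactorial_add_two]
      exact ih.trans (Nat.le_mul_of_pos_left _ (by omega))
  exact_mod_cast h

lemma hasSum_sphericalBessel (l : ℕ) (z : ℂ) : HasSum (fun k : ℕ => (-1) ^ k * z ^ (l + 2 * k)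
    / (2 ^ k * (k.factorial : ℂ) * (Nat.doubleFactorial (2 * l + 2 * k + 1) : ℂ)))
    (sphericalBessel l z) ∧ ‖sphericalBessel l z‖
      ≤ ‖z‖ ^ l / (2 * l + 1).doubleFactorial * Real.exp (‖z‖ ^ 2 / 2) := by
  have hb : HasSum (fun j : ℕ => ‖z‖ ^ l / (2 * l + 1).doubleFactorial * ((‖z‖ ^ 2 / 2) ^ j / j.factorial))
      (‖z‖ ^ l / (2 * l + 1).doubleFactorial * Real.exp (‖z‖ ^ 2 / 2)) := by
    have h := NormedSpace.expSeries_div_hasSum_exp (𝔸 := ℝ) (‖z‖ ^ 2 / 2)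
    rw [← Real.exp_eq_exp_ℝ] at h
    exact h.mul_left _
  have hle : ∀ j : ℕ, ‖(-1) ^ j * z ^ (l + 2 * j)
    / (2 ^ j * (j.factorial : ℂ) * (Nat.doubleFactorial (2 * l + 2 * j + 1) : ℂ))‖
      ≤ ‖z‖ ^ l / (2 * l + 1).doubleFactorial * ((‖z‖ ^ 2 / 2) ^ j / j.factorial) := by
    intro j
    have hd := doubleFactorial_odd_le l j
    have hd0 : (0 : ℝ) < (2 * l + 1).doubleFactorial := by exact_mod_cast Nat.doubleFactorial_pos _
    have hj : (0 : ℝ) < j.factorial := by exact_mod_cast j.factorial_pos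
    simp only [norm_div, norm_mul, norm_pow, norm_neg, norm_one, one_pow, one_mul, Complex.norm_natCast,
      Complex.norm_ofNat]
    calc ‖z‖ ^ (l + 2 * j) / (2 ^ j * j.factorial * (2 * l + 2 * j + 1).doubleFactorial)
        ≤ ‖z‖ ^ (l + 2 * j) / (2 ^ j * j.factorial * (2 * l + 1).doubleFactorial) := by gcongr
      _ = _ := by rw [pow_add, pow_mul, div_pow]; field_simp
  have hs : Summable (fun k : ℕ => (-1) ^ k * z ^ (l + 2 * k)
    / (2 ^ k * (k.factorial : ℂ) * (Nat.doubleFactorial (2 * l + 2 * k + 1) : ℂ))) :=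
    Summable.of_norm_bounded hb.summable hle
  exact ⟨hs.hasSum, tsum_of_norm_bounded hb hle⟩

/-- The regular spherical wave `j_l(k|r|) Y_{lm}(r̂)`. -/
def regWave (k : ℂ) (r : E3) (p : LM) : ℂ :=
  sphericalBessel p.l (k * ‖r‖) * sphericalHarmonic p r

/-- The terms of the power series of `regWave`. -/
def regTerm (k : ℂ) (r : E3) (p : LM) (j : ℕ) : ℂ := (-1) ^ j * k ^ (p.l + 2 * j)
    * (‖r‖ : ℂ) ^ (2 * j) / (2 ^ j * (j.factorial : ℂ) * (Nat.doubleFactorial (2 * p.l + 2 * j + 1) : ℂ))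
    * MvPolynomial.eval (toC r) (solid p)

lemma hasSum_regWave (k : ℂ) (r : E3) (p : LM) : HasSum (regTerm k r p) (regWave k r p) := by
  have h := (hasSum_sphericalBessel p.l (k * ‖r‖)).1.mul_right (sphericalHarmonic p r)
  refine h.congr_fun fun j => ?_
  rw [regTerm, ← norm_pow_mul_sphericalHarmonic, mul_pow, pow_add (‖r‖ : ℂ)]
  ring

lemma norm_regTerm_le (k : ℂ) (r : E3) (q : LM) (j : ℕ) : ‖regTerm k r q j‖
    ≤ ‖k‖ ^ (q.l + 2 * j) * ‖r‖ ^ (2 * j)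
        / (2 ^ j * j.factorial * (2 * q.l + 1).doubleFactorial) * ((2 * q.l + 1) * ‖r‖ ^ q.l) := by
  have hd := doubleFactorial_odd_le q.l j
  have hd0 : (0 : ℝ) < (2 * q.l + 1).doubleFactorial := by exact_mod_cast Nat.doubleFactorial_pos _
  have hj : (0 : ℝ) < j.factorial := by exact_mod_cast j.factorial_pos
  simp only [regTerm, norm_div, norm_mul, norm_pow, norm_neg, norm_one, one_pow, one_mul,
    Complex.norm_natCast, Complex.norm_ofNat, Complex.norm_real, norm_norm]
  have := norm_eval_solid_le q r
  gcongr

lemma norm_regWave_le (k : ℂ) (r : E3) (p : LM) : ‖regWave k r p‖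
    ≤ (‖k‖ * ‖r‖) ^ p.l / (2 * p.l + 1).doubleFactorial * Real.exp ((‖k‖ * ‖r‖) ^ 2 / 2)
      * (2 * p.l + 1) := by
  have h1 := (hasSum_sphericalBessel p.l (k * ‖r‖)).2
  have h2 := norm_eval_solid_le p r
  rw [← norm_pow_mul_sphericalHarmonic, norm_mul, norm_pow, Complex.norm_real, norm_norm] at h2
  rw [norm_mul, Complex.norm_real, norm_norm] at h1
  rw [regWave, norm_mul]
  have hd0 : (0 : ℝ) < (2 * p.l + 1).doubleFactorial := by exact_mod_cast Nat.doubleFactorial_pos _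
  calc _ ≤ (‖k‖ * ‖r‖) ^ p.l / (2 * p.l + 1).doubleFactorial * Real.exp ((‖k‖ * ‖r‖) ^ 2 / 2)
      * ‖sphericalHarmonic p r‖ := mul_le_mul_of_nonneg_right h1 (norm_nonneg _)
    _ = ‖k‖ ^ p.l / (2 * p.l + 1).doubleFactorial * Real.exp ((‖k‖ * ‖r‖) ^ 2 / 2)
      * (‖r‖ ^ p.l * ‖sphericalHarmonic p r‖) := by rw [mul_pow]; ring
    _ ≤ ‖k‖ ^ p.l / (2 * p.l + 1).doubleFactorial * Real.exp ((‖k‖ * ‖r‖) ^ 2 / 2)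
      * ((2 * p.l + 1) * ‖r‖ ^ p.l) := by gcongr
    _ = _ := by rw [mul_pow]; ring

lemma solidBar_neg (p : LM) : solidBar p.neg = MvPolynomial.C ((-1) ^ p.m.natAbs) * solid p := by
  rw [solidBar, LM.neg_neg, LM.neg_m, Int.natAbs_neg]

lemma solid_neg (p : LM) : solid p.neg = MvPolynomial.C ((-1) ^ p.m.natAbs) * solidBar p := by
  rw [solidBar, ← mul_assoc, ← map_mul, ← mul_pow]; simp

/-- Reflection of the magnetic quantum number. -/
def LM.negEquiv : LM ≃ LM := Function.Involutive.toPerm LM.neg LM.neg_neg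

lemma hasSum_sphere_expansion_bar (Φ : Pol →ₗ[ℂ] ℂ) (hΦ : IsSphereFunctional Φ) (p : Pol) :
    HasSum (fun q : LM => sphInt (p * solid q) * Φ (solidBar q)) (Φ p) := by
  have h := (LM.negEquiv.hasSum_iff).2 (hasSum_sphere_expansion Φ hΦ p)
  refine h.congr_fun fun q => ?_
  have h1 : ((-1 : ℂ) ^ q.m.natAbs) * (-1) ^ q.m.natAbs = 1 := by rw [← mul_pow]; simp
  change _ = sphInt (p * solidBar q.neg) * Φ (solid q.neg)
  rw [solidBar_neg, solid_neg, mul_left_comm, sphInt_C_mul, ← MvPolynomial.smul_eq_C_mul, map_smul,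
    smul_eq_mul]
  linear_combination -(sphInt (p * solid q) * Φ (solidBar q)) * h1

lemma sphInt_lin_toC_pow_mul_solid (r : E3) (N : ℕ) (q : LM) : sphInt (lin (toC r) ^ N * solid q)
    = if q.l ≤ N then funkHecke N q.l * (‖r‖ : ℂ) ^ (N - q.l) * MvPolynomial.eval (toC r) (solid q)
      else 0 := by
  obtain ⟨n, hn, hx⟩ := exists_unit_smul r
  have hd : dot (toC n) (toC n) = 1 := by rw [dot_toC_self, hn]; simp
  have h1 : toC r = (‖r‖ : ℂ) • toC n := by
    conv_lhs => rw [hx]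
    rw [toC_smul]
  rw [h1, lin_smul, mul_pow, ← map_pow, mul_assoc, sphInt_C_mul, sphInt_lin_pow_mul_solid _ hd,
    eval_solid_smul]
  split_ifs with h
  · obtain ⟨d, rfl⟩ := Nat.exists_eq_add_of_le h
    rw [Nat.add_sub_cancel_left, pow_add]; ring
  · rw [funkHecke_of_lt (not_le.1 h)]; simp

lemma norm_waveFun_solidBar_mul (k : ℂ) (y : Fin 3 → ℂ) (q : LM) (s : Pol) :
    ‖waveFun k y (solidBar q * s)‖ = ‖waveFun k y (solid q.neg * s)‖ := by
  rw [solidBar, mul_assoc, ← MvPolynomial.smul_eq_C_mul, map_smul, norm_smul]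
  simp

/-- The (2l+1)!! in `growth` cancels the one in the denominator of the Bessel series. What remains
is a polynomial in l times (‖r‖/R)^l, with ‖r‖ < R < ‖a‖, and an exponential series in j. -/
lemma summable_regTerm_mul_waveFun {k : ℂ} (hk : k ≠ 0) {a r : E3} (h : ‖r‖ < ‖a‖) (s : Pol) :
    Summable fun z : LM × ℕ => 4 * Real.pi * I ^ z.1.l * regTerm k r z.1 z.2
      * waveFun k (toC a) (solidBar z.1 * s) := by
  have hk' : 0 < ‖k‖ := norm_pos_iff.2 hk
  obtain ⟨R, hrR, hRa⟩ := exists_between h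
  have hR0 : 0 < R := (norm_nonneg r).trans_lt hrR
  obtain ⟨M, hM0, hM⟩ := exists_waveFun_solid_bound hk hR0 hRa s
  have hx0 : 0 ≤ ‖r‖ / R := by positivity
  have hs := ((summable_LM hx0 ((div_lt_one hR0).2 hrR) 2).mul_left
    (4 * Real.pi * M * (Real.pi / 2))).mul_of_nonneg
    (Real.summable_pow_div_factorial ((‖k‖ * ‖r‖) ^ 2 / 2)) (fun p => by positivity)
    (fun j => by positivity)
  refine Summable.of_norm_bounded hs ?_
  rintro ⟨q, j⟩
  have h1 : ‖waveFun k (toC a) (solidBar q * s)‖ ≤ M * (growth q.l / (‖k‖ * R) ^ q.l) :=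
    (norm_waveFun_solidBar_mul k _ q s).trans_le (hM q.neg)
  have hd0 : (0 : ℝ) < (2 * q.l + 1).doubleFactorial := by exact_mod_cast Nat.doubleFactorial_pos _
  have hj : (0 : ℝ) < j.factorial := by exact_mod_cast j.factorial_pos
  have h2 := norm_regTerm_le k r q j
  simp only [norm_mul, norm_pow, norm_I, one_pow, mul_one, Complex.norm_ofNat,
    Complex.norm_real, Real.norm_of_nonneg Real.pi_pos.le]
  calc 4 * Real.pi * ‖regTerm k r q j‖ * ‖waveFun k (toC a) (solidBar q * s)‖
      ≤ 4 * Real.pi * (‖k‖ ^ (q.l + 2 * j) * ‖r‖ ^ (2 * j)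
      / (2 ^ j * j.factorial * (2 * q.l + 1).doubleFactorial) * ((2 * q.l + 1) * ‖r‖ ^ q.l))
        * (M * (growth q.l / (‖k‖ * R) ^ q.l)) := by gcongr
    _ = 4 * Real.pi * M * (Real.pi / 2) * ((2 * q.l + 1) ^ 2 * (‖r‖ / R) ^ q.l)
        * (((‖k‖ * ‖r‖) ^ 2 / 2) ^ j / j.factorial) := by
      rw [growth_eq, pow_add, pow_mul ‖k‖, pow_mul ‖r‖, div_pow, div_pow, mul_pow ‖k‖ R,
        mul_pow ‖k‖ ‖r‖, mul_pow (‖k‖ ^ 2)]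
      field_simp

lemma hasSum_waveFun_taylor_real {k : ℂ} (hk : k ≠ 0) {a r : E3} (h : ‖r‖ < ‖a‖) (s : Pol) :
    HasSum (fun N : ℕ => (I * k) ^ N / N.factorial * waveFun k (toC a) (lin (toC r) ^ N * s))
      (waveFun k (toC (a + r)) s) := by
  obtain ⟨R, hrR, hRa⟩ := exists_between h
  have hR0 : 0 < R := (norm_nonneg r).trans_lt hrR
  rw [toC_add]
  refine hasSum_waveFun_taylor hk (toC a) (toC r) s (ρ := ‖a‖ / R) ((one_lt_div hR0).2 hRa)
    (fun t ht => ?_)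
  have h1 : ‖t‖ * R < ‖a‖ := (lt_div_iff₀ hR0).1 ht
  have h2 : ‖t‖ * ‖r‖ ≤ ‖t‖ * R := mul_le_mul_of_nonneg_left hrR.le (norm_nonneg t)
  have := dot_mem_slitPlane a r 0 t 0 (by simp; linarith)
  simpa using this

/-- The harmonic component of degree l of exp(ik n·r), taken order by order, is the power series of
4π i^l j_l: Rayleigh's plane wave expansion. -/
lemma taylor_coeff_eq_regTerm (k : ℂ) (r : E3) (q : LM) (j : ℕ) :
    (I * k) ^ (q.l + 2 * j) / (q.l + 2 * j).factorial * sphInt (lin (toC r) ^ (q.l + 2 * j) * solid q)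
      = 4 * Real.pi * I ^ q.l * regTerm k r q j := by
  rw [sphInt_lin_toC_pow_mul_solid, if_pos (by omega), funkHecke_add, Nat.add_sub_cancel_left, regTerm]
  have h1 : ((q.l + 2 * j).factorial : ℂ) ≠ 0 := by exact_mod_cast Nat.factorial_ne_zero _
  have h2 : ((I * k) ^ (q.l + 2 * j)) = I ^ q.l * (-1) ^ j * k ^ (q.l + 2 * j) := by
    rw [mul_pow, pow_add I, pow_mul, I_sq]
  rw [h2]
  push_cast
  field_simp

lemma sphInt_lin_pow_mul_solid_eq_zero (r : E3) (q : LM) (N : ℕ) (h : ∀ j, N ≠ q.l + 2 * j) :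
    sphInt (lin (toC r) ^ N * solid q) = 0 := by
  have : funkHecke N q.l = 0 := by
    rw [funkHecke, if_neg]
    rintro ⟨h1, j, h2⟩
    exact h j (by omega)
  rw [sphInt_lin_toC_pow_mul_solid, this]; simp

/-- Expansion of the functional at a translated point in regular spherical waves. -/
theorem hasSum_waveFun_translate {k : ℂ} (hk : k ≠ 0) {a r : E3} (h : ‖r‖ < ‖a‖) (s : Pol) :
    HasSum (fun q : LM => 4 * Real.pi * I ^ q.l * regWave k r q * waveFun k (toC a) (solidBar q * s))
      (waveFun k (toC (a + r)) s) := by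
  have ha : a ≠ 0 := norm_pos_iff.1 ((norm_nonneg r).trans_lt h)
  obtain ⟨G, hG⟩ : ∃ G : LM × ℕ → ℂ, G = fun z => (I * k) ^ z.2 / z.2.factorial *
    (sphInt (lin (toC r) ^ z.2 * solid z.1) * waveFun k (toC a) (solidBar z.1 * s)) := ⟨_, rfl⟩
  have hN : ∀ N : ℕ, HasSum (fun q => G (q, N))
      ((I * k) ^ N / N.factorial * waveFun k (toC a) (lin (toC r) ^ N * s)) := fun N => by
    have h1 := hasSum_sphere_expansion_bar _ ((isSphereFunctional_waveFun' hk
      (dot_toC_mem_slitPlane ha)).comp_mulRight s) (lin (toC r) ^ N)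
    simp only [LinearMap.comp_apply, LinearMap.mulRight_apply] at h1
    rw [hG]
    exact h1.mul_left ((I * k) ^ N / N.factorial)
  have he_inj : Function.Injective (fun z : LM × ℕ => (z.1, z.1.l + 2 * z.2)) := by
    rintro ⟨q, j⟩ ⟨q', j'⟩ h
    simp only [Prod.mk.injEq] at h
    obtain ⟨rfl, h⟩ := h
    simp; omega
  have hFsum := summable_regTerm_mul_waveFun hk h s
  obtain ⟨S, hS⟩ := hFsum
  -- A power N of the linear form has no component of degree l unless N = l + 2j, so pairs (q, N)
  -- may replace pairs (q, j).
  have hGsum : HasSum G S := by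
    rw [← he_inj.hasSum_iff]
    · refine hS.congr_fun fun z => ?_
      rw [Function.comp_apply, hG, ← taylor_coeff_eq_regTerm, mul_assoc]
    · rintro ⟨q, N⟩ hz
      rw [hG]
      simp only
      rw [sphInt_lin_pow_mul_solid_eq_zero r q N, zero_mul, mul_zero]
      rintro j rfl
      exact hz ⟨(q, j), rfl⟩
  -- Summed over q first, the family is the Taylor series in N; summed over j first, it is the
  -- series of regular waves. Summability of the whole family permits the exchange.
  have htot : S = waveFun k (toC (a + r)) s := by
    have h1 := (Equiv.prodComm ℕ LM).hasSum_iff.2 hGsum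
    have h2 := h1.prod_fiberwise hN
    exact h2.unique (hasSum_waveFun_taylor_real hk h s)
  rw [← htot]
  have h3 : ∀ q : LM, HasSum (fun j => 4 * Real.pi * I ^ q.l * regTerm k r q j
      * waveFun k (toC a) (solidBar q * s))
      (4 * Real.pi * I ^ q.l * regWave k r q * waveFun k (toC a) (solidBar q * s)) := fun q =>
    ((hasSum_regWave k r q).mul_left (4 * Real.pi * I ^ q.l)).mul_right _
  exact hS.prod_fiberwise h3

end SphericalWaves
end

/-! ### The expansion of the propagator at complex frequency. -/

noncomputable section
namespace SphericalWaves
open Complex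

/-- The Gaunt coefficients are 4π times the coefficients of Y_{lm} Y_{l'm'}^* in spherical
harmonics, and the Hankel waves at a are the values of the functional on these harmonics. -/
lemma transferCoeff_eq {k : ℂ} (hk : k ≠ 0) {a : E3} (ha : a ≠ 0) (p p' : LM) : transferCoeff k a p p'
    = -(I * Real.pi / (2 * k)) * (4 * Real.pi * I ^ ((p'.l : ℤ) - p.l)
      * waveFun k (toC a) (solidBar p' * solid p)) := by
  have h := (hasSum_sphere_expansion _ (isSphereFunctional_waveFun' hk
    (dot_toC_mem_slitPlane ha)) (solid p * solidBar p')).mul_left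
      (4 * Real.pi * I ^ ((p'.l : ℤ) - p.l))
  rw [transferCoeff]
  congr 1
  rw [mul_comm (solidBar p'), ← h.tsum_eq]
  refine tsum_congr fun q => ?_
  rw [gauntC_eq_sphInt, waveFun_solid_real hk ha,
    show (q.l : ℤ) + p'.l - p.l = ((p'.l : ℤ) - p.l) + q.l by ring, zpow_add₀ I_ne_zero, zpow_natCast]
  ring

lemma freePropagator_eq {k : ℂ} (hk : k ≠ 0) {x y : E3} (h : y - x ≠ 0) :
    freePropagator k x y = -(I * k / (4 * Real.pi)) * waveFun k (toC (y - x)) 1 := by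
  have hn : (‖y - x‖ : ℂ) ≠ 0 := by exact_mod_cast norm_ne_zero_iff.2 h
  rw [waveFun_one, dot_toC_self, freePropagator, norm_sub_rev x y]
  have : ((‖y - x‖ : ℂ) ^ 2) ^ (1 / 2 : ℂ) = ‖y - x‖ := by
    have h := Complex.ofReal_cpow (x := ‖y - x‖ ^ 2) (by positivity) (1 / 2)
    rw [← Real.sqrt_eq_rpow, Real.sqrt_sq (norm_nonneg _)] at h
    push_cast at h; exact h.symm
  rw [this, hankelRed_zero, ← mul_assoc I k]
  have hpi : (Real.pi : ℂ) ≠ 0 := by exact_mod_cast Real.pi_ne_zero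
  field_simp
  linear_combination -I_sq

lemma regWave_neg (k : ℂ) (r : E3) (p : LM) : regWave k (-r) p = (-1) ^ p.l * regWave k r p := by
  refine (hasSum_regWave k (-r) p).unique (((hasSum_regWave k r p).mul_left _).congr_fun fun j => ?_)
  rw [regTerm, regTerm, norm_neg, show toC (-r) = (-1 : ℂ) • toC r by rw [toC_neg]; simp,
    eval_solid_smul]
  ring

/-- The wave conjugate to `regWave` at real frequency. -/
def regWaveBar (k : ℂ) (r : E3) (p : LM) : ℂ :=
  sphericalBessel p.l (k * ‖r‖) * (starRingEnd ℂ) (sphericalHarmonic p r)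

lemma regWaveBar_eq (k : ℂ) (r : E3) (p : LM) :
    regWaveBar k r p = (-1) ^ p.m.natAbs * regWave k r p.neg := by
  rw [regWaveBar, conj_sphericalHarmonic, regWave, LM.neg_l]; ring

/-- The terms of the expansion at complex frequency `k`. -/
def waveTerm (k : ℂ) (a r r' : E3) (p p' : LM) : ℂ :=
  2 * k ^ 2 / Real.pi * regWave k r' p' * transferCoeff k a p p' * regWaveBar k r p

lemma waveTerm_eq {k : ℂ} (hk : k ≠ 0) {a : E3} (ha : a ≠ 0) (r r' : E3) (p p' : LM) :
    waveTerm k a r r' p p' = -(4 * Real.pi * I * k) * I ^ ((p'.l : ℤ) - p.l) * regWave k r' p'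
      * waveFun k (toC a) (solidBar p' * solid p) * regWaveBar k r p := by
  have hpi : (Real.pi : ℂ) ≠ 0 := by exact_mod_cast Real.pi_ne_zero
  rw [waveTerm, transferCoeff_eq hk ha]
  field_simp

lemma hasSum_waveTerm_inner {k : ℂ} (hk : k ≠ 0) {a r' : E3} (h : ‖r'‖ < ‖a‖) (r : E3) (p : LM) :
    HasSum (fun p' => waveTerm k a r r' p p')
      (-(I * k) * I ^ (-(p.l : ℤ)) * regWaveBar k r p * waveFun k (toC (a + r')) (solid p)) := by
  have ha : a ≠ 0 := norm_pos_iff.1 ((norm_nonneg r').trans_lt h)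
  refine ((hasSum_waveFun_translate hk h (solid p)).mul_left _).congr_fun fun p' => ?_
  rw [waveTerm_eq hk ha, sub_eq_add_neg, zpow_add₀ I_ne_zero, zpow_natCast]
  ring

/-- Translation by -r with `s = 1`: the parity (-1)^l of the reflected wave turns i^l into i^(-l),
and relabelling m ↦ -m exchanges conjugate and plain harmonics. -/
lemma hasSum_waveTerm_outer {k : ℂ} (hk : k ≠ 0) {b r : E3} (h : ‖r‖ < ‖b‖) :
    HasSum (fun p : LM => -(I * k) * I ^ (-(p.l : ℤ)) * regWaveBar k r p * waveFun k (toC b) (solid p))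
      (-(I * k / (4 * Real.pi)) * waveFun k (toC (b - r)) 1) := by
  have h1 := hasSum_waveFun_translate hk (a := b) (r := -r) (by rwa [norm_neg]) 1
  rw [← sub_eq_add_neg] at h1
  have h2 := ((LM.negEquiv.hasSum_iff).2 h1).mul_left (-(I * k / (4 * Real.pi)))
  have hpi : (Real.pi : ℂ) ≠ 0 := by exact_mod_cast Real.pi_ne_zero
  refine h2.congr_fun fun p => ?_
  change _ = -(I * k / (4 * Real.pi)) * (4 * Real.pi * I ^ p.l * regWave k (-r) p.neg
    * waveFun k (toC b) (solidBar p.neg * 1))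
  rw [regWaveBar_eq, regWave_neg, mul_one, solidBar_neg, ← MvPolynomial.smul_eq_C_mul, map_smul,
    LM.neg_l, smul_eq_mul, zpow_neg, zpow_natCast, ← inv_pow, inv_I,
    show (-I) ^ p.l = (-1) ^ p.l * I ^ p.l by rw [← mul_pow]; simp]
  field_simp

lemma norm_regWaveBar (k : ℂ) (r : E3) (p : LM) : ‖regWaveBar k r p‖ = ‖regWave k r p‖ := by
  rw [regWaveBar, regWave, norm_mul, norm_mul, RCLike.norm_conj]

lemma norm_regWave_mul_growth_le {k : ℂ} (hk : k ≠ 0) (r : E3) {R : ℝ} (hR : 0 < R) (p : LM) :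
    ‖regWave k r p‖ * (growth p.l / (‖k‖ * R) ^ p.l)
      ≤ Real.pi / 2 * Real.exp ((‖k‖ * ‖r‖) ^ 2 / 2) * ((2 * p.l + 1) ^ 2 * (‖r‖ / R) ^ p.l) := by
  have hk' : 0 < ‖k‖ := norm_pos_iff.2 hk
  have hg := growth_nonneg p.l
  have hd0 : (0 : ℝ) < (2 * p.l + 1).doubleFactorial := by exact_mod_cast Nat.doubleFactorial_pos _
  refine (mul_le_mul_of_nonneg_right (norm_regWave_le k r p) (by positivity)).trans (le_of_eq ?_)
  rw [growth_eq, mul_pow ‖k‖ R, mul_pow ‖k‖ ‖r‖ p.l, div_pow]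
  field_simp

lemma summable_waveTerm {k : ℂ} (hk : k ≠ 0) {a r r' : E3} (h : ‖r‖ + ‖r'‖ < ‖a‖) :
    Summable fun q : LM × LM => waveTerm k a r r' q.1 q.2 := by
  have hk' : 0 < ‖k‖ := norm_pos_iff.2 hk
  have hr := norm_nonneg r
  have hr' := norm_nonneg r'
  have ha : a ≠ 0 := norm_pos_iff.1 (by linarith)
  -- A third of the slack enlarges each radius, and the last third keeps the sum of the enlarged
  -- radii strictly below ‖a‖.
  set d := (‖a‖ - ‖r‖ - ‖r'‖) / 3 with hd
  have hd0 : 0 < d := by rw [hd]; linarith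
  have hR : 0 < ‖r‖ + d := by linarith
  have hR' : 0 < ‖r'‖ + d := by linarith
  obtain ⟨M, hM0, hM⟩ := exists_waveFun_solid_mul_solid_bound hk (a := a) hR' hR (by rw [hd]; linarith)
  have h1 : Summable fun p : LM => ‖regWave k r p‖ * (growth p.l / (‖k‖ * (‖r‖ + d)) ^ p.l) := by
    refine Summable.of_nonneg_of_le (fun p => mul_nonneg (norm_nonneg _)
      (div_nonneg (growth_nonneg _) (by positivity))) (norm_regWave_mul_growth_le hk r hR)
      ((summable_LM (by positivity) ((div_lt_one hR).2 (by linarith)) 2).mul_left _)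
  have h2 : Summable fun p : LM => ‖regWave k r' p‖ * (growth p.l / (‖k‖ * (‖r'‖ + d)) ^ p.l) := by
    refine Summable.of_nonneg_of_le (fun p => mul_nonneg (norm_nonneg _)
      (div_nonneg (growth_nonneg _) (by positivity))) (norm_regWave_mul_growth_le hk r' hR')
      ((summable_LM (by positivity) ((div_lt_one hR').2 (by linarith)) 2).mul_left _)
  have h3 := (h1.mul_of_nonneg h2 (fun p => mul_nonneg (norm_nonneg _)
      (div_nonneg (growth_nonneg _) (by positivity))) (fun p => mul_nonneg (norm_nonneg _)
      (div_nonneg (growth_nonneg _) (by positivity)))).mul_left (4 * Real.pi * ‖k‖ * M)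
  refine Summable.of_norm_bounded h3 ?_
  rintro ⟨p, p'⟩
  rw [waveTerm_eq hk ha]
  simp only [norm_mul, norm_neg, norm_zpow, norm_I, one_zpow, mul_one, Complex.norm_ofNat,
    Complex.norm_real, Real.norm_of_nonneg Real.pi_pos.le, norm_regWaveBar,
    norm_waveFun_solidBar_mul]
  have h4 := hM p'.neg p
  rw [LM.neg_l] at h4
  calc _ ≤ 4 * Real.pi * ‖k‖ * ‖regWave k r' p'‖ * (M * (growth p'.l / (‖k‖ * (‖r'‖ + d)) ^ p'.l
      * (growth p.l / (‖k‖ * (‖r‖ + d)) ^ p.l))) * ‖regWave k r p‖ := by gcongr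
    _ = _ := by ring

/-- The expansion of the free propagator as an iterated series. -/
theorem hasSum_waveTerm_iterated {k : ℂ} (hk : k ≠ 0) {PA PB x y : E3} (h1 : ‖y - PB‖ < ‖PB - PA‖)
    (h2 : ‖x - PA‖ < ‖y - PA‖) :
    (∀ p : LM, Summable fun p' => waveTerm k (PB - PA) (x - PA) (y - PB) p p') ∧
    HasSum (fun p : LM => ∑' p', waveTerm k (PB - PA) (x - PA) (y - PB) p p') (freePropagator k x y) := by
  have h3 := fun p => hasSum_waveTerm_inner hk h1 (x - PA) p
  have h4 := hasSum_waveTerm_outer hk h2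
  have hxy : y - x ≠ 0 := by
    intro h
    rw [sub_eq_zero.1 h] at h2
    exact lt_irrefl _ h2
  refine ⟨fun p => (h3 p).summable, ?_⟩
  rw [freePropagator_eq hk hxy]
  rw [sub_sub_sub_cancel_right] at h4
  refine h4.congr_fun fun p => ?_
  rw [(h3 p).tsum_eq, show PB - PA + (y - PB) = y - PA by abel]

/-- The expansion of the free propagator as a double series. -/
theorem hasSum_waveTerm {k : ℂ} (hk : k ≠ 0) {PA PB x y : E3}
    (h : ‖x - PA‖ + ‖y - PB‖ < ‖PB - PA‖) :
    HasSum (fun q : LM × LM => waveTerm k (PB - PA) (x - PA) (y - PB) q.1 q.2)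
      (freePropagator k x y) := by
  have hs := summable_waveTerm hk h
  have h1 : ‖y - PB‖ < ‖PB - PA‖ := by have := norm_nonneg (x - PA); linarith
  have h2 : ‖x - PA‖ < ‖y - PA‖ := by
    have := norm_sub_norm_le (PB - PA) (PB - y)
    rw [sub_sub_sub_cancel_left, norm_sub_rev PB y] at this
    linarith
  obtain ⟨h3, h4⟩ := hasSum_waveTerm_iterated hk h1 h2
  -- Summability of the double family is already known, so its sum must be that of the iterated
  -- series.
  have h5 := hs.hasSum.prod_fiberwise fun p => (h3 p).hasSum
  rw [← h5.unique h4]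
  exact hs.hasSum

lemma conj_sphericalBessel_ofReal (l : ℕ) (x : ℝ) :
    (starRingEnd ℂ) (sphericalBessel l x) = sphericalBessel l x := by
  rw [sphericalBessel, Complex.conj_tsum]
  refine tsum_congr fun j => ?_
  simp [← Complex.ofReal_pow, map_ofNat (starRingEnd ℂ) 2]

lemma expansionTerm_eq (ω : ℝ) (PA PB x y : E3) (p p' : LM) :
    expansionTerm ω PA PB x y p p' = waveTerm ω (PB - PA) (x - PA) (y - PB) p p' := by
  have h : ((Real.sqrt (2 * ω ^ 2 / Real.pi) : ℝ) : ℂ) * ((Real.sqrt (2 * ω ^ 2 / Real.pi) : ℝ) : ℂ)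
      = 2 * ω ^ 2 / Real.pi := by
    rw [← Complex.ofReal_mul, Real.mul_self_sqrt (by positivity)]; push_cast; rfl
  have h2 := conj_sphericalBessel_ofReal p.l (ω * ‖x - PA‖)
  push_cast at h2
  rw [expansionTerm, waveTerm, sphericalWave, sphericalWave, map_mul, map_mul, Complex.conj_ofReal, h2,
    regWave, regWaveBar, ← h]
  ring

lemma wickTerm_eq (ω : ℝ) (PA PB x y : E3) (p p' : LM) :
    wickTerm ω PA PB x y p p' = waveTerm (I * ω) (PB - PA) (x - PA) (y - PB) p p' := rfl

end SphericalWaves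
end

/-! ### Wick rotation: modified Bessel functions, and reality of the coefficients. -/

noncomputable section
namespace SphericalWaves
open Complex

lemma cosh_eq_one_add (t : ℝ) : Real.cosh t = 1 + 2 * Real.sinh (t / 2) ^ 2 := by
  have h := Real.cosh_two_mul (t / 2)
  have h2 := Real.cosh_sq (t / 2)
  rw [show 2 * (t / 2) = t by ring] at h
  linarith

/-- From cosh t ≥ t²/2 the exponent is at most -x t²/2 + |ν| t; completing the square with |ν| + 1
leaves a spare factor exp(-t). -/
lemma exp_mul_cosh_le (ν : ℝ) {x t : ℝ} (hx : 0 < x) (ht : 0 ≤ t) :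
    Real.exp (-x * Real.cosh t) * Real.cosh (ν * t)
      ≤ Real.exp ((|ν| + 1) ^ 2 / (2 * x)) * Real.exp (-1 * t) := by
  have h1 : t ^ 2 / 2 ≤ Real.cosh t := by
    have := Real.self_le_sinh_iff.2 (show 0 ≤ t / 2 by positivity)
    rw [cosh_eq_one_add]
    nlinarith [show 0 ≤ t / 2 by positivity]
  have h2 : Real.cosh (ν * t) ≤ Real.exp (|ν| * t) := by
    rw [← Real.cosh_abs, abs_mul, abs_of_nonneg ht, Real.cosh_eq]
    have : Real.exp (-(|ν| * t)) ≤ Real.exp (|ν| * t) := Real.exp_le_exp.2 (by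
      have : 0 ≤ |ν| * t := by positivity
      linarith)
    linarith
  calc _ ≤ Real.exp (-x * Real.cosh t) * Real.exp (|ν| * t) := by gcongr
    _ = Real.exp (-x * Real.cosh t + |ν| * t) := (Real.exp_add _ _).symm
    _ ≤ Real.exp ((|ν| + 1) ^ 2 / (2 * x) + -1 * t) := by
      apply Real.exp_le_exp.2
      have h3 : (|ν| + 1) ^ 2 / (2 * x) - (|ν| + 1) * t + x * (t ^ 2 / 2)
          = (|ν| + 1 - x * t) ^ 2 / (2 * x) := by field_simp; ring
      have h4 : 0 ≤ (|ν| + 1 - x * t) ^ 2 / (2 * x) := by positivity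
      nlinarith
    _ = _ := Real.exp_add _ _

lemma isBigO_exp_mul_cosh (ν : ℝ) {x : ℝ} (hx : 0 < x) :
    (fun t => Real.exp (-x * Real.cosh t) * Real.cosh (ν * t)) =O[Filter.atTop]
      fun t => Real.exp (-1 * t) := by
  refine Asymptotics.IsBigO.of_bound (Real.exp ((|ν| + 1) ^ 2 / (2 * x))) ?_
  filter_upwards [Filter.eventually_ge_atTop (0 : ℝ)] with t ht
  rw [Real.norm_of_nonneg (by have := Real.cosh_pos (ν * t); positivity),
    Real.norm_of_nonneg (by positivity)]
  exact exp_mul_cosh_le ν hx ht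

lemma integrableOn_exp_mul_cosh (ν : ℝ) {x : ℝ} (hx : 0 < x) : MeasureTheory.IntegrableOn
    (fun t => Real.exp (-x * Real.cosh t) * Real.cosh (ν * t)) (Set.Ioi 0) :=
  integrable_of_isBigO_exp_neg one_pos
    (Continuous.continuousOn (by have := Real.continuous_cosh; fun_prop)) (isBigO_exp_mul_cosh ν hx)

/-- Integrate the derivative of exp(-x cosh t) sinh(νt) over (0, ∞); both boundary values vanish. -/
lemma besselK_add_one (ν : ℝ) {x : ℝ} (hx : 0 < x) :
    besselK (ν + 1) x = besselK (ν - 1) x + 2 * ν / x * besselK ν x := by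
  have hd : ∀ t ∈ Set.Ici (0 : ℝ), HasDerivAt (fun t => Real.exp (-x * Real.cosh t) * Real.sinh (ν * t))
      (-(x / 2) * (Real.exp (-x * Real.cosh t) * Real.cosh ((ν + 1) * t))
        + x / 2 * (Real.exp (-x * Real.cosh t) * Real.cosh ((ν - 1) * t))
        + ν * (Real.exp (-x * Real.cosh t) * Real.cosh (ν * t))) t := by
    intro t _
    have h1 := ((Real.hasDerivAt_cosh t).const_mul (-x)).exp
    have h2 := ((hasDerivAt_id t).const_mul ν).sinh
    refine (h1.mul h2).congr_deriv ?_
    rw [add_mul, sub_mul, one_mul, Real.cosh_add, Real.cosh_sub]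
    simp only [id]
    ring
  have i1 := (integrableOn_exp_mul_cosh (ν + 1) hx).const_mul (-(x / 2))
  have i2 := (integrableOn_exp_mul_cosh (ν - 1) hx).const_mul (x / 2)
  have i3 := (integrableOn_exp_mul_cosh ν hx).const_mul ν
  have hlim : Filter.Tendsto (fun t => Real.exp (-x * Real.cosh t) * Real.sinh (ν * t)) Filter.atTop
      (nhds 0) := by
    have h1 : Filter.Tendsto (fun t : ℝ => Real.exp (-1 * t)) Filter.atTop (nhds 0) := by
      simpa using Real.tendsto_exp_neg_atTop_nhds_zero
    have h2 := (isBigO_exp_mul_cosh ν hx).trans_tendsto h1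
    refine squeeze_zero_norm (fun t => ?_) h2
    rw [norm_mul, Real.norm_of_nonneg (Real.exp_pos _).le]
    gcongr
    rw [Real.norm_eq_abs, Real.abs_sinh, ← Real.cosh_abs]
    exact (Real.sinh_lt_cosh _).le
  have h := MeasureTheory.integral_Ioi_of_hasDerivAt_of_tendsto' hd ((i1.add i2).add i3) hlim
  have e1 := MeasureTheory.integral_add (i1.add i2) i3
  have e2 := MeasureTheory.integral_add i1 i2
  simp only [Pi.add_apply] at e1 e2
  rw [e1, e2, MeasureTheory.integral_const_mul, MeasureTheory.integral_const_mul,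
    MeasureTheory.integral_const_mul] at h
  simp only [mul_zero, Real.sinh_zero, sub_zero] at h
  have h' : -(x / 2) * besselK (ν + 1) x + x / 2 * besselK (ν - 1) x + ν * besselK ν x = 0 := h
  field_simp
  linarith

lemma besselK_neg (ν x : ℝ) : besselK (-ν) x = besselK ν x := by
  simp only [besselK, neg_mul, Real.cosh_neg]

/-- The substitution u = sinh(t/2), with cosh t = 1 + 2u², turns the integral into a Gaussian. -/
lemma besselK_half {x : ℝ} (hx : 0 < x) :
    besselK (1 / 2) x = Real.sqrt (Real.pi / (2 * x)) * Real.exp (-x) := by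
  have h := MeasureTheory.integral_comp_mul_deriv_Ioi (a := 0) (f := fun t => Real.sinh (t / 2))
    (f' := fun t => Real.cosh (t / 2) * (1 / 2)) (g := fun u => Real.exp (-(2 * x) * u ^ 2))
    (by have := Real.continuous_sinh; fun_prop) ?_ ?_ (by fun_prop)
    (integrable_exp_neg_mul_sq (by positivity)).integrableOn ?_
  · simp only [zero_div, Real.sinh_zero, Function.comp_apply, integral_gaussian_Ioi] at h
    have e : ∀ t, Real.exp (-x * Real.cosh t) * Real.cosh (1 / 2 * t) = 2 * Real.exp (-x)
        * (Real.exp (-(2 * x) * Real.sinh (t / 2) ^ 2) * (Real.cosh (t / 2) * (1 / 2))) := by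
      intro t
      rw [cosh_eq_one_add t, show -x * (1 + 2 * Real.sinh (t / 2) ^ 2)
        = -x + -(2 * x) * Real.sinh (t / 2) ^ 2 by ring, Real.exp_add, show 1 / 2 * t = t / 2 by ring]
      ring
    simp only [besselK, e]
    rw [MeasureTheory.integral_const_mul, h]
    ring
  · refine Filter.tendsto_atTop_mono' _ ?_ (Filter.tendsto_id.atTop_div_const (show (0 : ℝ) < 2 by norm_num))
    filter_upwards [Filter.eventually_ge_atTop (0 : ℝ)] with t ht
    exact Real.self_le_sinh_iff.2 (by positivity)
  · intro t _
    have := ((hasDerivAt_id t).div_const 2).sinh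
    exact this.hasDerivWithinAt
  · rw [integrableOn_Ici_iff_integrableOn_Ioi]
    have h := (integrableOn_exp_mul_cosh (1 / 2) hx).const_mul (1 / 2 * Real.exp x)
    refine MeasureTheory.IntegrableOn.congr_fun h (fun t _ => ?_) measurableSet_Ioi
    simp only [Function.comp_apply]
    rw [cosh_eq_one_add t, show -x * (1 + 2 * Real.sinh (t / 2) ^ 2)
        = -x + -(2 * x) * Real.sinh (t / 2) ^ 2 by ring, Real.exp_add, show 1 / 2 * t = t / 2 by ring,
        Real.exp_neg]
    have := (Real.exp_pos x).ne'
    field_simp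

lemma besselCoeff_three_term (l k : ℕ) :
    besselCoeff (l + 2) (k + 1) = besselCoeff l (k + 1) + (2 * l + 3) * besselCoeff (l + 1) k := by
  have h : (k + 1 + l : ℂ) * besselCoeff l k = (l + 1 - k) * besselCoeff (l + 1) k := by
    by_cases hk : k ≤ l
    · obtain ⟨d, rfl⟩ := Nat.exists_eq_add_of_le hk
      rw [besselCoeff, besselCoeff, if_pos hk, if_pos (by omega), Nat.add_sub_cancel_left,
        show k + d + 1 - k = d + 1 by omega, show k + d + 1 + k = (k + d + k) + 1 by ring,
        Nat.factorial_succ (k + d + k), Nat.factorial_succ d]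
      have n1 : ∀ n : ℕ, (n.factorial : ℂ) ≠ 0 := fun n => by exact_mod_cast n.factorial_ne_zero
      have := n1 k; have := n1 d
      have h2 : (d + 1 : ℂ) ≠ 0 := by exact_mod_cast d.succ_ne_zero
      push_cast
      field_simp
      ring
    · rw [besselCoeff_of_lt (not_le.1 hk)]
      rcases (show l + 1 ≤ k by omega).eq_or_lt with h | h
      · rw [← h]; push_cast; ring
      · rw [besselCoeff_of_lt h]; ring
  rw [besselCoeff_succ_succ (l + 1), besselCoeff_succ_succ l, h]
  push_cast; ring

/-- The outgoing spherical Hankel function at imaginary argument. -/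
lemma hankel_imaginary (l : ℕ) (x : ℝ) : I ^ l * sphericalHankel l (I * x)
    = -exp (-x) * ∑ k ∈ Finset.range (l + 1), besselCoeff l k * ((x : ℂ) ^ (k + 1))⁻¹ := by
  rw [sphericalHankel_eq, Finset.mul_sum, Finset.mul_sum]
  refine Finset.sum_congr rfl fun k _ => ?_
  rw [show I * (I * x) = -(x : ℂ) by linear_combination (x : ℂ) * I_sq, mul_pow, mul_inv]
  have h : I ^ l * I ^ ((k : ℤ) - l - 1) * (I ^ (k + 1))⁻¹ = -1 := by
    rw [← zpow_natCast, ← zpow_natCast, ← zpow_neg, ← zpow_add₀ I_ne_zero, ← zpow_add₀ I_ne_zero,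
      show (l : ℤ) + ((k : ℤ) - l - 1) + -((k + 1 : ℕ) : ℤ) = -2 by push_cast; ring, zpow_neg,
      show (2 : ℤ) = ((2 : ℕ) : ℤ) from rfl, zpow_natCast, I_sq]
    norm_num
  linear_combination (besselCoeff l k * exp (-x) * ((x : ℂ) ^ (k + 1))⁻¹) * h

lemma hankel_imaginary_add_two (l : ℕ) {x : ℝ} (hx : 0 < x) :
    I ^ (l + 2) * sphericalHankel (l + 2) (I * x) = I ^ l * sphericalHankel l (I * x)
      + (2 * l + 3) / x * (I ^ (l + 1) * sphericalHankel (l + 1) (I * x)) := by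
  have hx' : (x : ℂ) ≠ 0 := by exact_mod_cast hx.ne'
  have hext : ∑ k ∈ Finset.range (l + 1), besselCoeff l k * ((x : ℂ) ^ (k + 1))⁻¹
      = ∑ k ∈ Finset.range (l + 3), besselCoeff l k * ((x : ℂ) ^ (k + 1))⁻¹ := by
    rw [Finset.sum_range_succ _ (l + 2), Finset.sum_range_succ _ (l + 1),
      besselCoeff_of_lt (show l < l + 1 by omega), besselCoeff_of_lt (show l < l + 2 by omega)]
    ring
  rw [hankel_imaginary _ x, hankel_imaginary _ x, hankel_imaginary _ x, hext,
    Finset.sum_range_succ' _ (l + 2), Finset.sum_range_succ' _ (l + 2), besselCoeff_zero, besselCoeff_zero]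
  simp only [besselCoeff_three_term, add_mul (besselCoeff l _), Finset.sum_add_distrib]
  have : ∑ k ∈ Finset.range (l + 2), (2 * l + 3) * besselCoeff (l + 1) k * ((x : ℂ) ^ (k + 1 + 1))⁻¹
      = (2 * l + 3) / x * ∑ k ∈ Finset.range (l + 1 + 1), besselCoeff (l + 1) k * ((x : ℂ) ^ (k + 1))⁻¹ := by
    rw [Finset.mul_sum]
    refine Finset.sum_congr rfl fun k _ => ?_
    rw [pow_succ _ (k + 1), mul_inv]; ring
  rw [this]
  ring

/-- Both sides satisfy the same two-step recursion in l, so l = 0 and l = 1 suffice; the latter uses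
K_{-1/2} = K_{1/2}. -/
lemma besselK_eq_hankel {x : ℝ} (hx : 0 < x) (l : ℕ) :
    -((Real.sqrt (2 / (Real.pi * x)) : ℝ) : ℂ) * (besselK ((l : ℝ) + 1 / 2) x : ℝ)
      = I ^ l * sphericalHankel l (I * x) := by
  have hx' : (x : ℂ) ≠ 0 := by exact_mod_cast hx.ne'
  have h0 : -((Real.sqrt (2 / (Real.pi * x)) : ℝ) : ℂ) * (besselK (1 / 2) x : ℝ)
      = I ^ 0 * sphericalHankel 0 (I * x) := by
    rw [hankel_imaginary _ x, besselK_half hx]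
    have : Real.sqrt (2 / (Real.pi * x)) * Real.sqrt (Real.pi / (2 * x)) = x⁻¹ := by
      rw [← Real.sqrt_mul (by positivity), show 2 / (Real.pi * x) * (Real.pi / (2 * x)) = x⁻¹ ^ 2 by
        have := Real.pi_pos.ne'
        field_simp, Real.sqrt_sq (by positivity)]
    have h2 : ((Real.sqrt (2 / (Real.pi * x)) : ℝ) : ℂ) * ((Real.sqrt (Real.pi / (2 * x)) : ℝ) : ℂ)
      = (x : ℂ)⁻¹ := by exact_mod_cast this
    simp only [zero_add, Finset.sum_range_one, besselCoeff_zero, pow_one, one_mul]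
    push_cast
    linear_combination -exp (-x) * h2
  induction l using Nat.twoStepInduction with
  | zero => simpa using h0
  | one =>
    have h1 := besselK_add_one (1 / 2) hx
    rw [show (1 / 2 : ℝ) - 1 = -(1 / 2) by norm_num, besselK_neg] at h1
    rw [Nat.cast_one, show (1 : ℝ) + 1 / 2 = 1 / 2 + 1 by norm_num, h1]
    have h2 : I ^ 1 * sphericalHankel 1 (I * x) = (1 + 1 / x) * (I ^ 0 * sphericalHankel 0 (I * x)) := by
      rw [hankel_imaginary _ x, hankel_imaginary _ x]
      have : besselCoeff 1 1 = 1 := by simp [besselCoeff]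
      simp only [Finset.sum_range_succ, Finset.sum_range_zero, besselCoeff_zero, this]
      field_simp
      ring
    rw [h2, ← h0]
    push_cast
    field_simp
  | more l ih1 ih2 =>
    have h1 := besselK_add_one ((l : ℝ) + 1 + 1 / 2) hx
    rw [show (l : ℝ) + 1 + 1 / 2 - 1 = l + 1 / 2 by ring] at h1
    push_cast at ih2 ⊢
    rw [show (l : ℝ) + 2 + 1 / 2 = l + 1 + 1 / 2 + 1 by ring, h1, hankel_imaginary_add_two l hx, ← ih1,
      ← ih2]
    push_cast
    ring

/-- The transfer coefficients at imaginary frequency. -/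
theorem transferCoeff_imaginary {ω : ℝ} (hω : 0 < ω) {a : E3} (ha : a ≠ 0) (p p' : LM) :
    transferCoeff (I * ω) a p p'
      = (Real.pi / (2 * ω) : ℝ) * I ^ ((p'.l : ℤ) - p.l) * wickCoeff ω a p p' := by
  have hω' : (ω : ℂ) ≠ 0 := by exact_mod_cast hω.ne'
  have hx : 0 < ω * ‖a‖ := mul_pos hω (norm_pos_iff.2 ha)
  rw [transferCoeff, wickCoeff, ← tsum_mul_left, ← tsum_mul_left]
  refine tsum_congr fun q => ?_
  have h := besselK_eq_hankel hx q.l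
  rw [← mul_assoc Real.pi] at h
  rw [show I * (ω : ℂ) * ‖a‖ = I * ((ω * ‖a‖ : ℝ) : ℂ) by push_cast; ring,
    show (q.l : ℤ) + p'.l - p.l = ((p'.l : ℤ) - p.l) + q.l by ring, zpow_add₀ I_ne_zero, zpow_natCast,
    show -(I * Real.pi / (2 * (I * ω))) = -(Real.pi / (2 * ω)) by field_simp]
  push_cast at h ⊢
  linear_combination ((Real.pi : ℂ) / (2 * ω)) * I ^ ((p'.l : ℤ) - p.l) * gauntC p p' q
    * sphericalHarmonic q a * h

/-- The polar form of (x₀ + i x₁)^n isolates the only non-real factor. On the z-axis `arg 0 = 0`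
agrees with the convention for the azimuth. -/
lemma exists_sphericalHarmonic_phase (p : LM) (x : E3) : ∃ s : ℝ, sphericalHarmonic p x
    = s * exp (I * (p.m : ℂ) * (arg ((x 0 : ℂ) + I * (x 1 : ℂ)) : ℂ)) := by
  set w : ℂ := (x 0 : ℂ) + I * (x 1 : ℂ)
  have key : ∀ l n : ℕ, ∃ s : ℝ, harmonicNonneg l n x = s * exp (I * (n : ℂ) * (arg w : ℂ)) := by
    intro l n
    have hw : w ^ n = (‖w‖ : ℂ) ^ n * exp (I * n * (arg w : ℂ)) := by
      nth_rewrite 1 [← Complex.norm_mul_exp_arg_mul_I w]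
      rw [mul_pow, ← Complex.exp_nat_mul]
      congr 2; ring
    refine ⟨(-1) ^ n * Real.sqrt ((2 * l + 1) / (4 * Real.pi)
        * ((l - n).factorial / (l + n).factorial))
      * ((Polynomial.derivative^[l + n] ((Polynomial.X ^ 2 - 1 : Polynomial ℝ) ^ l)).eval
        (x 2 / ‖x‖) / (2 ^ l * l.factorial)) * (‖w‖ ^ n / ‖x‖ ^ n), ?_⟩
    rw [harmonicNonneg, div_pow, hw, mul_div_right_comm, ← mul_assoc]
    push_cast
    rfl
  obtain ⟨s, hs⟩ := key p.l p.m.natAbs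
  rw [sphericalHarmonic]
  split_ifs with h
  · refine ⟨s, ?_⟩
    rw [hs, show ((p.m.natAbs : ℕ) : ℂ) = (p.m : ℂ) by
      rw [← Int.cast_natCast, Int.natAbs_of_nonneg h]]
  · refine ⟨(-1) ^ p.m.natAbs * s, ?_⟩
    have hm : ((p.m.natAbs : ℕ) : ℂ) = -(p.m : ℂ) := by
      have : ((p.m.natAbs : ℕ) : ℤ) = -p.m := by omega
      rw [← Int.cast_natCast, this, Int.cast_neg]
    rw [hs, map_mul, Complex.conj_ofReal, ← Complex.exp_conj, map_mul, map_mul, conj_I, conj_ofReal,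
      Complex.conj_natCast, hm]
    push_cast
    rw [show -I * -(p.m : ℂ) * (arg w : ℂ) = I * p.m * (arg w : ℂ) by ring]
    ring

/-- Up to a phase, the Wick-rotated coefficients are real. -/
theorem exists_wickCoeff_phase (ω : ℝ) (a : E3) (p p' : LM) : ∃ s : ℝ, wickCoeff ω a p p' =
    s * exp (I * ((p.m - p'.m : ℤ) : ℂ) * (arg ((a 0 : ℂ) + I * (a 1 : ℂ)) : ℂ)) := by
  choose Y hY using fun q : LM => exists_sphericalHarmonic_phase q a
  have h : ∀ q : LM, ∃ s : ℝ, gauntC p p' q * (Real.sqrt (2 / (Real.pi * ω * ‖a‖)) : ℝ)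
      * (besselK ((q.l : ℝ) + 1 / 2) (ω * ‖a‖) : ℝ) * sphericalHarmonic q a
      = s * exp (I * ((p.m - p'.m : ℤ) : ℂ) * (arg ((a 0 : ℂ) + I * (a 1 : ℂ)) : ℂ)) := by
    intro q
    -- Only harmonics with m'' = m - m' contribute, so all nonzero terms share one phase.
    by_cases hm : p.m = p'.m + q.m
    · obtain ⟨g, hg⟩ : ∃ g : ℝ, gauntC p p' q = g := ⟨_, gauntC_eq_wigner3j p p' q⟩
      refine ⟨g * Real.sqrt (2 / (Real.pi * ω * ‖a‖)) * besselK ((q.l : ℝ) + 1 / 2) (ω * ‖a‖) * Y q, ?_⟩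
      rw [hY, hg, show p.m - p'.m = q.m by omega]
      push_cast
      ring
    · exact ⟨0, by rw [gauntC_eq_zero_of_m_ne p p' q hm]; simp⟩
  choose s hs using h
  refine ⟨∑' q, s q, ?_⟩
  rw [wickCoeff, tsum_congr hs, tsum_mul_right, ofReal_tsum]

end SphericalWaves
end

/-! ### The theorem, with frequency k = ω and k = iω. -/

theorem mainTheorem6 (ω : ℝ) (hω : 0 < ω) (PA PB : E3) (hP : PA ≠ PB) :
    -- the coefficients `C` in terms of 3j symbols
    (∀ p p' p'' : LM, gauntC p p' p'' =
      (((-1) ^ p.m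
        * Real.sqrt (4 * Real.pi * (2 * p.l + 1) * (2 * p'.l + 1) * (2 * p''.l + 1))
        * wigner3j p.l p'.l p''.l 0 0 0
        * wigner3j p.l p'.l p''.l p.m (-p'.m) (-p''.m) : ℝ) : ℂ)) ∧
    -- the sums over `(l'', m'')` have finitely many nonzero terms
    (∀ p p' : LM, {p'' : LM | gauntC p p' p'' ≠ 0}.Finite) ∧
    -- the expansion, as an unconditionally convergent double series
    (∀ x y : E3, ‖x - PA‖ + ‖y - PB‖ < ‖PB - PA‖ →
      HasSum (fun q : LM × LM => expansionTerm ω PA PB x y q.1 q.2) (freePropagator ω x y)) ∧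
    -- the expansion, as an iterated series on a larger set
    (∀ x y : E3, ‖y - PB‖ < ‖PB - PA‖ → ‖x - PA‖ < ‖y - PA‖ →
      (∀ p : LM, Summable (fun p' : LM => expansionTerm ω PA PB x y p p')) ∧
      HasSum (fun p : LM => ∑' p' : LM, expansionTerm ω PA PB x y p p')
        (freePropagator ω x y)) ∧
    -- the Wick-rotated coefficients
    (∀ p p' : LM, transferCoeff (Complex.I * ω) (PB - PA) p p' =
      (Real.pi / (2 * ω) : ℝ) * Complex.I ^ ((p'.l : ℤ) - p.l) * wickCoeff ω (PB - PA) p p') ∧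
    -- they are real up to the phase `exp (i (m - m') φ)`, `φ` the azimuth of `a`
    (∀ p p' : LM, ∃ s : ℝ, wickCoeff ω (PB - PA) p p' =
      s * Complex.exp (Complex.I * ((p.m - p'.m : ℤ) : ℂ)
        * (Complex.arg (((PB - PA) 0 : ℂ) + Complex.I * ((PB - PA) 1 : ℂ)) : ℂ))) ∧
    -- the Wick-rotated expansion
    (∀ x y : E3, ‖x - PA‖ + ‖y - PB‖ < ‖PB - PA‖ →
      HasSum (fun q : LM × LM => wickTerm ω PA PB x y q.1 q.2)
        (freePropagator (Complex.I * ω) x y)) ∧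
    (∀ x y : E3, ‖y - PB‖ < ‖PB - PA‖ → ‖x - PA‖ < ‖y - PA‖ →
      (∀ p : LM, Summable (fun p' : LM => wickTerm ω PA PB x y p p')) ∧
      HasSum (fun p : LM => ∑' p' : LM, wickTerm ω PA PB x y p p')
        (freePropagator (Complex.I * ω) x y)) := by
  have hω' : (ω : ℂ) ≠ 0 := by exact_mod_cast hω.ne'
  have hIω : Complex.I * (ω : ℂ) ≠ 0 := mul_ne_zero Complex.I_ne_zero hω'
  have ha : PB - PA ≠ 0 := sub_ne_zero.2 hP.symm
  refine ⟨gauntC_eq_wigner3j, finite_gauntC_ne_zero, fun x y h => ?_, fun x y h1 h2 => ?_,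
    transferCoeff_imaginary hω ha, exists_wickCoeff_phase ω (PB - PA), fun x y h => ?_,
    fun x y h1 h2 => ?_⟩
  · simp only [expansionTerm_eq]
    exact hasSum_waveTerm hω' h
  · simp only [expansionTerm_eq]
    exact hasSum_waveTerm_iterated hω' h1 h2
  · simp only [wickTerm_eq]
    exact hasSum_waveTerm hIω h
  · simp only [wickTerm_eq]
    exact hasSum_waveTerm_iterated hIω h1 h2
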